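/- Let "of class $\mathcal C$" mean either smooth ($C^\infty$) or $\mathbb R$-analytic, the same throughout. A singular symplectic form-germ of class $\mathcal C$ on $\mathbb R^4$ is a germ at $0$ of a closed $2$-form $\omega$ of class $\mathcal C$ whose Martinet hypersurface $\Sigma_2(\omega)=\{x:\ (\omega\wedge\omega)_x=0\}$ is nowhere dense near $0$. Writing $\omega\wedge\omega=f\,dx_1\wedge dx_2\wedge dx_3\wedge dx_4$, the Martinet hypersurface is called structurally smooth at $0$ if $f(0)=0$ and $df_0\neq 0$; then it is a smooth hypersurface-germ. Theorem. Let $\omega_0,\omega_1$ be singular symplectic form-germs of class $\mathcal C$ at $0$ on $\mathbb R^4$ whose Martinet hypersurfaces are structurally smooth at $0$ and coincide as set-germs at $0$; call the common germ $\Sigma_2$. Let $\iota:(\mathbb R^3,0)\to(\mathbb R^4,0)$ be the inclusion $\Sigma_2\hookrightarrow\mathbb R^4$ written in local coordinates of class $\mathcal C$ on $\Sigma_2$ at $0$ (an immersion-germ of class $\mathcal C$ parametrizing $\Sigma_2$). Suppose that $\iota^*\omega_0=\iota^*\omega_1=\sigma$ as germs at $0$ and $\sigma|_0=0$. Write $$\sigma=a\,dy\wedge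 dz+b\,dz\wedge dx+c\,dx\wedge dy ,$$ let $R$ be the ring of function-germs of class $\mathcal C$ at $0$ on $\mathbb R^3$, and let $I(\sigma)=\langle a,b,c\rangle\subset R$. Suppose that $I(\sigma)=\langle g_1,g_2\rangle$ for some $g_1,g_2\in R$ that form a regular sequence in $R$: $g_1$ is a non-zero-divisor of $R$ and $g_2$ is a non-zero-divisor of $R/\langle g_1\rangle$. Then there exists a diffeomorphism-germ $\Psi:(\mathbb R^4,0)\to(\mathbb R^4,0)$ of class $\mathcal C$ such that $$\Psi^*\omega_1=\omega_0 .$$ -/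

import Mathlib

open Filter Topology
open scoped ContDiff

/-- A map defined near `0` is a germ of class `n`: it is of class `n` on a whole neighbourhood
of `0` (for `n = ∞` one neighbourhood serves all orders; for `n = ω` this is analyticity). -/
def IsGermOfClass {E F : Type*} [NormedAddCommGroup E] [NormedSpace ℝ E]
    [NormedAddCommGroup F] [NormedSpace ℝ F] (n : WithTop ℕ∞) (f : E → F) : Prop :=
  ∀ᶠ x in 𝓝 (0 : E), ContDiffAt ℝ n f x

/-- The ring of function-germs of class `n` at `0 ∈ E`, as a subring of all germs at `0`. -/
def functionGerms (n : WithTop ℕ∞) (E : Type*) [NormedAddCommGroup E] [NormedSpace ℝ E] :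
    Subring (Germ (𝓝 (0 : E)) ℝ) where
  carrier := {g | ∃ f : E → ℝ, IsGermOfClass n f ∧ (f : Germ (𝓝 (0 : E)) ℝ) = g}
  zero_mem' := ⟨0, Eventually.of_forall fun _ => contDiffAt_const, rfl⟩
  one_mem' := ⟨1, Eventually.of_forall fun _ => contDiffAt_const, rfl⟩
  add_mem' := by
    rintro _ _ ⟨f, hf, rfl⟩ ⟨g, hg, rfl⟩
    exact ⟨f + g, by filter_upwards [hf, hg] with x h1 h2 using h1.add h2, rfl⟩
  mul_mem' := by
    rintro _ _ ⟨f, hf, rfl⟩ ⟨g, hg, rfl⟩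
    exact ⟨f * g, by filter_upwards [hf, hg] with x h1 h2 using h1.mul h2, rfl⟩
  neg_mem' := by
    rintro _ ⟨f, hf, rfl⟩
    exact ⟨-f, by filter_upwards [hf] with x h1 using h1.neg, rfl⟩

/-- The pullback `φ^* η` of a differential 2-form `η` under a map `φ`. -/
noncomputable def pullback {E F : Type*} [NormedAddCommGroup E] [NormedSpace ℝ E]
    [NormedAddCommGroup F] [NormedSpace ℝ F] (φ : E → F) (η : F → F [⋀^Fin 2]→L[ℝ] ℝ) :
    E → E [⋀^Fin 2]→L[ℝ] ℝ :=
  fun x => (η (φ x)).compContinuousLinearMap (fderiv ℝ φ x)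

/-- The coefficient `η(e_i, e_j)` of a 2-form on `ℝ^m`. -/
noncomputable def coeff {m : ℕ} (η : (Fin m → ℝ) → (Fin m → ℝ) [⋀^Fin 2]→L[ℝ] ℝ)
    (i j : Fin m) (x : Fin m → ℝ) : ℝ :=
  η x ![Pi.single i 1, Pi.single j 1]

/-- The function `f` with `η ∧ η = f dx₁ ∧ dx₂ ∧ dx₃ ∧ dx₄`, for a 2-form `η` on `ℝ⁴`. -/
noncomputable def squareCoeff (η : (Fin 4 → ℝ) → (Fin 4 → ℝ) [⋀^Fin 2]→L[ℝ] ℝ)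
    (x : Fin 4 → ℝ) : ℝ :=
  2 * (coeff η 0 1 x * coeff η 2 3 x - coeff η 0 2 x * coeff η 1 3 x
    + coeff η 0 3 x * coeff η 1 2 x)

/-- The Martinet hypersurface `Σ₂(η)`: the points where `η ∧ η` vanishes. -/
def martinet (η : (Fin 4 → ℝ) → (Fin 4 → ℝ) [⋀^Fin 2]→L[ℝ] ℝ) : Set (Fin 4 → ℝ) :=
  {x | squareCoeff η x = 0}

/-- `η` represents a germ at `0` of a singular symplectic form of class `n` on `ℝ⁴`: it is closed
and, near `0`, the set where `η ∧ η` vanishes is nowhere dense. -/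
structure IsSingularSymplecticGerm (n : WithTop ℕ∞)
    (η : (Fin 4 → ℝ) → (Fin 4 → ℝ) [⋀^Fin 2]→L[ℝ] ℝ) : Prop where
  isGermOfClass : IsGermOfClass n η
  closed : ∀ᶠ x in 𝓝 0, extDeriv η x = 0
  nowhereDense : ∃ U ∈ 𝓝 (0 : Fin 4 → ℝ), IsNowhereDense (martinet η ∩ U)

/-- The Martinet hypersurface of `η` is structurally smooth at `0`: `f(0) = 0` and `df₀ ≠ 0`,
where `η ∧ η = f dx₁ ∧ dx₂ ∧ dx₃ ∧ dx₄`. -/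
def IsStructurallySmooth (η : (Fin 4 → ℝ) → (Fin 4 → ℝ) [⋀^Fin 2]→L[ℝ] ℝ) : Prop :=
  squareCoeff η 0 = 0 ∧ fderiv ℝ (squareCoeff η) 0 ≠ 0

/-- `ι` is a local parametrization of class `n` at `0` of the hypersurface-germ `S ⊆ ℝ⁴`, i.e. the
inclusion `S ↪ ℝ⁴` written in local coordinates `(ℝ³, 0)` of `S`: an immersion which maps the
small neighbourhoods of `0` onto the small neighbourhoods of `0` in `S`. -/
structure IsLocalParametrization (n : WithTop ℕ∞) (ι : (Fin 3 → ℝ) → (Fin 4 → ℝ))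
    (S : Set (Fin 4 → ℝ)) : Prop where
  isGermOfClass : IsGermOfClass n ι
  map_zero : ι 0 = 0
  immersion : Function.Injective (fderiv ℝ ι 0)
  map_nhds : Filter.map ι (𝓝 0) = 𝓝[S] 0

/-- The ideal `I(σ)`, in the ring of function-germs of class `n` on `ℝ³`, generated by the
coefficients of the 2-form-germ `σ`. -/
noncomputable def coeffIdeal (n : WithTop ℕ∞) (σ : (Fin 3 → ℝ) → (Fin 3 → ℝ) [⋀^Fin 2]→L[ℝ] ℝ) :
    Ideal (functionGerms n (Fin 3 → ℝ)) :=
  Ideal.span {g | ∃ i j : Fin 3, (g : Germ (𝓝 (0 : Fin 3 → ℝ)) ℝ) = (coeff σ i j : Germ _ ℝ)}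

/-- `Ψ`, a homeomorphism between open sets of `E`, represents a diffeomorphism-germ
`(E, 0) → (E, 0)` of class `n`. -/
structure IsDiffeoGerm {E : Type*} [NormedAddCommGroup E] [NormedSpace ℝ E] (n : WithTop ℕ∞)
    (Ψ : OpenPartialHomeomorph E E) : Prop where
  zero_mem : (0 : E) ∈ Ψ.source
  map_zero : Ψ 0 = 0
  contDiffOn : ContDiffOn ℝ n Ψ Ψ.source
  contDiffOn_symm : ContDiffOn ℝ n Ψ.symm Ψ.target

/-! Straighten Σ₂ to the hyperplane x₃ = 0 and write ω_i = σ + dx₃ ∧ α_i along it, where α_i is the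
contraction of ω_i with ∂/∂x₃. On the hyperplane, ω_i ∧ ω_i = 0 means σ ∧ α_i = 0. Since σ(0) = 0,
closedness turns structural smoothness into α_i ∧ dα_i ≠ 0 at 0 (`fderiv_squareCoeff`): each α_i is
a contact form.

The regular sequence enters once. Both α_i annihilate the vector (a, b, c) dual to σ, so α₀ ∧ α₁ is
proportional to σ at each point; the algebra of `exists_eq_mul_of_proportional` upgrades this to α₀
∧ α₁ = hσ with h of class C. At the origin this gives α₁ = kα₀ with k ≠ 0, and its differential
gives α₀ ∧ dα₁ = α₁ ∧ dα₀ there, because σ(0) = 0 and dσ = 0 (`exists_proportional_contractions`).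
Hence α_s = (1 - s)α₀ + sα₁ satisfies α_s ∧ dα_s = (1 - s + sk)² α₀ ∧ dα₀ at 0. If k > 0 this never
vanishes on [0, 1]; if k < 0, straightening ω₁ with the opposite transverse vector reverses α₁ and
makes k positive.

Now Moser's method applies to ω_s = ω₀ + s(ω₁ - ω₀). The relative Poincaré lemma gives ω₁ - ω₀ =
d(x₃γ). The equation i_V ω_s = -x₃γ degenerates on Σ₂, but ω_s is inverted by a polynomial adjugate
up to its Pfaffian, and this Pfaffian is x₃κ/2 with κ ≠ 0 near 0; the factor x₃ cancels. The
solution V vanishes at 0 because γ and α_s are both multiples of α₀ there. The flow of V makes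
nearby ω_s equivalent (`eventually_germEquiv_of_homological`), and connectedness of [0, 1] links ω₀
to ω₁.

The smooth and analytic cases run in parallel. Flows and averages are built from the operator v ↦ G
∘ v on continuous functions over a compact space, which is smooth if G is and analytic near a
constant function at whose value G is analytic; flows then come from the inverse function theorem.
-/

/-! ### Regularity of superposition operators on spaces of continuous functions. -/

section Superposition

variable {K Y Z : Type} [TopologicalSpace K] [CompactSpace K]
  [NormedAddCommGroup Y] [NormedSpace ℝ Y] [NormedAddCommGroup Z] [NormedSpace ℝ Z]

/-- Pointwise application of a continuous family of linear maps to a continuous function. -/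
noncomputable def pointwiseApply (K Y Z : Type) [TopologicalSpace K] [CompactSpace K]
    [NormedAddCommGroup Y] [NormedSpace ℝ Y] [NormedAddCommGroup Z] [NormedSpace ℝ Z] :
    C(K, Y →L[ℝ] Z) →L[ℝ] C(K, Y) →L[ℝ] C(K, Z) :=
  LinearMap.mkContinuous₂
    (LinearMap.mk₂ ℝ (fun (A : C(K, Y →L[ℝ] Z)) (h : C(K, Y)) =>
        (⟨fun s => A s (h s), A.continuous.clm_apply h.continuous⟩ : C(K, Z)))
      (fun _ _ _ => by ext; simp) (fun _ _ _ => by ext; simp)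
      (fun _ _ _ => by ext; simp) (fun _ _ _ => by ext; simp)) 1
    (fun A h => by
      rw [ContinuousMap.norm_le _ (by positivity)]
      intro s
      simp only [LinearMap.mk₂_apply, ContinuousMap.coe_mk, one_mul]
      exact ((A s).le_opNorm _).trans
        (mul_le_mul (A.norm_coe_le_norm s) (h.norm_coe_le_norm s) (by positivity) (by positivity)))

@[simp] lemma pointwiseApply_apply (A : C(K, Y →L[ℝ] Z)) (h : C(K, Y)) (s : K) :
    pointwiseApply K Y Z A h s = A s (h s) := rfl

/-- Mean value inequality at each s. Uniformity in s needs no local compactness of Y: a point of the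
segment from u(s) to v(s) is the value at s of a function on the segment from u to v, and w ↦ G' ∘ w
is continuous at u in the sup metric. -/
lemma hasFDerivAt_superposition (G : C(Y, Z)) (G' : C(Y, Y →L[ℝ] Z))
    (hG : ∀ y, HasFDerivAt G (G' y) y) (u : C(K, Y)) :
    HasFDerivAt (fun v : C(K, Y) => G.comp v) (pointwiseApply K Y Z (G'.comp u)) u := by
  rw [hasFDerivAt_iff_isLittleO, Asymptotics.isLittleO_iff]
  intro c hc
  have hcont : ContinuousAt (fun v : C(K, Y) => G'.comp v) u :=
    (ContinuousMap.continuous_postcomp G').continuousAt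
  have hmem : ∀ᶠ v in 𝓝 u, dist (G'.comp v) (G'.comp u) < c :=
    hcont.eventually (p := fun A => dist A (G'.comp u) < c)
      (Metric.eventually_nhds_iff.2 ⟨c, hc, fun _ h => h⟩)
  obtain ⟨δ, hδ, H⟩ := Metric.eventually_nhds_iff.1 hmem
  filter_upwards [Metric.ball_mem_nhds u hδ] with v hv
  rw [ContinuousMap.norm_le _ (by positivity)]
  intro s
  have hs : ∀ w ∈ segment ℝ (u s) (v s), ‖G' w - G' (u s)‖ ≤ c := by
    intro w hw
    obtain ⟨t, ht, rfl⟩ := (segment_eq_image' ℝ (u s) (v s)) ▸ hw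
    have h1 : dist (u + t • (v - u)) u < δ := by
      rw [dist_eq_norm, add_sub_cancel_left, norm_smul, Real.norm_of_nonneg ht.1]
      calc t * ‖v - u‖ ≤ 1 * ‖v - u‖ := by gcongr; exact ht.2
        _ < δ := by rw [one_mul, ← dist_eq_norm]; exact hv
    have h2 := (ContinuousMap.dist_apply_le_dist s).trans (H h1).le
    rw [← dist_eq_norm]
    exact h2
  have := (convex_segment (𝕜 := ℝ) (u s) (v s)).norm_image_sub_le_of_norm_hasFDerivWithin_le'
    (fun x _ => (hG x).hasFDerivWithinAt) hs (left_mem_segment ℝ _ _) (right_mem_segment ℝ _ _)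
  refine (this.trans ?_ :)
  gcongr
  exact (v - u).norm_coe_le_norm s

/-- The derivative is again a superposition operator, that of the derivative of G, followed by a
bounded linear map. The target space changes at each stage, so it is quantified inside the
induction. -/
lemma contDiff_superposition_nat (m : ℕ) : ∀ {Z : Type} [NormedAddCommGroup Z] [NormedSpace ℝ Z]
    (G : C(Y, Z)), ContDiff ℝ ∞ G → ContDiff ℝ m (fun v : C(K, Y) => G.comp v) := by
  induction m with
  | zero =>
    intro Z _ _ G _
    exact contDiff_zero.2 (ContinuousMap.continuous_postcomp G)
  | succ m ih =>
    intro Z _ _ G hG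
    have hG' : ContDiff ℝ ∞ (fderiv ℝ G) := hG.fderiv_right (by simp)
    set G' : C(Y, Y →L[ℝ] Z) := ⟨fderiv ℝ G, hG'.continuous⟩
    have hd : ∀ u : C(K, Y), HasFDerivAt (fun v : C(K, Y) => G.comp v)
        (pointwiseApply K Y Z (G'.comp u)) u :=
      hasFDerivAt_superposition G G' fun y => (hG.differentiable (by simp) y).hasFDerivAt
    push_cast
    rw [contDiff_succ_iff_fderiv]
    refine ⟨fun u => (hd u).differentiableAt, by simp, ?_⟩
    rw [show fderiv ℝ (fun v : C(K, Y) => G.comp v) =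
      fun u => pointwiseApply K Y Z (G'.comp u) from funext fun u => (hd u).fderiv]
    exact (pointwiseApply K Y Z).contDiff.comp (ih G' hG')

lemma contDiff_superposition (G : C(Y, Z)) (hG : ContDiff ℝ ∞ G) :
    ContDiff ℝ ∞ (fun v : C(K, Y) => G.comp v) :=
  contDiff_infty.2 fun m => contDiff_superposition_nat m G hG

/-- Pointwise application of a continuous multilinear map to continuous functions. -/
noncomputable def pointwiseMultilinear (K : Type) [TopologicalSpace K] [CompactSpace K] {m : ℕ}
    (p : Y [×m]→L[ℝ] Z) : C(K, Y) [×m]→L[ℝ] C(K, Z) :=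
  MultilinearMap.mkContinuous
    { toFun := fun h => ⟨fun s => p fun i => h i s,
        p.cont.comp (continuous_pi fun i => (h i).continuous)⟩
      map_update_add' := fun h i a b => by
        ext s
        have key : ∀ c : C(K, Y), (fun j => Function.update h i c j s) =
            Function.update (fun j => h j s) i (c s) := fun c => by
          ext j; by_cases hj : j = i
          · subst hj; simp
          · simp [hj]
        simp [key]
      map_update_smul' := fun h i a b => by
        ext s
        have key : ∀ c : C(K, Y), (fun j => Function.update h i c j s) =
            Function.update (fun j => h j s) i (c s) := fun c => by
          ext j; by_cases hj : j = i
          · subst hj; simp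
          · simp [hj]
        simp [key] } ‖p‖
    (fun h => by
      rw [ContinuousMap.norm_le _ (by positivity)]
      intro s
      refine (p.le_opNorm _).trans ?_
      gcongr with i
      exact (h i).norm_coe_le_norm s)

lemma norm_pointwiseMultilinear_le {m : ℕ} (p : Y [×m]→L[ℝ] Z) :
    ‖pointwiseMultilinear K p‖ ≤ ‖p‖ :=
  MultilinearMap.mkContinuous_norm_le _ (norm_nonneg _) _

/-- The power series of the superposition operator at a constant function. -/
noncomputable def superpositionSeries (K : Type) [TopologicalSpace K] [CompactSpace K]
    (p : FormalMultilinearSeries ℝ Y Z) : FormalMultilinearSeries ℝ C(K, Y) C(K, Z) :=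
  fun m => pointwiseMultilinear K (p m)

lemma radius_le_superpositionSeries (p : FormalMultilinearSeries ℝ Y Z) :
    p.radius ≤ (superpositionSeries K p).radius := by
  refine ENNReal.le_of_forall_nnreal_lt fun ρ hρ => ?_
  obtain ⟨C, _, hC⟩ := p.norm_mul_pow_le_of_lt_radius hρ
  refine (superpositionSeries K p).le_radius_of_bound C fun m => (le_trans ?_ (hC m))
  exact mul_le_mul_of_nonneg_right (norm_pointwiseMultilinear_le (p m)) (by positivity)

/-- At a constant function the Taylor coefficients of G are the same for all s, and ‖h(s)‖ ≤ ‖h‖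
keeps the radius. Evaluation at each s identifies the sum. -/
lemma hasFPowerSeriesOnBall_superposition [CompleteSpace Z] (G : C(Y, Z)) (y₀ : Y)
    {p : FormalMultilinearSeries ℝ Y Z} {r : ENNReal} (hp : HasFPowerSeriesOnBall G p y₀ r) :
    HasFPowerSeriesOnBall (fun v : C(K, Y) => G.comp v) (superpositionSeries K p)
      (ContinuousMap.const K y₀) r where
  r_le := hp.r_le.trans (radius_le_superpositionSeries p)
  r_pos := hp.r_pos
  hasSum := by
    intro h hh
    have hs : HasSum (fun m => superpositionSeries K p m fun _ => h)
        ((superpositionSeries K p).sum h) :=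
      (superpositionSeries K p).hasSum
        (Metric.eball_subset_eball (hp.r_le.trans (radius_le_superpositionSeries p)) hh)
    suffices hsum : G.comp (ContinuousMap.const K y₀ + h) = (superpositionSeries K p).sum h by
      rw [hsum]; exact hs
    ext s
    have h1 : HasSum (fun m => (superpositionSeries K p m fun _ => h) s)
        ((superpositionSeries K p).sum h s) := by
      have := hs.map (ContinuousMap.evalCLM ℝ s : C(K, Z) →L[ℝ] Z)
        (ContinuousMap.evalCLM ℝ s : C(K, Z) →L[ℝ] Z).continuous
      exact this
    have h2 : HasSum (fun m => p m fun _ => h s) (G (y₀ + h s)) := by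
      refine hp.hasSum ?_
      have hn : ‖h s‖ₑ ≤ ‖h‖ₑ := by
        rw [enorm_le_iff_norm_le]
        exact h.norm_coe_le_norm s
      rw [Metric.mem_eball, edist_zero_right] at hh ⊢
      exact hn.trans_lt hh
    exact h2.unique h1

lemma analyticAt_superposition [CompleteSpace Z] (G : C(Y, Z)) (y₀ : Y) (hG : AnalyticAt ℝ G y₀) :
    AnalyticAt ℝ (fun v : C(K, Y) => G.comp v) (ContinuousMap.const K y₀) := by
  obtain ⟨p, r, hp⟩ := hG
  exact ⟨superpositionSeries K p, r, hasFPowerSeriesOnBall_superposition G y₀ hp⟩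

end Superposition

/-! ### Extension of germs, and the inverse function theorem for germs. -/

/-- A germ at `a` of class `n`, smooth or analytic, extends to a globally smooth function. -/
lemma exists_contDiff_extension {Y Z : Type} [NormedAddCommGroup Y] [NormedSpace ℝ Y]
    [FiniteDimensional ℝ Y] [NormedAddCommGroup Z] [NormedSpace ℝ Z]
    {n : WithTop ℕ∞} (hn : n = ∞ ∨ n = ω) {g : Y → Z} {a : Y}
    (hg : ∀ᶠ y in 𝓝 a, ContDiffAt ℝ n g y) :
    ∃ G : Y → Z, ContDiff ℝ ∞ G ∧ G =ᶠ[𝓝 a] g := by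
  have hn' : (∞ : WithTop ℕ∞) ≤ n := by rcases hn with rfl | rfl <;> simp
  obtain ⟨r, hr, hb⟩ := Metric.nhds_basis_closedBall.eventually_iff.1 hg
  let b : ContDiffBump a := ⟨r / 2, r, by positivity, by linarith⟩
  refine ⟨fun y => b y • g y, ?_, ?_⟩
  · rw [contDiff_iff_contDiffAt]
    intro y
    by_cases hy : y ∈ Metric.closedBall a r
    · exact b.contDiffAt.smul ((hb hy).of_le hn')
    · have : (fun y => b y • g y) =ᶠ[𝓝 y] fun _ => 0 := by
        filter_upwards [Metric.isClosed_closedBall.isOpen_compl.mem_nhds hy] with z hz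
        have hz' : r < dist z a := by simpa using hz
        rw [b.zero_of_le_dist hz'.le, zero_smul]
      exact contDiffAt_const.congr_of_eventuallyEq this
  · filter_upwards [b.eventuallyEq_one] with y hy
    simp [hy]

lemma eventually_contDiffAt_superposition {K Y Z : Type} [TopologicalSpace K] [CompactSpace K]
    [NormedAddCommGroup Y] [NormedSpace ℝ Y] [NormedAddCommGroup Z] [NormedSpace ℝ Z]
    [CompleteSpace Z] {n : WithTop ℕ∞} (hn : n = ∞ ∨ n = ω) (G : C(Y, Z)) (hG : ContDiff ℝ ∞ G)
    (y₀ : Y) (h : ContDiffAt ℝ n G y₀) :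
    ∀ᶠ v in 𝓝 (ContinuousMap.const K y₀), ContDiffAt ℝ n (fun v : C(K, Y) => G.comp v) v := by
  rcases hn with rfl | rfl
  · exact Eventually.of_forall fun v => (contDiff_superposition G hG).contDiffAt
  · filter_upwards [(analyticAt_superposition (K := K) G y₀
      (by simpa using h.analyticAt)).eventually_analyticAt] with v hv
    exact hv.contDiffAt

/-- The inverse function theorem for germs. -/
lemma exists_openPartialHomeomorph {E F : Type*} [NormedAddCommGroup E] [NormedSpace ℝ E]
    [CompleteSpace E] [NormedAddCommGroup F] [NormedSpace ℝ F]
    {n : WithTop ℕ∞} (hn : 1 ≤ n) {f : E → F} {a : E} (hf : ∀ᶠ x in 𝓝 a, ContDiffAt ℝ n f x)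
    (f' : E ≃L[ℝ] F) (hf' : HasFDerivAt f (f' : E →L[ℝ] F) a) :
    ∃ Ψ : OpenPartialHomeomorph E F, ⇑Ψ = f ∧ a ∈ Ψ.source ∧
      (∀ x ∈ Ψ.source, ContDiffAt ℝ n f x) ∧ ∀ y ∈ Ψ.target, ContDiffAt ℝ n Ψ.symm y := by
  have hn0 : n ≠ 0 := (lt_of_lt_of_le one_pos hn).ne'
  have hfa := hf.self_of_nhds
  have hinv : ∀ᶠ x in 𝓝 a, ∃ e : E ≃L[ℝ] F, (e : E →L[ℝ] F) = fderiv ℝ f x := by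
    have hc : ContinuousAt (fderiv ℝ f) a := (hfa.fderiv_right (m := 0) (by simpa)).continuousAt
    have : ∀ᶠ A in 𝓝 (fderiv ℝ f a), ∃ e : E ≃L[ℝ] F, (e : E →L[ℝ] F) = A := by
      rw [hf'.fderiv]
      exact ContinuousLinearEquiv.nhds f'
    exact hc.eventually this
  -- Restricting to a set on which the derivative stays invertible makes the inverse of class `n` on
  -- the whole target, not only at the image of `a`.
  obtain ⟨U, hU, hUo, haU⟩ := eventually_nhds_iff.1 (hf.and hinv)
  set Φ := hfa.toOpenPartialHomeomorph f hf' hn0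
  refine ⟨Φ.restrOpen U hUo, rfl, ⟨hfa.mem_toOpenPartialHomeomorph_source hf' hn0, haU⟩,
    fun x hx => (hU x hx.2).1, fun y hy => ?_⟩
  have hx : (Φ.restrOpen U hUo).symm y ∈ (Φ.restrOpen U hUo).source :=
    (Φ.restrOpen U hUo).map_target hy
  obtain ⟨h1, e, he⟩ := hU _ hx.2
  refine (Φ.restrOpen U hUo).contDiffAt_symm (f₀' := e) hy ?_ h1
  rw [he]
  exact (h1.differentiableAt hn0).hasFDerivAt

/-! ### Local flows of class C through an integral equation. -/

section Flow

/-- The time interval `[-1, 1]`. -/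
abbrev timeInterval : Set ℝ := Set.Icc (-1 : ℝ) 1

lemma neg_one_le_one_real : (-1 : ℝ) ≤ 1 := by norm_num

section ExtendTime

variable {Y : Type} [NormedAddCommGroup Y]

/-- The extension of a function on `[-1, 1]` to the real line, constant outside. -/
noncomputable def extendTime (u : C(timeInterval, Y)) : ℝ → Y :=
  Set.IccExtend neg_one_le_one_real u

lemma continuous_extendTime (u : C(timeInterval, Y)) : Continuous (extendTime u) :=
  u.continuous.Icc_extend'

lemma extendTime_of_mem (u : C(timeInterval, Y)) {r : ℝ} (hr : r ∈ timeInterval) :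
    extendTime u r = u ⟨r, hr⟩ := Set.IccExtend_of_mem _ _ hr

lemma extendTime_coe (u : C(timeInterval, Y)) (r : timeInterval) :
    extendTime u r = u r := extendTime_of_mem u r.2

lemma norm_extendTime_le (u : C(timeInterval, Y)) (r : ℝ) : ‖extendTime u r‖ ≤ ‖u‖ :=
  u.norm_coe_le_norm _

end ExtendTime

variable {Y : Type} [NormedAddCommGroup Y] [NormedSpace ℝ Y]

/-- The primitive vanishing at `0`, as an operator on continuous functions on `[-1, 1]`. -/
noncomputable def primitive (Y : Type) [NormedAddCommGroup Y] [NormedSpace ℝ Y] :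
    C(timeInterval, Y) →L[ℝ] C(timeInterval, Y) :=
  LinearMap.mkContinuous
    { toFun := fun u => ⟨fun τ => ∫ r in (0 : ℝ)..τ, extendTime u r,
        (intervalIntegral.continuous_primitive
          (fun a b => (continuous_extendTime u).intervalIntegrable a b) 0).comp
          continuous_subtype_val⟩
      map_add' := fun u v => by
        ext τ
        exact intervalIntegral.integral_add ((continuous_extendTime u).intervalIntegrable _ _)
          ((continuous_extendTime v).intervalIntegrable _ _)
      map_smul' := fun c u => by
        ext τ
        exact intervalIntegral.integral_smul c (extendTime u) } 1
    (fun u => by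
      rw [ContinuousMap.norm_le _ (by positivity)]
      intro τ
      refine (intervalIntegral.norm_integral_le_of_norm_le_const
        fun r _ => norm_extendTime_le u r).trans ?_
      rw [one_mul, sub_zero]
      exact mul_le_of_le_one_right (norm_nonneg _) (abs_le.2 τ.2))

/-- Constant functions, as a continuous linear map. -/
noncomputable def constTime (Y : Type) [NormedAddCommGroup Y] [NormedSpace ℝ Y] :
    Y →L[ℝ] C(timeInterval, Y) :=
  LinearMap.mkContinuous
    { toFun := fun y => ContinuousMap.const _ y
      map_add' := fun _ _ => rfl
      map_smul' := fun _ _ => rfl } 1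
    (fun y => by
      rw [ContinuousMap.norm_le _ (by positivity)]
      intro τ
      rw [one_mul]
      exact le_rfl)

@[simp] lemma constTime_apply (y : Y) (τ : timeInterval) : constTime Y y τ = y := rfl

/-- The defect of the integral equation `u = y + ε ∫ W ∘ u`. -/
noncomputable def integralDefect (W : C(Y, Y)) (q : (ℝ × Y) × C(timeInterval, Y)) :
    C(timeInterval, Y) :=
  q.2 - constTime Y q.1.2 - q.1.1 • primitive Y (W.comp q.2)

lemma integralDefect_eq_zero_iff (W : C(Y, Y)) (ε : ℝ) (y : Y) (u : C(timeInterval, Y)) :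
    integralDefect W ((ε, y), u) = 0 ↔
      ∀ τ ∈ timeInterval, extendTime u τ = y + ε • ∫ r in (0 : ℝ)..τ, W (extendTime u r) := by
  rw [ContinuousMap.ext_iff]
  constructor
  · intro h τ hτ
    have := h ⟨τ, hτ⟩
    simp only [integralDefect, ContinuousMap.sub_apply, ContinuousMap.zero_apply, sub_sub,
      sub_eq_zero] at this
    rw [extendTime_of_mem u hτ, this]
    rfl
  · intro h τ
    have := h τ τ.2
    rw [extendTime_coe] at this
    simp only [integralDefect, ContinuousMap.sub_apply, ContinuousMap.zero_apply, sub_sub,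
      sub_eq_zero]
    rw [this]
    rfl

/-- Slowing a solution down by τ multiplies its parameter by τ. This converts dependence on the
parameter ε, given by the inverse function theorem, into dependence on time. -/
lemma integralDefect_rescale (W : C(Y, Y)) {ε : ℝ} {y : Y} {u : C(timeInterval, Y)}
    (h : integralDefect W ((ε, y), u) = 0) (τ : timeInterval) :
    integralDefect W ((ε * τ, y), ⟨fun s => extendTime u (τ * s),
      (continuous_extendTime u).comp (continuous_const.mul continuous_subtype_val)⟩) = 0 := by
  have hmul : ∀ r ∈ timeInterval, (τ : ℝ) * r ∈ timeInterval := fun r hr => by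
    rw [Set.mem_Icc, ← abs_le, abs_mul]
    exact mul_le_one₀ (abs_le.2 τ.2) (abs_nonneg _) (abs_le.2 hr)
  rw [integralDefect_eq_zero_iff] at h ⊢
  intro s hs
  rw [extendTime_of_mem _ hs]
  simp only [ContinuousMap.coe_mk]
  rw [h _ (hmul s hs), mul_smul]
  congr 2
  have h2 := intervalIntegral.smul_integral_comp_mul_left (a := 0) (b := s)
    (fun r => W (extendTime u r)) (τ : ℝ)
  rw [mul_zero] at h2
  rw [← h2]
  congr 1
  refine intervalIntegral.integral_congr fun r hr => ?_
  have hr' : r ∈ timeInterval := by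
    refine Set.uIcc_subset_Icc ?_ hs hr
    simp
  rw [extendTime_of_mem _ hr']
  rfl

/-- At ε = 0 the product rule drops the derivative of the nonlinear term, so the partial derivative
in the path is the identity. -/
lemma hasFDerivAt_integralDefect {W : C(Y, Y)} (hW : ContDiff ℝ ∞ W) (y₀ : Y) :
    HasFDerivAt (integralDefect W)
      (ContinuousLinearMap.snd ℝ (ℝ × Y) C(timeInterval, Y) -
        (constTime Y ∘L ContinuousLinearMap.snd ℝ ℝ Y +
          (ContinuousLinearMap.fst ℝ ℝ Y).smulRight (primitive Y (W.comp (constTime Y y₀)))) ∘L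
          ContinuousLinearMap.fst ℝ (ℝ × Y) C(timeInterval, Y)) ((0, y₀), constTime Y y₀) := by
  set q₀ : (ℝ × Y) × C(timeInterval, Y) := ((0, y₀), constTime Y y₀)
  have hN : DifferentiableAt ℝ (fun q : (ℝ × Y) × C(timeInterval, Y) =>
      primitive Y (W.comp q.2)) q₀ := by
    have h1 : DifferentiableAt ℝ (fun u : C(timeInterval, Y) => W.comp u) q₀.2 :=
      (contDiff_superposition W hW).contDiffAt.differentiableAt (by simp)
    exact (primitive Y).differentiableAt.comp q₀ (h1.comp q₀ differentiableAt_snd)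
  have h1 : HasFDerivAt (fun q : (ℝ × Y) × C(timeInterval, Y) => q.1.1)
      (ContinuousLinearMap.fst ℝ ℝ Y ∘L ContinuousLinearMap.fst ℝ (ℝ × Y) C(timeInterval, Y)) q₀ :=
    (ContinuousLinearMap.fst ℝ ℝ Y ∘L
      ContinuousLinearMap.fst ℝ (ℝ × Y) C(timeInterval, Y)).hasFDerivAt
  have h2 : HasFDerivAt (fun q : (ℝ × Y) × C(timeInterval, Y) => constTime Y q.1.2)
      (constTime Y ∘L ContinuousLinearMap.snd ℝ ℝ Y ∘L
        ContinuousLinearMap.fst ℝ (ℝ × Y) C(timeInterval, Y)) q₀ :=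
    (constTime Y ∘L ContinuousLinearMap.snd ℝ ℝ Y ∘L
      ContinuousLinearMap.fst ℝ (ℝ × Y) C(timeInterval, Y)).hasFDerivAt
  have h3 : HasFDerivAt (fun q : (ℝ × Y) × C(timeInterval, Y) => q.2)
      (ContinuousLinearMap.snd ℝ (ℝ × Y) C(timeInterval, Y)) q₀ := hasFDerivAt_snd
  refine ((h3.sub h2).sub (h1.smul hN.hasFDerivAt)).congr_fderiv ?_
  ext q <;> simp [q₀]

lemma eventually_contDiffAt_integralDefect [CompleteSpace Y] {n : WithTop ℕ∞}
    (hn : n = ∞ ∨ n = ω) {W : C(Y, Y)} (hW : ContDiff ℝ ∞ W) {y₀ : Y} (h : ContDiffAt ℝ n W y₀) :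
    ∀ᶠ q in 𝓝 ((0, y₀), constTime Y y₀), ContDiffAt ℝ n (integralDefect W) q := by
  have hc : Tendsto (fun q : (ℝ × Y) × C(timeInterval, Y) => q.2)
      (𝓝 ((0, y₀), constTime Y y₀)) (𝓝 (constTime Y y₀)) := continuous_snd.continuousAt
  filter_upwards [hc.eventually (eventually_contDiffAt_superposition hn W hW y₀ h)] with q hq
  have h1 : ContDiffAt ℝ n (fun q : (ℝ × Y) × C(timeInterval, Y) =>
      primitive Y (W.comp q.2)) q :=
    (primitive Y).contDiff.contDiffAt.comp q (hq.comp q contDiffAt_snd)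
  have h2 : ContDiffAt ℝ n (fun q : (ℝ × Y) × C(timeInterval, Y) => constTime Y q.1.2) q :=
    (constTime Y ∘L ContinuousLinearMap.snd ℝ ℝ Y ∘L
      ContinuousLinearMap.fst ℝ (ℝ × Y) C(timeInterval, Y)).contDiff.contDiffAt
  have h3 : ContDiffAt ℝ n (fun q : (ℝ × Y) × C(timeInterval, Y) => q.1.1) q :=
    (ContinuousLinearMap.fst ℝ ℝ Y ∘L
      ContinuousLinearMap.fst ℝ (ℝ × Y) C(timeInterval, Y)).contDiff.contDiffAt
  exact (contDiffAt_snd.sub h2).sub (h3.smul h1)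

/-- The solutions of the integral equation `u = y + ε ∫ W ∘ u` depend on `(ε, y)` in class `n`. -/
lemma exists_solution_integralDefect [CompleteSpace Y] {n : WithTop ℕ∞}
    (hn : n = ∞ ∨ n = ω) {W : C(Y, Y)} (hW : ContDiff ℝ ∞ W) {y₀ : Y} (h : ContDiffAt ℝ n W y₀) :
    ∃ φ : ℝ × Y → C(timeInterval, Y), φ (0, y₀) = constTime Y y₀ ∧
      (∀ᶠ p in 𝓝 (0, y₀), ContDiffAt ℝ n φ p) ∧
      (∀ᶠ p in 𝓝 (0, y₀), integralDefect W (p, φ p) = 0) ∧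
      ∀ᶠ q in 𝓝 ((0, y₀), constTime Y y₀), integralDefect W q = 0 → φ q.1 = q.2 := by
  have hn1 : 1 ≤ n := by rcases hn with rfl | rfl <;> simp
  set q₀ : (ℝ × Y) × C(timeInterval, Y) := ((0, y₀), constTime Y y₀)
  set A : (ℝ × Y) →L[ℝ] C(timeInterval, Y) := constTime Y ∘L ContinuousLinearMap.snd ℝ ℝ Y +
    (ContinuousLinearMap.fst ℝ ℝ Y).smulRight (primitive Y (W.comp (constTime Y y₀)))
  -- Implicit function theorem by inverting (p, u) ↦ (p, defect). Its derivative (p, u) ↦ (p, u - A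
  -- p) is triangular with identity diagonal, hence invertible.
  set H : (ℝ × Y) × C(timeInterval, Y) → (ℝ × Y) × C(timeInterval, Y) :=
    fun q => (q.1, integralDefect W q)
  have hH : ∀ᶠ q in 𝓝 q₀, ContDiffAt ℝ n H q := by
    filter_upwards [eventually_contDiffAt_integralDefect hn hW h] with q hq
    exact contDiffAt_fst.prodMk hq
  set e : ((ℝ × Y) × C(timeInterval, Y)) ≃L[ℝ] ((ℝ × Y) × C(timeInterval, Y)) :=
    (ContinuousLinearEquiv.refl ℝ (ℝ × Y)).skewProd
      (ContinuousLinearEquiv.refl ℝ C(timeInterval, Y)) (-A)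
  have hH' : HasFDerivAt H (e : _ →L[ℝ] (ℝ × Y) × C(timeInterval, Y)) q₀ := by
    refine (hasFDerivAt_fst.prodMk (hasFDerivAt_integralDefect hW y₀)).congr_fderiv ?_
    refine ContinuousLinearMap.ext fun q => ?_
    simp only [ContinuousLinearMap.prod_apply, sub_apply,
      ContinuousLinearMap.comp_apply, ContinuousLinearMap.coe_fst', ContinuousLinearMap.coe_snd']
    refine Prod.ext rfl ?_
    change q.2 - A q.1 = q.2 + (-A) q.1
    rw [neg_apply, sub_eq_add_neg]
  obtain ⟨Ψ, hΨ, hmem, -, hsymm⟩ := exists_openPartialHomeomorph hn1 hH e hH'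
  have hH0 : H q₀ = ((0, y₀), 0) := by
    simp [H, q₀, integralDefect]
  have hinv : Ψ.symm ((0, y₀), 0) = q₀ := by
    rw [← hH0, ← hΨ, Ψ.left_inv hmem]
  have htgt : ∀ᶠ p : ℝ × Y in 𝓝 (0, y₀), (p, (0 : C(timeInterval, Y))) ∈ Ψ.target := by
    have hc : ContinuousAt (fun p : ℝ × Y => (p, (0 : C(timeInterval, Y)))) (0, y₀) := by fun_prop
    refine hc.eventually (Ψ.open_target.mem_nhds ?_)
    change ((0, y₀), (0 : C(timeInterval, Y))) ∈ Ψ.target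
    rw [← hH0, ← hΨ]
    exact Ψ.map_source hmem
  refine ⟨fun p => (Ψ.symm (p, 0)).2, by simp only [hinv]; rfl, ?_, ?_, ?_⟩
  · filter_upwards [htgt] with p hp
    exact ((hsymm _ hp).comp p
      (contDiffAt_id.prodMk (contDiffAt_const (c := (0 : C(timeInterval, Y)))))).snd
  · filter_upwards [htgt] with p hp
    have h1 : H (Ψ.symm (p, 0)) = (p, 0) := by rw [← hΨ, Ψ.right_inv hp]
    have h2 : (Ψ.symm (p, 0)).1 = p := congrArg Prod.fst h1
    have h3 : integralDefect W (Ψ.symm (p, 0)) = 0 := congrArg Prod.snd h1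
    rwa [← Prod.mk.eta (p := Ψ.symm (p, 0)), h2] at h3
  · filter_upwards [Ψ.open_source.mem_nhds hmem] with q hq h0
    have h1 : H q = (q.1, 0) := by simp [H, h0]
    have h2 : Ψ.symm (q.1, 0) = q := by rw [← h1, ← hΨ, Ψ.left_inv hq]
    simp only [h2]

/-- A vector field of class `n` has a local flow of class `n`. -/
theorem exists_local_flow [FiniteDimensional ℝ Y] {n : WithTop ℕ∞} (hn : n = ∞ ∨ n = ω)
    {W : Y → Y} {y₀ : Y} (hW : ∀ᶠ y in 𝓝 y₀, ContDiffAt ℝ n W y) :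
    ∃ G : ℝ × Y → Y, (∀ᶠ q in 𝓝 (0, y₀), ContDiffAt ℝ n G q) ∧
      (∀ᶠ y in 𝓝 y₀, G (0, y) = y) ∧
      ∀ᶠ q in 𝓝 (0, y₀), HasDerivAt (fun ε => G (ε, q.2)) (W (G q)) q.1 := by
  have := FiniteDimensional.complete ℝ Y
  obtain ⟨W', hW', hWW'⟩ := exists_contDiff_extension hn hW
  set V : C(Y, Y) := ⟨W', hW'.continuous⟩
  have hn1 : 1 ≤ n := by rcases hn with rfl | rfl <;> simp
  have hV : ContDiffAt ℝ n V y₀ := hW.self_of_nhds.congr_of_eventuallyEq hWW'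
  obtain ⟨φ, hφ0, hφn, hφz, hφu⟩ := exists_solution_integralDefect hn (W := V) hW' hV
  obtain ⟨r, hr, hru⟩ := Metric.eventually_nhds_iff.1 hφu
  have hφc : ∀ᶠ p in 𝓝 (0, y₀), dist (φ p) (constTime Y y₀) < r := by
    have := hφn.self_of_nhds.continuousAt
    rw [ContinuousAt, hφ0] at this
    exact this.eventually (Metric.eventually_nhds_iff.2 ⟨r, hr, fun _ h => h⟩)
  obtain ⟨δ, hδ, hδφ⟩ := Metric.eventually_nhds_iff.1
    (hφn.and (hφz.and (hφc.and (Metric.ball_mem_nhds ((0 : ℝ), y₀) hr))))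
  have h1mem : (1 : ℝ) ∈ timeInterval := ⟨by norm_num, le_rfl⟩
  have hball : ∀ {ε : ℝ} {y : Y}, |ε| < δ → dist y y₀ < δ → dist (ε, y) ((0 : ℝ), y₀) < δ := by
    intro ε y h1 h2
    rw [Prod.dist_eq, max_lt_iff]
    exact ⟨by simpa using h1, h2⟩
  -- The flow for time ε is the time-1 value of the solution with parameter ε.
  set G : ℝ × Y → Y := fun p => φ p ⟨1, h1mem⟩
  -- The slowed-down path solves the equation for ετ and is still close to the constant path, so
  -- local uniqueness identifies it with φ(ετ, y).
  have hscale : ∀ {ε : ℝ} {y : Y}, |ε| < δ → dist y y₀ < δ → ∀ τ : timeInterval,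
      G (ε * τ, y) = extendTime (φ (ε, y)) τ := by
    intro ε y h1 h2 τ
    obtain ⟨-, hz, hc, hb⟩ := hδφ (hball h1 h2)
    have hτ : |(τ : ℝ)| ≤ 1 := abs_le.2 τ.2
    set v : C(timeInterval, Y) := ⟨fun s => extendTime (φ (ε, y)) (τ * s),
      (continuous_extendTime _).comp (continuous_const.mul continuous_subtype_val)⟩
    have hzero := integralDefect_rescale V hz τ
    have hdist : dist ((ε * τ, y), v) (((0 : ℝ), y₀), constTime Y y₀) < r := by
      simp only [Prod.dist_eq, max_lt_iff]
      have hb' : dist (ε, y) ((0 : ℝ), y₀) < r := hb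
      simp only [Prod.dist_eq, max_lt_iff] at hb'
      refine ⟨⟨?_, hb'.2⟩, ?_⟩
      · refine lt_of_le_of_lt ?_ hb'.1
        rw [Real.dist_0_eq_abs, Real.dist_0_eq_abs, abs_mul]
        exact mul_le_of_le_one_right (abs_nonneg _) hτ
      · rw [ContinuousMap.dist_lt_iff hr]
        intro s
        have h3 := (ContinuousMap.dist_lt_iff hr).1 hc
        exact h3 (Set.projIcc (-1) 1 neg_one_le_one_real (τ * s))
    have := hru hdist hzero
    simp only [G, this]
    change extendTime (φ (ε, y)) (τ * 1) = _
    rw [mul_one]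
  have hGn : ∀ᶠ q in 𝓝 ((0 : ℝ), y₀), ContDiffAt ℝ n G q := by
    filter_upwards [hφn] with q hq
    exact (ContinuousMap.evalCLM ℝ (⟨1, h1mem⟩ : timeInterval) :
      C(timeInterval, Y) →L[ℝ] Y).contDiff.contDiffAt.comp q hq
  have hG0 : G (0, y₀) = y₀ := by simp only [G, hφ0, constTime_apply]
  have hGW : ∀ᶠ q in 𝓝 ((0 : ℝ), y₀), W' (G q) = W (G q) := by
    have hc := hGn.self_of_nhds.continuousAt
    rw [ContinuousAt, hG0] at hc
    exact hc.eventually hWW'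
  refine ⟨G, hGn, ?_, ?_⟩
  · filter_upwards [Metric.ball_mem_nhds y₀ hδ] with y hy
    have h0 : |(0 : ℝ)| < δ := by simpa using hδ
    have h1 := hscale h0 hy ⟨1, h1mem⟩
    obtain ⟨-, hz, -⟩ := hδφ (hball h0 hy)
    have h2 := (integralDefect_eq_zero_iff V 0 y _).1 hz 1 h1mem
    rw [zero_smul, add_zero] at h2
    rw [zero_mul] at h1
    exact h1.trans h2
  · have hε : 0 < δ / 2 := by positivity
    have hε' : |δ / 2| < δ := by rw [abs_of_pos hε]; linarith
    filter_upwards [hGW, Metric.ball_mem_nhds ((0 : ℝ), y₀) hε] with q hq hqb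
    obtain ⟨s, y⟩ := q
    have hqb' : dist (s, y) ((0 : ℝ), y₀) < δ / 2 := hqb
    simp only [Prod.dist_eq, max_lt_iff, Real.dist_0_eq_abs] at hqb'
    have hy : dist y y₀ < δ := by linarith [hqb'.2]
    obtain ⟨-, hz, -⟩ := hδφ (hball hε' hy)
    rw [integralDefect_eq_zero_iff] at hz
    set u := extendTime (φ (δ / 2, y))
    have hmem : ∀ s' : ℝ, |s'| < δ / 2 → s' / (δ / 2) ∈ timeInterval := fun s' hs' => by
      rw [Set.mem_Icc, ← abs_le, abs_div, abs_of_pos hε]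
      exact (div_le_one hε).2 hs'.le
    have hform : ∀ s' : ℝ, |s'| < δ / 2 → G (s', y) = u (s' / (δ / 2)) := fun s' hs' => by
      have := hscale hε' hy ⟨_, hmem s' hs'⟩
      simp only [mul_div_cancel₀ _ hε.ne'] at this
      exact this
    have hcont : Continuous fun r => V (u r) := V.continuous.comp (continuous_extendTime _)
    have hder : HasDerivAt (fun s' : ℝ => y + (δ / 2) • ∫ r in (0 : ℝ)..s' / (δ / 2), V (u r))
        ((δ / 2) • ((1 / (δ / 2)) • V (u (s / (δ / 2))))) s := by
      have h1 := (hcont.integral_hasStrictDerivAt 0 (s / (δ / 2))).hasDerivAt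
      have h2 : HasDerivAt (fun s' : ℝ => s' / (δ / 2)) (1 / (δ / 2)) s :=
        (hasDerivAt_id s).div_const _
      exact ((h1.scomp s h2).const_smul (δ / 2)).const_add y
    rw [smul_smul, mul_one_div_cancel hε.ne', one_smul, ← hform s hqb'.1] at hder
    rw [← hq]
    refine hder.congr_of_eventuallyEq ?_
    have : ∀ᶠ s' in 𝓝 s, |s'| < δ / 2 :=
      (continuous_abs.continuousAt (x := s)).eventually (gt_mem_nhds hqb'.1)
    filter_upwards [this] with s' hs'
    rw [hform s' hs', hz _ (hmem s' hs')]

end Flow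

/-! ### Alternating 2-forms as bilinear maps. -/

section Bilinear

variable {E : Type} [NormedAddCommGroup E] [NormedSpace ℝ E]

/-- The bilinear map underlying an alternating 2-form. -/
noncomputable def toBilin (E : Type) [NormedAddCommGroup E] [NormedSpace ℝ E] :
    (E [⋀^Fin 2]→L[ℝ] ℝ) →L[ℝ] E →L[ℝ] E →L[ℝ] ℝ :=
  ContinuousLinearMap.postcomp E
    ((ContinuousAlternatingMap.ofSubsingletonLIE (𝕜 := ℝ) (E := E) (F := ℝ)
      (0 : Fin 1)).symm.toContinuousLinearEquiv.toContinuousLinearMap) ∘L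
    (ContinuousAlternatingMap.curryLeftLI (𝕜 := ℝ) (E := E) (F := ℝ)
      (n := 1)).toContinuousLinearMap

lemma HasFDerivAt.toBilin {Y : Type} [NormedAddCommGroup Y] [NormedSpace ℝ Y]
    {η : Y → E [⋀^Fin 2]→L[ℝ] ℝ} {η' : Y →L[ℝ] E [⋀^Fin 2]→L[ℝ] ℝ} {y : Y}
    (h : HasFDerivAt η η' y) :
    HasFDerivAt (fun z => toBilin E (η z)) (toBilin E ∘L η') y := by
  exact HasFDerivAt.comp (𝕜 := ℝ) (E := Y) (F := E [⋀^Fin 2]→L[ℝ] ℝ) (G := E →L[ℝ] E →L[ℝ] ℝ)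
    (g := fun θ => _root_.toBilin E θ) (g' := _root_.toBilin E) y
    (ContinuousLinearMap.hasFDerivAt (𝕜 := ℝ) (E := E [⋀^Fin 2]→L[ℝ] ℝ)
      (F := E →L[ℝ] E →L[ℝ] ℝ) (_root_.toBilin E)) h

lemma ContDiffAt.toBilin {Y : Type} [NormedAddCommGroup Y] [NormedSpace ℝ Y]
    {η : Y → E [⋀^Fin 2]→L[ℝ] ℝ} {y : Y} {n : WithTop ℕ∞} (h : ContDiffAt ℝ n η y) :
    ContDiffAt ℝ n (fun z => toBilin E (η z)) y := by
  exact ContDiffAt.continuousLinearMap_comp (𝕜 := ℝ) (E := Y) (F := E [⋀^Fin 2]→L[ℝ] ℝ)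
    (G := E →L[ℝ] E →L[ℝ] ℝ) (_root_.toBilin E) h

lemma toBilin_apply (η : E [⋀^Fin 2]→L[ℝ] ℝ) (a b : E) : toBilin E η a b = η ![a, b] := by
  change η (Matrix.vecCons a fun _ => b) = _
  congr 1
  ext i; fin_cases i <;> rfl

lemma toBilin_swap (η : E [⋀^Fin 2]→L[ℝ] ℝ) (a b : E) : toBilin E η a b = -toBilin E η b a := by
  rw [toBilin_apply, toBilin_apply]
  have := η.toAlternatingMap.map_swap ![b, a] (show (0 : Fin 2) ≠ 1 by decide)
  rw [show (![b, a] ∘ Equiv.swap (0 : Fin 2) 1) = ![a, b] by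
    ext i; fin_cases i <;> simp] at this
  exact this

lemma toBilin_self (η : E [⋀^Fin 2]→L[ℝ] ℝ) (a : E) : toBilin E η a a = 0 := by
  linarith [toBilin_swap η a a]

lemma ext_toBilin {η η' : E [⋀^Fin 2]→L[ℝ] ℝ}
    (h : ∀ a b, toBilin E η a b = toBilin E η' a b) : η = η' := by
  ext v
  have := h (v 0) (v 1)
  rw [toBilin_apply, toBilin_apply] at this
  rwa [show ![v 0, v 1] = v by ext i; fin_cases i <;> rfl] at this

lemma extDeriv_apply_three (η : E → E [⋀^Fin 2]→L[ℝ] ℝ) (x a b c : E) :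
    extDeriv η x ![a, b, c] = toBilin E (fderiv ℝ η x a) b c - toBilin E (fderiv ℝ η x b) a c +
      toBilin E (fderiv ℝ η x c) a b := by
  simp only [toBilin_apply]
  rw [extDeriv, ContinuousAlternatingMap.alternatizeUncurryFin_apply, Fin.sum_univ_three]
  have h0 : (Fin.removeNth 0 ![a, b, c] : Fin 2 → E) = ![b, c] := by
    ext i; fin_cases i <;> rfl
  have h1 : (Fin.removeNth 1 ![a, b, c] : Fin 2 → E) = ![a, c] := by
    ext i; fin_cases i <;> rfl
  have h2 : (Fin.removeNth 2 ![a, b, c] : Fin 2 → E) = ![a, b] := by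
    ext i; fin_cases i <;> rfl
  rw [h0, h1, h2]
  simp [sub_eq_add_neg]

lemma fderiv_toBilin {η : E → E [⋀^Fin 2]→L[ℝ] ℝ} {x : E} (h : DifferentiableAt ℝ η x) (a b c : E) :
    fderiv ℝ (fun y => toBilin E (η y) b c) x a = toBilin E (fderiv ℝ η x a) b c := by
  have h1 := (h.hasFDerivAt.toBilin.clm_apply (hasFDerivAt_const b x)).clm_apply
    (hasFDerivAt_const c x)
  rw [h1.fderiv]
  simp

end Bilinear

/-! ### Averages along a retraction onto a hyperplane, and Hadamard division. -/

section Average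

variable {Y Z : Type} [NormedAddCommGroup Y] [NormedSpace ℝ Y]
  [NormedAddCommGroup Z] [NormedSpace ℝ Z]

/-- The linear homotopy, along `e`, from a projection to `ker l` (at `τ = 0`) to the identity. -/
noncomputable def retract (l : Y →L[ℝ] ℝ) (e : Y) (τ : ℝ) : Y →L[ℝ] Y :=
  ContinuousLinearMap.id ℝ Y + (τ - 1) • l.smulRight e

lemma retract_apply (l : Y →L[ℝ] ℝ) (e : Y) (τ : ℝ) (y : Y) :
    retract l e τ y = y + (τ - 1) • l y • e := rfl

@[simp] lemma retract_one (l : Y →L[ℝ] ℝ) (e y : Y) : retract l e 1 y = y := by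
  simp [retract_apply]

lemma retract_of_eq_zero {l : Y →L[ℝ] ℝ} {y : Y} (h : l y = 0) (e : Y) (τ : ℝ) :
    retract l e τ y = y := by
  simp [retract_apply, h]

lemma apply_retract_zero {l : Y →L[ℝ] ℝ} {e : Y} (he : l e = 1) (y : Y) :
    l (retract l e 0 y) = 0 := by
  simp [retract_apply, he]

lemma hasDerivAt_retract (l : Y →L[ℝ] ℝ) (e y : Y) (τ : ℝ) :
    HasDerivAt (fun τ => retract l e τ y) (l y • e) τ := by
  simp only [retract_apply]
  simpa using (((hasDerivAt_id τ).sub_const 1).smul_const (l y • e)).const_add y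

lemma continuous_retract (l : Y →L[ℝ] ℝ) (e : Y) :
    Continuous fun q : Y × ℝ => retract l e q.2 q.1 := by
  simp only [retract_apply]
  fun_prop

lemma eventually_retract {l : Y →L[ℝ] ℝ} (e : Y) {y₀ : Y} (h₀ : l y₀ = 0) {P : Y → Prop}
    (hP : ∀ᶠ y in 𝓝 y₀, P y) : ∀ᶠ y in 𝓝 y₀, ∀ τ ∈ Set.Icc (0 : ℝ) 1, P (retract l e τ y) := by
  refine isCompact_Icc.eventually_forall_of_forall_eventually fun τ _ => ?_
  have hc := (continuous_retract l e).continuousAt (x := (y₀, τ))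
  rw [ContinuousAt, retract_of_eq_zero h₀] at hc
  exact hc.eventually hP

/-- The average of `g` along the homotopy `retract`. -/
noncomputable def average (l : Y →L[ℝ] ℝ) (e : Y) (g : Y → Z) (y : Y) : Z :=
  ∫ τ in (0 : ℝ)..1, g (retract l e τ y)

lemma average_congr {l : Y →L[ℝ] ℝ} {e : Y} {y₀ : Y} (h₀ : l y₀ = 0) {g g' : Y → Z}
    (h : g =ᶠ[𝓝 y₀] g') : average l e g =ᶠ[𝓝 y₀] average l e g' := by
  filter_upwards [eventually_retract e h₀ h] with y hy
  refine intervalIntegral.integral_congr fun τ hτ => ?_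
  rw [Set.uIcc_of_le zero_le_one] at hτ
  exact hy τ hτ

lemma average_of_eq_zero [CompleteSpace Z] {l : Y →L[ℝ] ℝ} (e : Y) {y : Y} (h : l y = 0)
    (g : Y → Z) : average l e g y = g y := by
  simp [average, retract_of_eq_zero h]

/-- The path `τ ↦ retract l e τ y`, depending linearly on `y`. -/
noncomputable def retractPath (l : Y →L[ℝ] ℝ) (e : Y) : Y →L[ℝ] C(timeInterval, Y) :=
  constTime Y + l.smulRight
    (⟨fun τ => ((τ : ℝ) - 1) • e, by fun_prop⟩ : C(timeInterval, Y))

lemma retractPath_apply (l : Y →L[ℝ] ℝ) (e y : Y) (τ : timeInterval) :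
    retractPath l e y τ = retract l e τ y := by
  change y + l y • ((τ : ℝ) - 1) • e = _
  rw [retract_apply, smul_comm]

lemma one_mem_timeInterval : (1 : ℝ) ∈ timeInterval := ⟨by norm_num, le_rfl⟩

/-- Integration over `[0, 1]`, as a continuous linear functional. -/
noncomputable def integralUnit (Z : Type) [NormedAddCommGroup Z] [NormedSpace ℝ Z] :
    C(timeInterval, Z) →L[ℝ] Z :=
  (ContinuousMap.evalCLM ℝ (⟨1, one_mem_timeInterval⟩ : timeInterval) :
    C(timeInterval, Z) →L[ℝ] Z) ∘L primitive Z

lemma integralUnit_eq {u : C(timeInterval, Z)} {f : ℝ → Z}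
    (h : ∀ τ : timeInterval, u τ = f τ) : integralUnit Z u = ∫ τ in (0 : ℝ)..1, f τ := by
  change ∫ τ in (0 : ℝ)..1, extendTime u τ = _
  refine intervalIntegral.integral_congr fun τ hτ => ?_
  rw [Set.uIcc_of_le zero_le_one] at hτ
  rw [extendTime_of_mem u ⟨by linarith [hτ.1], hτ.2⟩, h]

lemma average_eq (l : Y →L[ℝ] ℝ) (e : Y) (G : C(Y, Z)) (y : Y) :
    average l e G y = integralUnit Z (G.comp (retractPath l e y)) := by
  rw [integralUnit_eq (f := fun τ => G (retract l e τ y))]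
  · rfl
  · intro τ
    rw [ContinuousMap.comp_apply, retractPath_apply]

variable {n : WithTop ℕ∞}

/-- The average is a bounded linear functional of G composed with a path depending linearly on y. At
y₀ this path is constant, which is where superposition operators are known to be analytic. -/
lemma eventually_contDiffAt_average [FiniteDimensional ℝ Y] [CompleteSpace Z] (hn : n = ∞ ∨ n = ω) {l : Y →L[ℝ] ℝ} (e : Y) {y₀ : Y}
    (h₀ : l y₀ = 0) {g : Y → Z} (hg : ∀ᶠ y in 𝓝 y₀, ContDiffAt ℝ n g y) :
    ∀ᶠ y in 𝓝 y₀, ContDiffAt ℝ n (average l e g) y := by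
  obtain ⟨G', hG', hGg⟩ := exists_contDiff_extension hn hg
  set G : C(Y, Z) := ⟨G', hG'.continuous⟩
  have hG : ContDiffAt ℝ n G y₀ := hg.self_of_nhds.congr_of_eventuallyEq hGg
  have hc : Tendsto (retractPath l e) (𝓝 y₀) (𝓝 (ContinuousMap.const _ y₀)) := by
    have := (retractPath l e).continuous.continuousAt (x := y₀)
    rw [ContinuousAt, show retractPath l e y₀ = ContinuousMap.const _ y₀ from
      ContinuousMap.ext fun τ => by
        rw [retractPath_apply, retract_of_eq_zero h₀, ContinuousMap.const_apply]] at this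
    exact this
  filter_upwards [hc.eventually (eventually_contDiffAt_superposition hn G hG' y₀ hG),
    (average_congr (e := e) h₀ hGg).eventuallyEq_nhds] with y hy hy'
  refine ContDiffAt.congr_of_eventuallyEq ?_ hy'.symm
  rw [show average l e G' = fun y => integralUnit Z (G.comp (retractPath l e y)) from
    funext fun y => average_eq l e G y]
  exact (integralUnit Z).contDiff.contDiffAt.comp y
    (hy.comp y (retractPath l e).contDiff.contDiffAt)

/-- Differentiation under the integral sign, obtained from the chain rule for the same
factorization. -/
lemma eventually_fderiv_average [FiniteDimensional ℝ Y] (hn : n = ∞ ∨ n = ω) {l : Y →L[ℝ] ℝ} (e : Y) {y₀ : Y}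
    (h₀ : l y₀ = 0) {g : Y → Z} (hg : ∀ᶠ y in 𝓝 y₀, ContDiffAt ℝ n g y) :
    ∀ᶠ y in 𝓝 y₀, ∀ a, fderiv ℝ (average l e g) y a =
      ∫ τ in (0 : ℝ)..1, fderiv ℝ g (retract l e τ y) (retract l e τ a) := by
  obtain ⟨G', hG', hGg⟩ := exists_contDiff_extension hn hg
  set G : C(Y, Z) := ⟨G', hG'.continuous⟩
  have hdG : ContDiff ℝ ∞ (fderiv ℝ G') := hG'.fderiv_right (by simp)
  set D : C(Y, Y →L[ℝ] Z) := ⟨fderiv ℝ G', hdG.continuous⟩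
  filter_upwards [(average_congr (e := e) h₀ hGg).eventuallyEq_nhds,
    eventually_retract e h₀ hGg.eventuallyEq_nhds] with y hy hy' a
  have h1 : HasFDerivAt (fun y => integralUnit Z (G.comp (retractPath l e y)))
      (integralUnit Z ∘L (pointwiseApply _ Y Z (D.comp (retractPath l e y))) ∘L
        retractPath l e) y :=
    (integralUnit Z).hasFDerivAt.comp y ((hasFDerivAt_superposition G D
      (fun y => (hG'.differentiable (by simp) y).hasFDerivAt) (retractPath l e y)).comp y
        (retractPath l e).hasFDerivAt)
  rw [← hy.fderiv_eq, show average l e G' = fun y => integralUnit Z (G.comp (retractPath l e y))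
    from funext fun y => average_eq l e G y, h1.fderiv]
  change integralUnit Z (pointwiseApply _ Y Z (D.comp (retractPath l e y)) (retractPath l e a)) = _
  rw [integralUnit_eq (f := fun τ => fderiv ℝ G' (retract l e τ y) (retract l e τ a))]
  · refine intervalIntegral.integral_congr fun τ hτ => ?_
    rw [Set.uIcc_of_le zero_le_one] at hτ
    rw [(hy' τ hτ).fderiv_eq]
  · intro τ
    rw [pointwiseApply_apply, retractPath_apply, ContinuousMap.comp_apply, retractPath_apply]
    rfl

/-- Hadamard's lemma: division of a function vanishing on a hyperplane by the linear equation. -/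
lemma eventually_eq_mul_average (hn : n = ∞ ∨ n = ω) {l : Y →L[ℝ] ℝ} {e : Y} (he : l e = 1)
    {y₀ : Y} (h₀ : l y₀ = 0) {f : Y → ℝ} (hf : ∀ᶠ y in 𝓝 y₀, ContDiffAt ℝ n f y)
    (hf0 : ∀ᶠ y in 𝓝 y₀, l y = 0 → f y = 0) :
    ∀ᶠ y in 𝓝 y₀, f y = l y * average l e (fun z => fderiv ℝ f z e) y := by
  have hn1 : 1 ≤ n := by rcases hn with rfl | rfl <;> simp
  filter_upwards [eventually_retract e h₀ hf, eventually_retract e h₀ hf0] with y hy hy0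
  have hder : ∀ τ ∈ Set.uIcc (0 : ℝ) 1, HasDerivAt (fun τ => f (retract l e τ y))
      (l y * fderiv ℝ f (retract l e τ y) e) τ := by
    intro τ hτ
    rw [Set.uIcc_of_le zero_le_one] at hτ
    have h1 := ((hy τ hτ).differentiableAt (lt_of_lt_of_le one_pos hn1).ne').hasFDerivAt
    have h2 := h1.comp_hasDerivAt τ (hasDerivAt_retract l e y τ)
    rw [map_smul, smul_eq_mul] at h2
    exact h2
  have hcont : ContinuousOn (fun τ => l y * fderiv ℝ f (retract l e τ y) e)
      (Set.uIcc (0 : ℝ) 1) := by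
    rw [Set.uIcc_of_le zero_le_one]
    refine continuousOn_const.mul fun τ hτ => ContinuousAt.continuousWithinAt ?_
    have h1 : ContinuousAt (fderiv ℝ f) (retract l e τ y) :=
      ((hy τ hτ).fderiv_right (m := 0) (by simpa)).continuousAt
    have h2 : ContinuousAt (fun τ => fderiv ℝ f (retract l e τ y)) τ :=
      ContinuousAt.comp (f := fun τ => retract l e τ y) h1 (hasDerivAt_retract l e y τ).continuousAt
    exact h2.clm_apply continuousAt_const
  have hint := intervalIntegral.integral_eq_sub_of_hasDerivAt hder hcont.intervalIntegrable
  rw [intervalIntegral.integral_const_mul, retract_one,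
    hy0 0 ⟨le_rfl, zero_le_one⟩ (apply_retract_zero he y), sub_zero] at hint
  exact hint.symm

end Average

/-! ### The relative Poincaré lemma. -/

section RelativePoincare

variable {E : Type} [NormedAddCommGroup E] [NormedSpace ℝ E] [FiniteDimensional ℝ E]
  {n : WithTop ℕ∞}

/-- The homotopy primitive, up to the factor `l`, of a closed 2-form vanishing on `l = 0`. -/
noncomputable def homotopyForm (l : E →L[ℝ] ℝ) (e : E) (η : E → E [⋀^Fin 2]→L[ℝ] ℝ) :
    E → E →L[ℝ] ℝ :=
  average l e fun y => toBilin E (η y) e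

/-- Relative Poincaré lemma: a closed 2-form `η` whose restriction to the hyperplane `l = 0`
vanishes is the differential of `l • homotopyForm l e η`. -/
lemma eventually_extDeriv_homotopyForm (hn : n = ∞ ∨ n = ω) {l : E →L[ℝ] ℝ} {e : E} (he : l e = 1)
    {y₀ : E} (h₀ : l y₀ = 0) {η : E → E [⋀^Fin 2]→L[ℝ] ℝ}
    (hη : ∀ᶠ y in 𝓝 y₀, ContDiffAt ℝ n η y) (hc : ∀ᶠ y in 𝓝 y₀, extDeriv η y = 0)
    (hr : ∀ᶠ y in 𝓝 y₀, l y = 0 → ∀ a b, l a = 0 → l b = 0 → toBilin E (η y) a b = 0) :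
    ∀ᶠ y in 𝓝 y₀, ∀ a b, fderiv ℝ (fun z => l z • homotopyForm l e η z) y a b -
      fderiv ℝ (fun z => l z • homotopyForm l e η z) y b a = toBilin E (η y) a b := by
  have hn1 : 1 ≤ n := by rcases hn with rfl | rfl <;> simp
  have hn0 : n ≠ 0 := (lt_of_lt_of_le one_pos hn1).ne'
  have hg : ∀ᶠ y in 𝓝 y₀, ContDiffAt ℝ n (fun y => toBilin E (η y) e) y := by
    filter_upwards [hη] with y hy
    exact hy.toBilin.clm_apply contDiffAt_const
  filter_upwards [eventually_retract e h₀ hη, eventually_retract e h₀ hc,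
    eventually_retract e h₀ hr, eventually_contDiffAt_average hn e h₀ hg,
    eventually_fderiv_average hn e h₀ hg, eventually_retract e h₀ hg] with y hy hyc hyr hyg hyd hyg'
  have hprod : ∀ a b, fderiv ℝ (fun z => l z • homotopyForm l e η z) y a b =
      l y * (fderiv ℝ (homotopyForm l e η) y a b) + l a * homotopyForm l e η y b := by
    intro a b
    have h1 : HasFDerivAt (fun z => l z • homotopyForm l e η z) _ y :=
      l.hasFDerivAt.smul (hyg.differentiableAt hn0).hasFDerivAt
    rw [h1.fderiv]
    rfl
  have hI : ∀ {f : ℝ → ℝ}, (∀ τ ∈ Set.Icc (0 : ℝ) 1, ContinuousAt f τ) →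
      IntervalIntegrable f MeasureTheory.volume 0 1 := by
    intro f hf
    refine ContinuousOn.intervalIntegrable ?_
    rw [Set.uIcc_of_le zero_le_one]
    exact fun τ hτ => (hf τ hτ).continuousWithinAt
  have hret : ∀ z τ, ContinuousAt (fun τ => retract l e τ z) τ :=
    fun z τ => (hasDerivAt_retract l e z τ).continuousAt
  have hηc : ∀ τ ∈ Set.Icc (0 : ℝ) 1, ContinuousAt (fun τ => toBilin E (η (retract l e τ y))) τ :=
    fun τ hτ => (toBilin E).continuous.continuousAt.comp
      (ContinuousAt.comp (f := fun τ => retract l e τ y) (hy τ hτ).continuousAt (hret y τ))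
  have hηd : ∀ τ ∈ Set.Icc (0 : ℝ) 1, ContinuousAt (fun τ => fderiv ℝ η (retract l e τ y)) τ := by
    intro τ hτ
    exact ContinuousAt.comp (f := fun τ => retract l e τ y)
      ((hy τ hτ).fderiv_right (m := 0) (by simpa)).continuousAt (hret y τ)
  have hγ : ∀ b, homotopyForm l e η y b =
      ∫ τ in (0 : ℝ)..1, toBilin E (η (retract l e τ y)) e b := by
    intro b
    have hi : IntervalIntegrable (fun τ => toBilin E (η (retract l e τ y)) e)
        MeasureTheory.volume 0 1 := by
      refine ContinuousOn.intervalIntegrable ?_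
      rw [Set.uIcc_of_le zero_le_one]
      exact fun τ hτ => ((hηc τ hτ).clm_apply continuousAt_const).continuousWithinAt
    have := (ContinuousLinearMap.apply ℝ ℝ b).intervalIntegral_comp_comm hi
    exact this.symm
  have hdg : ∀ τ ∈ Set.Icc (0 : ℝ) 1, ∀ a, fderiv ℝ (fun y => toBilin E (η y) e)
      (retract l e τ y) a = toBilin E (fderiv ℝ η (retract l e τ y) a) e := by
    intro τ hτ a
    have h1 := ((hy τ hτ).differentiableAt hn0).hasFDerivAt.toBilin.clm_apply
      (hasFDerivAt_const e (retract l e τ y))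
    rw [h1.fderiv]
    simp
  have hdc : ∀ a b, ∀ τ ∈ Set.Icc (0 : ℝ) 1, ContinuousAt (fun τ =>
      toBilin E (fderiv ℝ η (retract l e τ y) (retract l e τ a)) e b) τ := by
    intro a b τ hτ
    exact (((toBilin E).continuous.continuousAt.comp
      ((hηd τ hτ).clm_apply (hret a τ))).clm_apply continuousAt_const).clm_apply continuousAt_const
  have hdγ : ∀ a b, fderiv ℝ (homotopyForm l e η) y a b =
      ∫ τ in (0 : ℝ)..1, toBilin E (fderiv ℝ η (retract l e τ y) (retract l e τ a)) e b := by
    intro a b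
    have h1 : fderiv ℝ (homotopyForm l e η) y a =
        ∫ τ in (0 : ℝ)..1, toBilin E (fderiv ℝ η (retract l e τ y) (retract l e τ a)) e := by
      refine (hyd a).trans (intervalIntegral.integral_congr fun τ hτ => ?_)
      rw [Set.uIcc_of_le zero_le_one] at hτ
      exact hdg τ hτ _
    have hi : IntervalIntegrable (fun τ => toBilin E (fderiv ℝ η (retract l e τ y)
        (retract l e τ a)) e) MeasureTheory.volume 0 1 := by
      refine ContinuousOn.intervalIntegrable ?_
      rw [Set.uIcc_of_le zero_le_one]
      exact fun τ hτ => (((toBilin E).continuous.continuousAt.comp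
        ((hηd τ hτ).clm_apply (hret a τ))).clm_apply continuousAt_const).continuousWithinAt
    rw [h1]
    exact ((ContinuousLinearMap.apply ℝ ℝ b).intervalIntegral_comp_comm hi).symm
  intro a b
  -- Cartan's formula for the τ-derivative of the pullback of η by r_τ = `retract l e τ`. Closedness
  -- trades the derivative of η along e for derivatives of its contraction with e; since r_τ z - z
  -- is a multiple of e, that contraction takes the same value on r_τ z and z.
  have hder : ∀ τ ∈ Set.uIcc (0 : ℝ) 1,
      HasDerivAt (fun τ => toBilin E (η (retract l e τ y)) (retract l e τ a) (retract l e τ b))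
        (l y * (toBilin E (fderiv ℝ η (retract l e τ y) (retract l e τ a)) e b
            - toBilin E (fderiv ℝ η (retract l e τ y) (retract l e τ b)) e a)
          + (l a * toBilin E (η (retract l e τ y)) e b
            - l b * toBilin E (η (retract l e τ y)) e a)) τ := by
    intro τ hτ
    rw [Set.uIcc_of_le zero_le_one] at hτ
    have h2 : HasDerivAt (fun τ => toBilin E (η (retract l e τ y)))
        (toBilin E (fderiv ℝ η (retract l e τ y) (l y • e))) τ :=
      HasFDerivAt.comp_hasDerivAt (l := fun z => toBilin E (η z)) (f := fun τ => retract l e τ y) τ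
        ((hy τ hτ).differentiableAt hn0).hasFDerivAt.toBilin (hasDerivAt_retract l e y τ)
    have h3 := (h2.clm_apply (hasDerivAt_retract l e a τ)).clm_apply (hasDerivAt_retract l e b τ)
    refine h3.congr_deriv ?_
    have hcl := extDeriv_apply_three η (retract l e τ y) e (retract l e τ a) (retract l e τ b)
    rw [hyc τ hτ] at hcl
    change 0 = _ at hcl
    have hea : ∀ (θ : E [⋀^Fin 2]→L[ℝ] ℝ) (z : E),
        toBilin E θ e (retract l e τ z) = toBilin E θ e z := by
      intro θ z
      simp only [retract_apply, map_add, map_smul, toBilin_self, smul_zero, add_zero]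
    rw [hea, hea] at hcl
    have hae : ∀ (θ : E [⋀^Fin 2]→L[ℝ] ℝ) (z : E),
        toBilin E θ (retract l e τ z) e = -toBilin E θ e z := by
      intro θ z
      rw [toBilin_swap, hea]
    simp only [map_smul, add_apply, smul_apply,
      smul_eq_mul, hea, hae]
    linear_combination -l y * hcl
  have hi1 : ∀ a b, IntervalIntegrable (fun τ =>
      toBilin E (fderiv ℝ η (retract l e τ y) (retract l e τ a)) e b) MeasureTheory.volume 0 1 :=
    fun a b => hI (hdc a b)
  have hi2 : ∀ b, IntervalIntegrable (fun τ =>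
      toBilin E (η (retract l e τ y)) e b) MeasureTheory.volume 0 1 :=
    fun b => hI fun τ hτ => ((hηc τ hτ).clm_apply continuousAt_const).clm_apply continuousAt_const
  have hint := intervalIntegral.integral_eq_sub_of_hasDerivAt hder
    ((((hi1 a b).sub (hi1 b a)).const_mul _).add
      (((hi2 b).const_mul _).sub ((hi2 a).const_mul _)))
  rw [intervalIntegral.integral_add (((hi1 a b).sub (hi1 b a)).const_mul _)
      (((hi2 b).const_mul _).sub ((hi2 a).const_mul _)), intervalIntegral.integral_const_mul,
    intervalIntegral.integral_sub (hi1 a b) (hi1 b a),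
    intervalIntegral.integral_sub ((hi2 b).const_mul _) ((hi2 a).const_mul _),
    intervalIntegral.integral_const_mul, intervalIntegral.integral_const_mul,
    ← hdγ, ← hdγ, ← hγ, ← hγ] at hint
  simp only [retract_one] at hint
  -- The endpoint τ = 0 contributes nothing: point and vectors are projected to the hyperplane,
  -- where η restricts to zero.
  rw [hyr 0 ⟨le_rfl, zero_le_one⟩ (apply_retract_zero he y) _ _ (apply_retract_zero he a)
    (apply_retract_zero he b), sub_zero] at hint
  rw [hprod, hprod, ← hint]
  ring

end RelativePoincare

/-! ### Pullbacks and equivalence of germs of 2-forms. -/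

section GermEquiv

variable {E : Type} [NormedAddCommGroup E] [NormedSpace ℝ E]

lemma toBilin_pullback {F : Type} [NormedAddCommGroup F] [NormedSpace ℝ F] (φ : E → F)
    (η : F → F [⋀^Fin 2]→L[ℝ] ℝ) (x a b : E) :
    toBilin E (pullback φ η x) a b = toBilin F (η (φ x)) (fderiv ℝ φ x a) (fderiv ℝ φ x b) := by
  rw [toBilin_apply, toBilin_apply, pullback,
    ContinuousAlternatingMap.compContinuousLinearMap_apply]
  congr 1
  ext i; fin_cases i <;> rfl

lemma pullback_comp {F G : Type} [NormedAddCommGroup F] [NormedSpace ℝ F]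
    [NormedAddCommGroup G] [NormedSpace ℝ G] {φ : E → F} {ψ : F → G} {x : E}
    (hψ : DifferentiableAt ℝ ψ (φ x)) (hφ : DifferentiableAt ℝ φ x)
    (η : G → G [⋀^Fin 2]→L[ℝ] ℝ) :
    pullback (ψ ∘ φ) η x = pullback φ (pullback ψ η) x := by
  refine ext_toBilin fun a b => ?_
  rw [toBilin_pullback, toBilin_pullback, toBilin_pullback, fderiv_comp x hψ hφ]
  rfl

lemma pullback_congr {F : Type} [NormedAddCommGroup F] [NormedSpace ℝ F]
    {φ φ' : E → F} {x : E} (h : φ =ᶠ[𝓝 x] φ') (η : F → F [⋀^Fin 2]→L[ℝ] ℝ) :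
    pullback φ η x = pullback φ' η x := by
  rw [pullback, pullback, h.fderiv_eq, h.eq_of_nhds]

/-- Two germs of 2-forms at `0` are equivalent if a diffeomorphism-germ of class `n` pulls back the
second one to the first one. -/
def GermEquiv (n : WithTop ℕ∞) (η η' : E → E [⋀^Fin 2]→L[ℝ] ℝ) : Prop :=
  ∃ Ψ : OpenPartialHomeomorph E E, IsDiffeoGerm n Ψ ∧ pullback Ψ η' =ᶠ[𝓝 0] η

variable {n : WithTop ℕ∞}

lemma IsDiffeoGerm.contDiffAt {Ψ : OpenPartialHomeomorph E E} (h : IsDiffeoGerm n Ψ) {x : E}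
    (hx : x ∈ Ψ.source) : ContDiffAt ℝ n Ψ x :=
  h.contDiffOn.contDiffAt (Ψ.open_source.mem_nhds hx)

lemma IsDiffeoGerm.symm {Ψ : OpenPartialHomeomorph E E} (h : IsDiffeoGerm n Ψ) :
    IsDiffeoGerm n Ψ.symm where
  zero_mem := by
    have := Ψ.map_source h.zero_mem
    rwa [h.map_zero] at this
  map_zero := by
    have := Ψ.left_inv h.zero_mem
    rwa [h.map_zero] at this
  contDiffOn := h.contDiffOn_symm
  contDiffOn_symm := h.contDiffOn

lemma IsDiffeoGerm.trans {Ψ Ψ' : OpenPartialHomeomorph E E} (h : IsDiffeoGerm n Ψ)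
    (h' : IsDiffeoGerm n Ψ') : IsDiffeoGerm n (Ψ.trans Ψ') where
  zero_mem := by
    rw [OpenPartialHomeomorph.trans_source]
    refine ⟨h.zero_mem, ?_⟩
    change Ψ 0 ∈ Ψ'.source
    rw [h.map_zero]
    exact h'.zero_mem
  map_zero := by
    rw [OpenPartialHomeomorph.coe_trans, Function.comp_apply, h.map_zero, h'.map_zero]
  contDiffOn := by
    rw [OpenPartialHomeomorph.trans_source]
    exact h'.contDiffOn.comp (h.contDiffOn.mono Set.inter_subset_left)
      fun x hx => hx.2
  contDiffOn_symm := by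
    rw [OpenPartialHomeomorph.trans_target]
    exact h.contDiffOn_symm.comp (h'.contDiffOn_symm.mono Set.inter_subset_left)
      fun x hx => hx.2

lemma GermEquiv.trans (hn : 1 ≤ n) {η η' η'' : E → E [⋀^Fin 2]→L[ℝ] ℝ} (h : GermEquiv n η η')
    (h' : GermEquiv n η' η'') : GermEquiv n η η'' := by
  have hn0 : n ≠ 0 := (lt_of_lt_of_le one_pos hn).ne'
  obtain ⟨Ψ, hΨ, hη⟩ := h
  obtain ⟨Ψ', hΨ', hη'⟩ := h'
  refine ⟨Ψ.trans Ψ', hΨ.trans hΨ', ?_⟩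
  have hc : Tendsto Ψ (𝓝 0) (𝓝 0) := by
    simpa [ContinuousAt, hΨ.map_zero] using Ψ.continuousAt hΨ.zero_mem
  filter_upwards [hη, hc.eventually hη', Ψ.open_source.mem_nhds hΨ.zero_mem,
    hc.eventually (Ψ'.open_source.mem_nhds hΨ'.zero_mem)] with x h1 h2 h3 h4
  rw [OpenPartialHomeomorph.coe_trans, pullback_comp
    ((hΨ'.contDiffAt h4).differentiableAt hn0) ((hΨ.contDiffAt h3).differentiableAt hn0), ← h1]
  change (pullback Ψ' η'' (Ψ x)).compContinuousLinearMap _ = _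
  rw [h2]
  rfl

lemma GermEquiv.symm (hn : 1 ≤ n) {η η' : E → E [⋀^Fin 2]→L[ℝ] ℝ} (h : GermEquiv n η η') :
    GermEquiv n η' η := by
  have hn0 : n ≠ 0 := (lt_of_lt_of_le one_pos hn).ne'
  obtain ⟨Ψ, hΨ, hη⟩ := h
  refine ⟨Ψ.symm, hΨ.symm, ?_⟩
  have hc : Tendsto Ψ.symm (𝓝 0) (𝓝 0) := by
    simpa [ContinuousAt, hΨ.symm.map_zero] using Ψ.symm.continuousAt hΨ.symm.zero_mem
  filter_upwards [hc.eventually hη, Ψ.symm.open_source.mem_nhds hΨ.symm.zero_mem] with y h1 h2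
  have h3 : Ψ.symm y ∈ Ψ.source := Ψ.map_target h2
  have h4 : pullback Ψ.symm η y = pullback Ψ.symm (pullback Ψ η') y := by
    rw [pullback, pullback, h1]
  rw [h4, ← pullback_comp ((hΨ.contDiffAt h3).differentiableAt hn0)
    ((hΨ.symm.contDiffAt h2).differentiableAt hn0)]
  have h5 : Ψ ∘ Ψ.symm =ᶠ[𝓝 y] id := Ψ.eventually_right_inverse h2
  rw [pullback_congr h5]
  refine ext_toBilin fun a b => ?_
  rw [toBilin_pullback]
  simp

lemma GermEquiv.of_map [CompleteSpace E] (hn : 1 ≤ n) {η η' : E → E [⋀^Fin 2]→L[ℝ] ℝ} {φ : E → E}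
    (hφ : ∀ᶠ x in 𝓝 0, ContDiffAt ℝ n φ x) (h0 : φ 0 = 0) (e : E ≃L[ℝ] E)
    (he : (e : E →L[ℝ] E) = fderiv ℝ φ 0) (h : pullback φ η' =ᶠ[𝓝 0] η) : GermEquiv n η η' := by
  have hn0 : n ≠ 0 := (lt_of_lt_of_le one_pos hn).ne'
  obtain ⟨Ψ, hΨ, hs, h1, h2⟩ := exists_openPartialHomeomorph hn hφ e
    (he ▸ (hφ.self_of_nhds.differentiableAt hn0).hasFDerivAt)
  refine ⟨Ψ, ⟨hs, by rw [hΨ, h0], fun x hx => ?_, fun y hy => (h2 y hy).contDiffWithinAt⟩, ?_⟩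
  · rw [hΨ]; exact (h1 x hx).contDiffWithinAt
  · rw [hΨ]; exact h

end GermEquiv

/-! ### Moser's method, by suspension to ℝ × E. -/

section Moser

lemma eventually_eq_of_hasDerivAt_zero {E F : Type*} [NormedAddCommGroup E] [NormedSpace ℝ E]
    [NormedAddCommGroup F] [NormedSpace ℝ F] {f : ℝ × E → F}
    (h : ∀ᶠ q in 𝓝 (0 : ℝ × E), HasDerivAt (fun ε => f (ε, q.2)) 0 q.1) :
    ∀ᶠ q in 𝓝 (0 : ℝ × E), f q = f (0, q.2) := by
  obtain ⟨r, hr, H⟩ := Metric.eventually_nhds_iff.1 h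
  filter_upwards [Metric.ball_mem_nhds (0 : ℝ × E) hr] with q hq
  have hq' : dist q.1 0 < r ∧ dist q.2 0 < r := by
    have : dist q 0 < r := hq
    rwa [Prod.dist_eq, max_lt_iff] at this
  have hd : ∀ ε ∈ Metric.ball (0 : ℝ) r,
      HasDerivWithinAt (fun ε => f (ε, q.2)) 0 (Metric.ball (0 : ℝ) r) ε := by
    intro ε hε
    refine (@H (ε, q.2) ?_).hasDerivWithinAt
    rw [Prod.dist_eq, max_lt_iff]
    exact ⟨hε, hq'.2⟩
  have := (convex_ball (0 : ℝ) r).norm_image_sub_le_of_norm_hasDerivWithin_le (C := 0) hd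
    (fun _ _ => by simp) (Metric.mem_ball_self hr) (Metric.mem_ball.2 hq'.1)
  rw [zero_mul, norm_le_zero_iff, sub_eq_zero] at this
  exact this

lemma minSmoothness_two_le {n : WithTop ℕ∞} (hn : n = ∞ ∨ n = ω) : minSmoothness ℝ 2 ≤ n := by
  rw [minSmoothness_of_isRCLikeNormedField]
  rcases hn with rfl | rfl
  · exact WithTop.coe_le_coe.2 (le_top (a := (2 : ℕ∞)))
  · exact le_top

variable {E : Type} [NormedAddCommGroup E] [NormedSpace ℝ E]

/-- The differential of a 1-form, as a bilinear map. -/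
noncomputable def oneFormDeriv (β : E → E →L[ℝ] ℝ) (x a b : E) : ℝ :=
  fderiv ℝ β x a b - fderiv ℝ β x b a

/-- The 1-form `s β` on `ℝ × E`. -/
noncomputable def suspendedForm (β : E → E →L[ℝ] ℝ) (q : ℝ × E) :
    (ℝ × E) [⋀^Fin 1]→L[ℝ] ℝ :=
  ContinuousAlternatingMap.ofSubsingletonLIE (𝕜 := ℝ) (0 : Fin 1)
    (q.1 • (β q.2).comp (ContinuousLinearMap.snd ℝ ℝ E))

/-- The closed 2-form `η + d(s β)` on `ℝ × E`. -/
noncomputable def suspension (η : E → E [⋀^Fin 2]→L[ℝ] ℝ) (β : E → E →L[ℝ] ℝ) (q : ℝ × E) :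
    (ℝ × E) [⋀^Fin 2]→L[ℝ] ℝ :=
  pullback Prod.snd η q + extDeriv (suspendedForm β) q

lemma contDiffAt_suspendedForm {n : WithTop ℕ∞} {β : E → E →L[ℝ] ℝ} {q : ℝ × E}
    (h : ContDiffAt ℝ n β q.2) : ContDiffAt ℝ n (suspendedForm β) q := by
  have h1 : ContDiffAt ℝ n (fun q : ℝ × E =>
      q.1 • (β q.2).comp (ContinuousLinearMap.snd ℝ ℝ E)) q :=
    contDiffAt_fst.smul ((h.comp q contDiffAt_snd).clm_comp contDiffAt_const)
  exact (ContinuousAlternatingMap.ofSubsingletonLIE (𝕜 := ℝ) (E := ℝ × E) (F := ℝ)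
    (0 : Fin 1)).contDiff.contDiffAt.comp q h1

lemma extDeriv_suspendedForm {β : E → E →L[ℝ] ℝ} {q : ℝ × E}
    (h : DifferentiableAt ℝ β q.2) (A B : ℝ × E) :
    toBilin (ℝ × E) (extDeriv (suspendedForm β) q) A B =
      A.1 * β q.2 B.2 - B.1 * β q.2 A.2 + q.1 * oneFormDeriv β q.2 A.2 B.2 := by
  have h1 : HasFDerivAt (fun q : ℝ × E => (β q.2).comp (ContinuousLinearMap.snd ℝ ℝ E))
      (((ContinuousLinearMap.compL ℝ (ℝ × E) E ℝ).flip (ContinuousLinearMap.snd ℝ ℝ E)).comp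
        ((fderiv ℝ β q.2).comp (ContinuousLinearMap.snd ℝ ℝ E))) q :=
    ((ContinuousLinearMap.compL ℝ (ℝ × E) E ℝ).flip
      (ContinuousLinearMap.snd ℝ ℝ E)).hasFDerivAt.comp q (h.hasFDerivAt.comp q hasFDerivAt_snd)
  have h2 := (ContinuousAlternatingMap.ofSubsingletonLIE (𝕜 := ℝ) (E := ℝ × E) (F := ℝ)
    (0 : Fin 1)).toContinuousLinearEquiv.hasFDerivAt.comp q ((hasFDerivAt_fst (𝕜 := ℝ)).smul h1)
  have h3 : ∀ A B : ℝ × E, fderiv ℝ (suspendedForm β) q A ![B] =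
      q.1 * fderiv ℝ β q.2 A.2 B.2 + A.1 * β q.2 B.2 := by
    intro A B
    rw [show fderiv ℝ (suspendedForm β) q = _ from h2.fderiv]
    rfl
  rw [toBilin_apply, extDeriv, ContinuousAlternatingMap.alternatizeUncurryFin_apply,
    Fin.sum_univ_two]
  have e0 : (Fin.removeNth 0 ![A, B] : Fin 1 → ℝ × E) = ![B] := by
    ext i <;> fin_cases i <;> rfl
  have e1 : (Fin.removeNth 1 ![A, B] : Fin 1 → ℝ × E) = ![A] := by
    ext i <;> fin_cases i <;> rfl
  rw [e0, e1]
  simp [h3, oneFormDeriv]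
  ring

lemma toBilin_suspension {η : E → E [⋀^Fin 2]→L[ℝ] ℝ} {β : E → E →L[ℝ] ℝ} {q : ℝ × E}
    (h : DifferentiableAt ℝ β q.2) (A B : ℝ × E) :
    toBilin (ℝ × E) (suspension η β q) A B = toBilin E (η q.2) A.2 B.2 +
      (A.1 * β q.2 B.2 - B.1 * β q.2 A.2 + q.1 * oneFormDeriv β q.2 A.2 B.2) := by
  rw [suspension, map_add, add_apply, add_apply, toBilin_pullback, extDeriv_suspendedForm h,
    fderiv_snd]
  rfl

lemma differentiableAt_pullback {F : Type} [NormedAddCommGroup F] [NormedSpace ℝ F]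
    {φ : E → F} {η : F → F [⋀^Fin 2]→L[ℝ] ℝ} {x : E} {n : WithTop ℕ∞} (hn : 2 ≤ n)
    (hφ : ContDiffAt ℝ n φ x) (hη : DifferentiableAt ℝ η (φ x)) :
    DifferentiableAt ℝ (pullback φ η) x := by
  have h1 : DifferentiableAt ℝ (fderiv ℝ φ) x :=
    (hφ.fderiv_right (m := 1) hn).differentiableAt one_ne_zero
  have h2 : DifferentiableAt ℝ φ x := hφ.differentiableAt (lt_of_lt_of_le two_pos hn).ne'
  exact (HasFDerivAt.continuousAlternatingMapCompContinuousLinearMap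
    (hη.comp x h2).hasFDerivAt h1.hasFDerivAt).differentiableAt

/-- The differential commutes with pullback, and d ∘ d = 0 on the second summand. Working on ℝ × E
replaces the time-dependent form by one closed form. -/
lemma extDeriv_suspension {n : WithTop ℕ∞} (hn : n = ∞ ∨ n = ω)
    {η : E → E [⋀^Fin 2]→L[ℝ] ℝ} {β : E → E →L[ℝ] ℝ} {q : ℝ × E}
    (hη : ContDiffAt ℝ n η q.2) (hc : extDeriv η q.2 = 0) (hβ : ContDiffAt ℝ n β q.2) :
    DifferentiableAt ℝ (suspension η β) q ∧ extDeriv (suspension η β) q = 0 := by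
  have h2 : (2 : WithTop ℕ∞) ≤ n := by
    simpa [minSmoothness_of_isRCLikeNormedField] using minSmoothness_two_le hn
  have hd : DifferentiableAt ℝ η q.2 := hη.differentiableAt (lt_of_lt_of_le two_pos h2).ne'
  have h1 : DifferentiableAt ℝ (pullback (Prod.snd : ℝ × E → E) η) q :=
    differentiableAt_pullback h2 (contDiffAt_snd (n := n)) hd
  have h3 : DifferentiableAt ℝ (extDeriv (suspendedForm β)) q := by
    have : DifferentiableAt ℝ (fderiv ℝ (suspendedForm β)) q :=
      ((contDiffAt_suspendedForm hβ).fderiv_right (m := 1) h2).differentiableAt one_ne_zero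
    exact (ContinuousAlternatingMap.alternatizeUncurryFinCLM ℝ (ℝ × E) ℝ).differentiableAt.comp q
      this
  refine ⟨h1.add h3, ?_⟩
  have h4 : extDeriv (suspension η β) q = extDeriv (pullback (Prod.snd : ℝ × E → E) η) q +
      extDeriv (extDeriv (suspendedForm β)) q := extDeriv_add h1 h3
  rw [h4, extDeriv_extDeriv_apply (contDiffAt_suspendedForm hβ) (minSmoothness_two_le hn),
    add_zero]
  have h5 : extDeriv (pullback (Prod.snd : ℝ × E → E) η) q = _ :=
    extDeriv_pullback hd (contDiffAt_snd (n := n)) (minSmoothness_two_le hn)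
  rw [h5, hc]
  rfl

/-- Pulling back a closed 2-form along the flow of a vector field in its kernel gives a form which
does not depend on time. -/
lemma eventually_pullback_eq_of_kernel {Y : Type} [NormedAddCommGroup Y] [NormedSpace ℝ Y]
    {n : WithTop ℕ∞} (hn : n = ∞ ∨ n = ω) {Ω : Y → Y [⋀^Fin 2]→L[ℝ] ℝ} {W : Y → Y} {G : ℝ × E → Y}
    (hG : ∀ᶠ q in 𝓝 0, ContDiffAt ℝ n G q)
    (hΩ : ∀ᶠ y in 𝓝 (G 0), DifferentiableAt ℝ Ω y ∧ extDeriv Ω y = 0)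
    (hW : ∀ᶠ y in 𝓝 (G 0), ∀ B, toBilin Y (Ω y) (W y) B = 0)
    (hGW : ∀ᶠ q in 𝓝 0, fderiv ℝ G q (1, 0) = W (G q)) :
    ∀ᶠ q in 𝓝 (0 : ℝ × E), pullback G Ω q = pullback G Ω (0, q.2) := by
  have h2 : (2 : WithTop ℕ∞) ≤ n := by
    simpa [minSmoothness_of_isRCLikeNormedField] using minSmoothness_two_le hn
  have hGc : Tendsto G (𝓝 0) (𝓝 (G 0)) := hG.self_of_nhds.continuousAt
  have hker : ∀ᶠ q in 𝓝 0, ∀ B, toBilin (ℝ × E) (pullback G Ω q) (1, 0) B = 0 := by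
    filter_upwards [hGc.eventually hW, hGW] with q h1 h3 B
    rw [toBilin_pullback, h3, h1]
  refine eventually_eq_of_hasDerivAt_zero ?_
  filter_upwards [hG, hGc.eventually hΩ, hker.eventually_nhds] with q hq hΩq hkq
  have hd : DifferentiableAt ℝ (pullback G Ω) q := differentiableAt_pullback h2 hq hΩq.1
  have hcl : extDeriv (pullback G Ω) q = 0 := by
    have h5 : extDeriv (pullback G Ω) q = _ :=
      extDeriv_pullback hΩq.1 hq (minSmoothness_two_le hn)
    rw [h5, hΩq.2]
    rfl
  -- The pulled-back form is annihilated by the time direction. In its closedness identity the two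
  -- terms containing that contraction therefore drop out, leaving the time derivative of the form.
  have hzero : fderiv ℝ (pullback G Ω) q (1, 0) = 0 := by
    refine ext_toBilin fun A B => ?_
    have h6 : ∀ A B, toBilin (ℝ × E) (fderiv ℝ (pullback G Ω) q A) (1, 0) B = 0 := by
      intro A B
      rw [← fderiv_toBilin hd]
      have : (fun p => toBilin (ℝ × E) (pullback G Ω p) (1, 0) B) =ᶠ[𝓝 q] fun _ => 0 :=
        hkq.mono fun p hp => hp B
      rw [this.fderiv_eq]
      simp
    have h7 := extDeriv_apply_three (pullback G Ω) q (1, 0) A B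
    rw [hcl, h6, h6] at h7
    change 0 = _ at h7
    rw [sub_zero, add_zero] at h7
    rw [← h7, map_zero]
    rfl
  have h8 : HasDerivAt (fun ε : ℝ => (ε, q.2)) ((1 : ℝ), (0 : E)) q.1 :=
    (hasDerivAt_id q.1).prodMk (hasDerivAt_const q.1 q.2)
  have h9 := HasFDerivAt.comp_hasDerivAt (l := pullback G Ω) (f := fun ε : ℝ => (ε, q.2)) q.1
    hd.hasFDerivAt h8
  rw [hzero] at h9
  exact h9

variable [FiniteDimensional ℝ E]

/-- Moser's method near one value of the parameter: a vector field `V` solving the homological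
equation and vanishing at the origin gives diffeomorphism-germs between nearby members of the
family `η + s dβ`. -/
theorem eventually_germEquiv_of_homological {n : WithTop ℕ∞} (hn : n = ∞ ∨ n = ω)
    {η : E → E [⋀^Fin 2]→L[ℝ] ℝ} {β : E → E →L[ℝ] ℝ} {V : ℝ × E → E} {s₀ : ℝ}
    (hη : ∀ᶠ x in 𝓝 0, ContDiffAt ℝ n η x) (hc : ∀ᶠ x in 𝓝 0, extDeriv η x = 0)
    (hβ : ∀ᶠ x in 𝓝 0, ContDiffAt ℝ n β x) (hV : ∀ᶠ q in 𝓝 (s₀, 0), ContDiffAt ℝ n V q)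
    (hV0 : ∀ᶠ s in 𝓝 s₀, V (s, 0) = 0)
    (heq : ∀ᶠ q in 𝓝 (s₀, 0), ∀ b, toBilin E (η q.2) (V q) b +
      q.1 * oneFormDeriv β q.2 (V q) b + β q.2 b = 0)
    {η' : ℝ → E → E [⋀^Fin 2]→L[ℝ] ℝ}
    (hη' : ∀ᶠ x in 𝓝 0, ∀ s a b, toBilin E (η' s x) a b =
      toBilin E (η x) a b + s * oneFormDeriv β x a b) :
    ∀ᶠ s in 𝓝 s₀, GermEquiv n (η' s₀) (η' s) := by
  have hcomp := FiniteDimensional.complete ℝ E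
  have h2 : (2 : WithTop ℕ∞) ≤ n := by
    simpa [minSmoothness_of_isRCLikeNormedField] using minSmoothness_two_le hn
  have hn1 : 1 ≤ n := le_trans (by norm_num) h2
  have hn0 : n ≠ 0 := (lt_of_lt_of_le one_pos hn1).ne'
  -- The component 1 makes the flow move the parameter at unit speed, so time ε carries the slice s₀
  -- to the slice s₀ + ε.
  set W : ℝ × E → ℝ × E := fun q => (1, V q)
  have hWn : ∀ᶠ q in 𝓝 (s₀, (0 : E)), ContDiffAt ℝ n W q :=
    hV.mono fun q hq => contDiffAt_const.prodMk hq
  obtain ⟨F, hFn, hF0, hFW⟩ := exists_local_flow hn hWn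
  set G : ℝ × E → ℝ × E := fun q => F (q.1, (s₀, q.2))
  have hemb : Tendsto (fun q : ℝ × E => (q.1, (s₀, q.2))) (𝓝 0) (𝓝 (0, (s₀, 0))) :=
    Continuous.tendsto' (by fun_prop) _ _ rfl
  have hGn : ∀ᶠ q in 𝓝 0, ContDiffAt ℝ n G q := by
    filter_upwards [hemb.eventually hFn] with q hq
    exact hq.comp q (contDiffAt_fst.prodMk (contDiffAt_const.prodMk contDiffAt_snd))
  have hG0 : ∀ᶠ x in 𝓝 (0 : E), G (0, x) = (s₀, x) := by
    have : Tendsto (fun x : E => (s₀, x)) (𝓝 0) (𝓝 (s₀, 0)) :=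
      Continuous.tendsto' (by fun_prop) _ _ rfl
    exact this.eventually hF0
  have hGW : ∀ᶠ q in 𝓝 (0 : ℝ × E), HasDerivAt (fun ε => G (ε, q.2)) (W (G q)) q.1 :=
    hemb.eventually hFW
  have hG00 : G 0 = (s₀, 0) := hG0.self_of_nhds
  have hGc : Tendsto G (𝓝 0) (𝓝 (s₀, 0)) := hG00 ▸ hGn.self_of_nhds.continuousAt
  have hslice : Tendsto (fun q : ℝ × E => ((0 : ℝ), q.2)) (𝓝 0) (𝓝 0) :=
    Continuous.tendsto' (by fun_prop) _ _ rfl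
  have hsnd : Tendsto (fun q : ℝ × E => q.2) (𝓝 (s₀, 0)) (𝓝 0) :=
    Continuous.tendsto' (by fun_prop) _ _ rfl
  have hsnd0 : Tendsto (fun q : ℝ × E => q.2) (𝓝 0) (𝓝 0) :=
    Continuous.tendsto' (by fun_prop) _ _ rfl
  have hG1 : ∀ᶠ q in 𝓝 (0 : ℝ × E), (G q).1 = s₀ + q.1 := by
    have h3 : ∀ᶠ q in 𝓝 (0 : ℝ × E), (G q).1 - q.1 = (G (0, q.2)).1 - 0 := by
      refine eventually_eq_of_hasDerivAt_zero (f := fun q : ℝ × E => (G q).1 - q.1) ?_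
      filter_upwards [hGW] with q hq
      have h4 : HasDerivAt (fun ε => (G (ε, q.2)).1) 1 q.1 :=
        HasFDerivAt.comp_hasDerivAt (l := Prod.fst) (f := fun ε => G (ε, q.2)) q.1
          hasFDerivAt_fst hq
      have h5 := h4.sub (hasDerivAt_id q.1)
      rw [sub_self] at h5
      exact h5
    filter_upwards [h3, hsnd0.eventually hG0] with q h4 h5
    rw [h5] at h4
    simp only at h4
    linarith
  have hGd : ∀ᶠ q in 𝓝 (0 : ℝ × E), fderiv ℝ G q (1, 0) = W (G q) := by
    filter_upwards [hGW, hGn] with q h3 h4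
    have h5 := HasFDerivAt.comp_hasDerivAt (l := G) (f := fun ε : ℝ => (ε, q.2)) q.1
      (h4.differentiableAt hn0).hasFDerivAt
      ((hasDerivAt_id q.1).prodMk (hasDerivAt_const q.1 q.2))
    exact h5.unique h3
  have hβd : ∀ᶠ q in 𝓝 (s₀, (0 : E)), DifferentiableAt ℝ β q.2 :=
    hsnd.eventually (hβ.mono fun x hx => hx.differentiableAt hn0)
  have hΩ : ∀ᶠ q in 𝓝 (G 0), DifferentiableAt ℝ (suspension η β) q ∧
      extDeriv (suspension η β) q = 0 := by
    rw [hG00]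
    filter_upwards [hsnd.eventually hη, hsnd.eventually hc, hsnd.eventually hβ] with q h3 h4 h5
    exact extDeriv_suspension hn h3 h4 h5
  have hker : ∀ᶠ q in 𝓝 (G 0), ∀ B, toBilin (ℝ × E) (suspension η β q) (W q) B = 0 := by
    rw [hG00]
    filter_upwards [hβd, heq] with q h3 h4 B
    rw [toBilin_suspension h3]
    -- Testing the homological equation on V itself gives β(V) = 0 by skew-symmetry; this handles
    -- the parameter component of B.
    have h5 := h4 (V q)
    rw [toBilin_self, oneFormDeriv, sub_self] at h5
    simp only [W]
    linear_combination h4 B.2 - B.1 * h5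
  have hconst := eventually_pullback_eq_of_kernel hn hGn hΩ hker hGd
  set ψ : ℝ → E → E := fun ε x => (G (ε, x)).2
  have hψ : ∀ᶠ q in 𝓝 (0 : ℝ × E), ∀ a, fderiv ℝ (ψ q.1) q.2 a = (fderiv ℝ G q (0, a)).2 := by
    filter_upwards [hGn] with q hq a
    have h3 : HasFDerivAt (ψ q.1) ((ContinuousLinearMap.snd ℝ ℝ E).comp ((fderiv ℝ G q).comp
        (ContinuousLinearMap.inr ℝ ℝ E))) q.2 :=
      hasFDerivAt_snd.comp q.2 (HasFDerivAt.comp (g := G) (f := fun x => (q.1, x)) q.2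
        (hq.differentiableAt hn0).hasFDerivAt (hasFDerivAt_prodMk_right q.1 q.2))
    rw [h3.fderiv]
    rfl
  have hG1d : ∀ᶠ q in 𝓝 (0 : ℝ × E), ∀ a, (fderiv ℝ G q (0, a)).1 = 0 := by
    filter_upwards [hGn, hG1.eventually_nhds] with q h3 h4 a
    have h5 : HasFDerivAt (fun p : ℝ × E => (G p).1) _ q :=
      hasFDerivAt_fst.comp q (h3.differentiableAt hn0).hasFDerivAt
    have h6 : HasFDerivAt (fun p : ℝ × E => s₀ + p.1) (ContinuousLinearMap.fst ℝ ℝ E) q :=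
      hasFDerivAt_fst.const_add s₀
    have h7 := h5.unique (h6.congr_of_eventuallyEq h4)
    exact congrArg (fun T => T (0, a)) h7
  have hform : ∀ᶠ q in 𝓝 (0 : ℝ × E), ∀ a b,
      toBilin (ℝ × E) (pullback G (suspension η β) q) (0, a) (0, b) =
        toBilin E (η' (s₀ + q.1) (ψ q.1 q.2)) (fderiv ℝ (ψ q.1) q.2 a)
          (fderiv ℝ (ψ q.1) q.2 b) := by
    filter_upwards [hGc.eventually hβd, hψ, hG1d, hG1, (hsnd.comp hGc).eventually hη']
      with q h3 h4 h5 h6 h7 a b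
    rw [toBilin_pullback, toBilin_suspension h3, h5, h5, ← h4, ← h4, h6]
    have h8 := h7 (s₀ + q.1) (fderiv ℝ (ψ q.1) q.2 a) (fderiv ℝ (ψ q.1) q.2 b)
    simp only [Function.comp_apply] at h8
    rw [show ψ q.1 q.2 = (G q).2 from rfl, h8]
    ring
  have hψ0 : ∀ᶠ x in 𝓝 (0 : E), ψ 0 x = x := hG0.mono fun x hx => by simp only [ψ, hx]
  have hψ0d : ∀ᶠ x in 𝓝 (0 : E), fderiv ℝ (ψ 0) x = ContinuousLinearMap.id ℝ E := by
    filter_upwards [hψ0.eventually_nhds] with x hx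
    have h3 : ψ 0 =ᶠ[𝓝 x] id := hx
    rw [h3.fderiv_eq, fderiv_id]
  have hpb : ∀ᶠ q in 𝓝 (0 : ℝ × E), pullback (ψ q.1) (η' (s₀ + q.1)) q.2 = η' s₀ q.2 := by
    filter_upwards [hconst, hform, hslice.eventually hform, hsnd0.eventually hψ0,
      hsnd0.eventually hψ0d] with q h3 h4 h5 h6 h7
    refine ext_toBilin fun a b => ?_
    rw [toBilin_pullback, ← h4, h3, h5]
    simp only [add_zero]
    rw [h6, h7]
    rfl
  have hψz : ∀ᶠ ε in 𝓝 (0 : ℝ), ψ ε 0 = 0 := by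
    obtain ⟨K, t, ht, hL⟩ := (hWn.self_of_nhds.of_le hn1).exists_lipschitzOnWith
    have hc0 : Tendsto (fun ε : ℝ => (ε, (0 : E))) (𝓝 0) (𝓝 0) :=
      Continuous.tendsto' (by fun_prop) _ _ rfl
    have hc1 : Tendsto (fun ε : ℝ => (s₀ + ε, (0 : E))) (𝓝 0) (𝓝 (s₀, 0)) :=
      Continuous.tendsto' (by fun_prop) _ _ (by simp)
    have hc2 : Tendsto (fun ε : ℝ => s₀ + ε) (𝓝 0) (𝓝 s₀) :=
      Continuous.tendsto' (by fun_prop) _ _ (by simp)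
    -- Because V vanishes at the origin, ε ↦ (s₀ + ε, 0) is an integral curve, and uniqueness makes
    -- it the orbit of (s₀, 0).
    have h3 : (fun ε => G (ε, 0)) =ᶠ[𝓝 0] fun ε => (s₀ + ε, (0 : E)) := by
      refine ODE_solution_unique_of_eventually (v := fun _ => W) (s := fun _ => t) (K := K)
        (Eventually.of_forall fun _ => hL) ?_ ?_ (hG00.trans (by simp))
      · filter_upwards [hc0.eventually hGW, (hGc.comp hc0).eventually ht] with ε h4 h5
        exact ⟨h4, h5⟩
      · filter_upwards [hc1.eventually ht, hc2.eventually hV0] with ε h4 h5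
        refine ⟨?_, h4⟩
        simp only [W, h5]
        exact ((hasDerivAt_id ε).const_add s₀).prodMk (hasDerivAt_const ε 0)
    filter_upwards [h3] with ε h4
    simp only [ψ, h4]
  have hinv : ∀ᶠ ε in 𝓝 (0 : ℝ), ∃ e : E ≃L[ℝ] E, (e : E →L[ℝ] E) = fderiv ℝ (ψ ε) 0 := by
    have hc0 : Tendsto (fun ε : ℝ => (ε, (0 : E))) (𝓝 0) (𝓝 0) :=
      Continuous.tendsto' (by fun_prop) _ _ rfl
    set T : ℝ × E → E →L[ℝ] E := fun q => (ContinuousLinearMap.snd ℝ ℝ E).comp ((fderiv ℝ G q).comp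
        (ContinuousLinearMap.inr ℝ ℝ E))
    have hT : ∀ᶠ q in 𝓝 (0 : ℝ × E), T q = fderiv ℝ (ψ q.1) q.2 := by
      filter_upwards [hψ] with q hq
      ext a
      rw [hq]
      rfl
    have hT0 : T 0 = ContinuousLinearEquiv.refl ℝ E := by
      rw [hT.self_of_nhds]
      exact hψ0d.self_of_nhds
    have hTc : ContinuousAt T 0 :=
      continuousAt_const.clm_comp
        (((hGn.self_of_nhds.fderiv_right (m := 0) (by simpa)).continuousAt).clm_comp
          continuousAt_const)
    have h3 : ∀ᶠ A in 𝓝 (T 0), ∃ e : E ≃L[ℝ] E, (e : E →L[ℝ] E) = A := by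
      rw [hT0]
      exact ContinuousLinearEquiv.nhds _
    filter_upwards [hc0.eventually (hTc.eventually h3), hc0.eventually hT] with ε h4 h5
    rwa [h5] at h4
  have hψn : ∀ᶠ q in 𝓝 (0 : ℝ × E), ContDiffAt ℝ n (ψ q.1) q.2 := by
    filter_upwards [hGn] with q hq
    exact contDiffAt_snd.comp q.2 (ContDiffAt.comp (g := G) (f := fun x => (q.1, x)) q.2 hq
      (contDiffAt_const.prodMk contDiffAt_id))
  have hfin : ∀ᶠ ε in 𝓝 (0 : ℝ), GermEquiv n (η' s₀) (η' (s₀ + ε)) := by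
    rw [show (0 : ℝ × E) = ((0 : ℝ), (0 : E)) from rfl, nhds_prod_eq] at hψn hpb
    filter_upwards [hψn.curry, hpb.curry, hψz, hinv] with ε h3 h4 h5 ⟨e, he⟩
    exact GermEquiv.of_map hn1 h3 h5 e he h4
  have hshift : Tendsto (fun s : ℝ => s - s₀) (𝓝 s₀) (𝓝 0) :=
    Continuous.tendsto' (by fun_prop) _ _ (by simp)
  filter_upwards [hshift.eventually hfin] with s hs
  simpa using hs

end Moser

/-! ### Pfaffian and contact-form identities. -/

section PfaffianAlgebra

/-- The adjugate of a skew-symmetric `4 × 4` matrix relative to its Pfaffian. -/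
def pfaffianAdjugate (M : Fin 4 → Fin 4 → ℝ) : Fin 4 → Fin 4 → ℝ :=
  ![![0, M 2 3, -M 1 3, M 1 2], ![-M 2 3, 0, M 0 3, -M 0 2],
    ![M 1 3, -M 0 3, 0, M 0 1], ![-M 1 2, M 0 2, -M 0 1, 0]]

/-- Skew 4 × 4 matrices are inverted up to the Pfaffian by a matrix linear in their entries. It
remains of class C where the form degenerates, so the Pfaffian is the only denominator. -/
lemma sum_pfaffianAdjugate_mul {M : Fin 4 → Fin 4 → ℝ} (hM : ∀ i j, M i j = -M j i)
    (g : Fin 4 → ℝ) (b : Fin 4) :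
    ∑ a, (∑ c, g c * pfaffianAdjugate M c a) * M a b =
      -(M 0 1 * M 2 3 - M 0 2 * M 1 3 + M 0 3 * M 1 2) * g b := by
  have h0 : ∀ i, M i i = 0 := fun i => by linarith [hM i i]
  have h10 := hM 1 0
  have h20 := hM 2 0
  have h30 := hM 3 0
  have h21 := hM 2 1
  have h31 := hM 3 1
  have h32 := hM 3 2
  fin_cases b <;>
    simp [Fin.sum_univ_four, pfaffianAdjugate, h0, h10, h20, h30, h21, h31, h32] <;> ring

/-- Here `du b i` stands for ∂_b u_i, so the bracketed sums are coefficients of u ∧ du and the like.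
The hypotheses give u ∧ dv = k u ∧ du and v ∧ dv = k² u ∧ du, and the expansion is a perfect square.
-/
lemma contactForm_interpolation {u v : Fin 3 → ℝ} {du dv : Fin 3 → Fin 3 → ℝ} {k s : ℝ}
    (hv : ∀ i, v i = k * u i)
    (hdiv : u 0 * (dv 1 2 - dv 2 1) + u 1 * (dv 2 0 - dv 0 2) + u 2 * (dv 0 1 - dv 1 0) =
      v 0 * (du 1 2 - du 2 1) + v 1 * (du 2 0 - du 0 2) + v 2 * (du 0 1 - du 1 0)) :
    ((1 - s) * u 0 + s * v 0) * (((1 - s) * du 1 2 + s * dv 1 2) - ((1 - s) * du 2 1 + s * dv 2 1)) +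
    ((1 - s) * u 1 + s * v 1) * (((1 - s) * du 2 0 + s * dv 2 0) - ((1 - s) * du 0 2 + s * dv 0 2)) +
    ((1 - s) * u 2 + s * v 2) * (((1 - s) * du 0 1 + s * dv 0 1) - ((1 - s) * du 1 0 + s * dv 1 0)) =
    (1 - s + s * k) ^ 2 * (u 0 * (du 1 2 - du 2 1) + u 1 * (du 2 0 - du 0 2) +
      u 2 * (du 0 1 - du 1 0)) := by
  simp only [hv] at hdiv ⊢
  linear_combination ((1 - s) * s + s ^ 2 * k) * hdiv

end PfaffianAlgebra

/-! ### Coefficients of 2-forms on ℝ^m. -/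

section Coefficients

variable {m : ℕ}

lemma coeff_eq_toBilin (η : (Fin m → ℝ) → (Fin m → ℝ) [⋀^Fin 2]→L[ℝ] ℝ) (i j : Fin m)
    (x : Fin m → ℝ) :
    coeff η i j x = toBilin (Fin m → ℝ) (η x) (Pi.single i 1) (Pi.single j 1) :=
  (toBilin_apply _ _ _).symm

lemma coeff_swap (η : (Fin m → ℝ) → (Fin m → ℝ) [⋀^Fin 2]→L[ℝ] ℝ) (i j : Fin m)
    (x : Fin m → ℝ) : coeff η i j x = -coeff η j i x := by
  rw [coeff_eq_toBilin, coeff_eq_toBilin, toBilin_swap]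

lemma contDiffAt_coeff {n : WithTop ℕ∞} {η : (Fin m → ℝ) → (Fin m → ℝ) [⋀^Fin 2]→L[ℝ] ℝ}
    {x : Fin m → ℝ} (h : ContDiffAt ℝ n η x) (i j : Fin m) : ContDiffAt ℝ n (coeff η i j) x := by
  have h1 : ContDiffAt ℝ n (fun y => toBilin (Fin m → ℝ) (η y) (Pi.single i 1) (Pi.single j 1)) x :=
    (h.toBilin.clm_apply contDiffAt_const).clm_apply contDiffAt_const
  rwa [show coeff η i j = fun y => toBilin (Fin m → ℝ) (η y) (Pi.single i 1) (Pi.single j 1) from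
    funext fun y => coeff_eq_toBilin η i j y]

lemma fderiv_coeff {η : (Fin m → ℝ) → (Fin m → ℝ) [⋀^Fin 2]→L[ℝ] ℝ}
    {x : Fin m → ℝ} (h : DifferentiableAt ℝ η x) (i j : Fin m) (a : Fin m → ℝ) :
    fderiv ℝ (coeff η i j) x a =
      toBilin (Fin m → ℝ) (fderiv ℝ η x a) (Pi.single i 1) (Pi.single j 1) := by
  rw [← fderiv_toBilin h, show coeff η i j = fun y => toBilin (Fin m → ℝ) (η y) (Pi.single i 1)
    (Pi.single j 1) from funext fun y => coeff_eq_toBilin η i j y]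

lemma closed_coeff {η : (Fin m → ℝ) → (Fin m → ℝ) [⋀^Fin 2]→L[ℝ] ℝ}
    {x : Fin m → ℝ} (h : DifferentiableAt ℝ η x) (hc : extDeriv η x = 0) (i j k : Fin m) :
    fderiv ℝ (coeff η j k) x (Pi.single i 1) - fderiv ℝ (coeff η i k) x (Pi.single j 1) +
      fderiv ℝ (coeff η i j) x (Pi.single k 1) = 0 := by
  have h1 := extDeriv_apply_three η x (Pi.single i 1) (Pi.single j 1) (Pi.single k 1)
  rw [hc] at h1
  rw [fderiv_coeff h, fderiv_coeff h, fderiv_coeff h]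
  exact h1.symm

lemma clm_ext_single {F : Type*} [AddCommGroup F] [Module ℝ F] [TopologicalSpace F]
    {L L' : (Fin m → ℝ) →L[ℝ] F} (h : ∀ i, L (Pi.single i 1) = L' (Pi.single i 1)) : L = L' := by
  refine ContinuousLinearMap.coe_injective (LinearMap.pi_ext' fun i => LinearMap.ext_ring ?_)
  exact h i

lemma clm_apply_eq_sum (L : (Fin m → ℝ) →L[ℝ] ℝ) (v : Fin m → ℝ) :
    L v = ∑ i, v i * L (Pi.single i 1) := by
  conv_lhs => rw [pi_eq_sum_univ' v]
  rw [map_sum]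
  refine Finset.sum_congr rfl fun i _ => ?_
  rw [map_smul, smul_eq_mul]

lemma toBilin_single (θ : (Fin m → ℝ) [⋀^Fin 2]→L[ℝ] ℝ) (v : Fin m → ℝ) (b : Fin m → ℝ) :
    toBilin (Fin m → ℝ) θ v b = ∑ i, v i * toBilin (Fin m → ℝ) θ (Pi.single i 1) b := by
  have := clm_apply_eq_sum ((toBilin (Fin m → ℝ) θ).flip b) v
  simpa using this

end Coefficients

/-! ### The equivalence when the Martinet hypersurface is x₃ = 0. -/

section Flat

/-- The last coordinate of `ℝ⁴`. -/
noncomputable abbrev lastCoord : (Fin 4 → ℝ) →L[ℝ] ℝ := ContinuousLinearMap.proj 3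

/-- The last basis vector of `ℝ⁴`. -/
abbrev lastVec : Fin 4 → ℝ := Pi.single 3 1

/-- The linear interpolation of two 2-forms. -/
noncomputable def interpolate (ω₀ ω₁ : (Fin 4 → ℝ) → (Fin 4 → ℝ) [⋀^Fin 2]→L[ℝ] ℝ) (s : ℝ)
    (x : Fin 4 → ℝ) : (Fin 4 → ℝ) [⋀^Fin 2]→L[ℝ] ℝ :=
  ω₀ x + s • (ω₁ x - ω₀ x)

lemma toBilin_interpolate (ω₀ ω₁ : (Fin 4 → ℝ) → (Fin 4 → ℝ) [⋀^Fin 2]→L[ℝ] ℝ) (s : ℝ)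
    (x a b : Fin 4 → ℝ) : toBilin (Fin 4 → ℝ) (interpolate ω₀ ω₁ s x) a b =
      toBilin (Fin 4 → ℝ) (ω₀ x) a b + s * toBilin (Fin 4 → ℝ) (ω₁ x - ω₀ x) a b := by
  rw [interpolate, map_add, map_smul]
  rfl

lemma coeff_interpolate (ω₀ ω₁ : (Fin 4 → ℝ) → (Fin 4 → ℝ) [⋀^Fin 2]→L[ℝ] ℝ) (s : ℝ)
    (i j : Fin 4) (x : Fin 4 → ℝ) : coeff (interpolate ω₀ ω₁ s) i j x =
      (1 - s) * coeff ω₀ i j x + s * coeff ω₁ i j x := by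
  simp only [coeff_eq_toBilin]
  rw [toBilin_interpolate, map_sub, sub_apply, sub_apply]
  ring

variable {n : WithTop ℕ∞}

/-- With α the contraction with ∂/∂x₃, this is -2 times the coefficient of α ∧ dα. Since the
coefficients without index 3 vanish at 0, only their ∂₃-derivatives survive, and closedness rewrites
these as derivatives of α along the hyperplane. -/
lemma fderiv_squareCoeff {θ : (Fin 4 → ℝ) → (Fin 4 → ℝ) [⋀^Fin 2]→L[ℝ] ℝ}
    (hθ : DifferentiableAt ℝ θ 0) (hc : extDeriv θ 0 = 0) (h01 : coeff θ 0 1 0 = 0)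
    (h02 : coeff θ 0 2 0 = 0) (h12 : coeff θ 1 2 0 = 0) (hd : ∀ i j, DifferentiableAt ℝ (coeff θ i j) 0) :
    fderiv ℝ (squareCoeff θ) 0 lastVec = -2 *
      (coeff θ 3 0 0 * (fderiv ℝ (coeff θ 3 2) 0 (Pi.single 1 1)
          - fderiv ℝ (coeff θ 3 1) 0 (Pi.single 2 1)) +
        coeff θ 3 1 0 * (fderiv ℝ (coeff θ 3 0) 0 (Pi.single 2 1)
          - fderiv ℝ (coeff θ 3 2) 0 (Pi.single 0 1)) +
        coeff θ 3 2 0 * (fderiv ℝ (coeff θ 3 1) 0 (Pi.single 0 1)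
          - fderiv ℝ (coeff θ 3 0) 0 (Pi.single 1 1))) := by
  have hf := ((((hd 0 1).hasFDerivAt.mul (hd 2 3).hasFDerivAt).sub
    ((hd 0 2).hasFDerivAt.mul (hd 1 3).hasFDerivAt)).add
    ((hd 0 3).hasFDerivAt.mul (hd 1 2).hasFDerivAt)).const_mul 2
  rw [show fderiv ℝ (squareCoeff θ) 0 = _ from hf.fderiv]
  have e1 := closed_coeff hθ hc 3 0 1
  have e2 := closed_coeff hθ hc 3 0 2
  have e3 := closed_coeff hθ hc 3 1 2
  simp only [add_apply, sub_apply, smul_apply, smul_eq_mul, h01, h02, h12,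
    coeff_swap θ 2 3, coeff_swap θ 1 3, coeff_swap θ 0 3, lastVec]
  linear_combination (-2 * coeff θ 3 2 0) * e1 + (2 * coeff θ 3 1 0) * e2
    + (-2 * coeff θ 3 0 0) * e3

variable {ω₀ ω₁ : (Fin 4 → ℝ) → (Fin 4 → ℝ) [⋀^Fin 2]→L[ℝ] ℝ}

/-- Solvability of the homological equation for the interpolation of two singular symplectic forms
with the same Martinet hypersurface `x₃ = 0` and the same restriction to it. -/
lemma eventually_germEquiv_interpolate (hn : n = ∞ ∨ n = ω)
    (hω₀ : ∀ᶠ x in 𝓝 0, ContDiffAt ℝ n ω₀ x) (hω₁ : ∀ᶠ x in 𝓝 0, ContDiffAt ℝ n ω₁ x)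
    (hc₀ : ∀ᶠ x in 𝓝 0, extDeriv ω₀ x = 0) (hc₁ : ∀ᶠ x in 𝓝 0, extDeriv ω₁ x = 0)
    (hres : ∀ᶠ x in 𝓝 (0 : Fin 4 → ℝ), x 3 = 0 → ∀ i j : Fin 4, i ≠ 3 → j ≠ 3 →
      coeff ω₀ i j x = coeff ω₁ i j x)
    (hzero : ∀ i j : Fin 4, i ≠ 3 → j ≠ 3 → coeff ω₀ i j 0 = 0)
    (hsq₀ : ∀ᶠ x in 𝓝 (0 : Fin 4 → ℝ), x 3 = 0 → squareCoeff ω₀ x = 0)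
    (hsq₁ : ∀ᶠ x in 𝓝 (0 : Fin 4 → ℝ), x 3 = 0 → squareCoeff ω₁ x = 0)
    {k : ℝ} (hk : ∀ i, coeff ω₁ 3 i 0 = k * coeff ω₀ 3 i 0) {s₀ : ℝ}
    (hd : fderiv ℝ (squareCoeff (interpolate ω₀ ω₁ s₀)) 0 lastVec ≠ 0) :
    ∀ᶠ s in 𝓝 s₀, GermEquiv n (interpolate ω₀ ω₁ s₀) (interpolate ω₀ ω₁ s) := by
  have hn1 : 1 ≤ n := by rcases hn with rfl | rfl <;> simp
  have hn0 : n ≠ 0 := (lt_of_lt_of_le one_pos hn1).ne'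
  set η : (Fin 4 → ℝ) → (Fin 4 → ℝ) [⋀^Fin 2]→L[ℝ] ℝ := fun x => ω₁ x - ω₀ x
  have hη : ∀ᶠ x in 𝓝 0, ContDiffAt ℝ n η x := by
    filter_upwards [hω₀, hω₁] with x h0 h1 using h1.sub h0
  have hηc : ∀ᶠ x in 𝓝 0, extDeriv η x = 0 := by
    filter_upwards [hω₀, hω₁, hc₀, hc₁] with x h0 h1 h2 h3
    have h4 : extDeriv η x = extDeriv ω₁ x - extDeriv ω₀ x := by
      have h5 : fderiv ℝ η x = fderiv ℝ ω₁ x - fderiv ℝ ω₀ x :=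
        fderiv_fun_sub (h1.differentiableAt hn0) (h0.differentiableAt hn0)
      rw [extDeriv, extDeriv, extDeriv, h5]
      exact map_sub (ContinuousAlternatingMap.alternatizeUncurryFinCLM ℝ (Fin 4 → ℝ) ℝ) _ _
    rw [h4, h2, h3, sub_zero]
  have hηr : ∀ᶠ x in 𝓝 (0 : Fin 4 → ℝ), lastCoord x = 0 → ∀ a b, lastCoord a = 0 →
      lastCoord b = 0 → toBilin (Fin 4 → ℝ) (η x) a b = 0 := by
    filter_upwards [hres] with x hx h0 a b ha hb
    rw [toBilin_single]
    refine Finset.sum_eq_zero fun i _ => ?_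
    by_cases hi : i = 3
    · subst hi
      rw [show a 3 = 0 from ha, zero_mul]
    rw [toBilin_swap, toBilin_single, Finset.sum_eq_zero, neg_zero, mul_zero]
    intro j _
    by_cases hj : j = 3
    · subst hj
      rw [show b 3 = 0 from hb, zero_mul]
    · have h1 := hx h0 j i hj hi
      rw [coeff_eq_toBilin, coeff_eq_toBilin] at h1
      rw [map_sub, sub_apply, sub_apply, h1, sub_self, mul_zero]
  have hl1 : lastCoord lastVec = 1 := by simp
  set γ := homotopyForm lastCoord lastVec η
  have hγ : ∀ᶠ x in 𝓝 0, ContDiffAt ℝ n γ x := by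
    refine eventually_contDiffAt_average hn lastVec (by simp) ?_
    filter_upwards [hη] with x hx using hx.toBilin.clm_apply contDiffAt_const
  set β : (Fin 4 → ℝ) → (Fin 4 → ℝ) →L[ℝ] ℝ := fun x => lastCoord x • γ x
  have hβ : ∀ᶠ x in 𝓝 0, ContDiffAt ℝ n β x := by
    filter_upwards [hγ] with x hx using lastCoord.contDiff.contDiffAt.smul hx
  have hdβ : ∀ᶠ x in 𝓝 (0 : Fin 4 → ℝ), ∀ a b,
      oneFormDeriv β x a b = toBilin (Fin 4 → ℝ) (η x) a b :=
    eventually_extDeriv_homotopyForm hn hl1 (by simp) hη hηc hηr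
  set A : Fin 4 → Fin 4 → ℝ × (Fin 4 → ℝ) → ℝ :=
    fun i j q => coeff (interpolate ω₀ ω₁ q.1) i j q.2
  have hsnd : Tendsto (fun q : ℝ × (Fin 4 → ℝ) => q.2) (𝓝 (s₀, 0)) (𝓝 0) :=
    Continuous.tendsto' (by fun_prop) _ _ rfl
  have hA : ∀ᶠ q in 𝓝 (s₀, (0 : Fin 4 → ℝ)), ∀ i j, ContDiffAt ℝ n (A i j) q := by
    filter_upwards [hsnd.eventually hω₀, hsnd.eventually hω₁] with q h0 h1 i j
    have h2 : A i j = fun q => (1 - q.1) * coeff ω₀ i j q.2 + q.1 * coeff ω₁ i j q.2 :=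
      funext fun q => coeff_interpolate ω₀ ω₁ q.1 i j q.2
    rw [h2]
    exact ((contDiffAt_const.sub contDiffAt_fst).mul
      ((contDiffAt_coeff h0 i j).comp q contDiffAt_snd)).add
      (contDiffAt_fst.mul ((contDiffAt_coeff h1 i j).comp q contDiffAt_snd))
  set f : ℝ × (Fin 4 → ℝ) → ℝ := fun q => squareCoeff (interpolate ω₀ ω₁ q.1) q.2
  have hf : ∀ᶠ q in 𝓝 (s₀, (0 : Fin 4 → ℝ)), ContDiffAt ℝ n f q := by
    filter_upwards [hA] with q hq
    exact contDiffAt_const.mul ((((hq 0 1).mul (hq 2 3)).sub ((hq 0 2).mul (hq 1 3))).add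
      ((hq 0 3).mul (hq 1 2)))
  set l : ℝ × (Fin 4 → ℝ) →L[ℝ] ℝ := lastCoord.comp (ContinuousLinearMap.snd ℝ ℝ (Fin 4 → ℝ))
  set e : ℝ × (Fin 4 → ℝ) := (0, lastVec)
  -- The square is quadratic in the form, but on x₃ = 0 both forms have the same restriction, so
  -- there it is affine in s and vanishes at both ends.
  have hf0 : ∀ᶠ q in 𝓝 (s₀, (0 : Fin 4 → ℝ)), l q = 0 → f q = 0 := by
    filter_upwards [hsnd.eventually hsq₀, hsnd.eventually hsq₁, hsnd.eventually hres]
      with q h0 h1 h2 hq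
    have h0' := h0 hq
    have h1' := h1 hq
    have h2' := h2 hq
    simp only [f, squareCoeff, coeff_interpolate] at h0' h1' ⊢
    rw [← h2' 0 1 (by decide) (by decide), ← h2' 0 2 (by decide) (by decide),
      ← h2' 1 2 (by decide) (by decide)] at h1' ⊢
    linear_combination (1 - q.1) * h0' + q.1 * h1'
  set κ : ℝ × (Fin 4 → ℝ) → ℝ := average l e fun z => fderiv ℝ f z e
  have hfκ : ∀ᶠ q in 𝓝 (s₀, (0 : Fin 4 → ℝ)), f q = l q * κ q :=
    eventually_eq_mul_average hn (by simp [l, e]) (by simp [l]) hf hf0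
  have hκ : ∀ᶠ q in 𝓝 (s₀, (0 : Fin 4 → ℝ)), ContDiffAt ℝ n κ q := by
    refine eventually_contDiffAt_average hn e (by simp [l]) ?_
    filter_upwards [hf] with q hq
    refine (hq.fderiv_right (m := n) ?_).clm_apply contDiffAt_const
    rcases hn with rfl | rfl <;> simp
  have hκ0 : κ (s₀, 0) ≠ 0 := by
    have h1 : κ (s₀, 0) = fderiv ℝ f (s₀, 0) e := average_of_eq_zero e (by simp [l]) _
    have h2 : HasFDerivAt (fun x : Fin 4 → ℝ => f (s₀, x)) _ 0 :=
      HasFDerivAt.comp (g := f) (f := fun x => (s₀, x)) 0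
        (hf.self_of_nhds.differentiableAt hn0).hasFDerivAt (hasFDerivAt_prodMk_right s₀ 0)
    have h3 : fderiv ℝ (squareCoeff (interpolate ω₀ ω₁ s₀)) 0 lastVec = fderiv ℝ f (s₀, 0) e := by
      rw [show squareCoeff (interpolate ω₀ ω₁ s₀) = fun x => f (s₀, x) from rfl, h2.fderiv]
      rfl
    rwa [h1, ← h3]
  have hκne : ∀ᶠ q in 𝓝 (s₀, (0 : Fin 4 → ℝ)), κ q ≠ 0 :=
    hκ.self_of_nhds.continuousAt.eventually_ne hκ0
  set c : Fin 4 → (Fin 4 → ℝ) → ℝ := fun i x => γ x (Pi.single i 1)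
  -- The Pfaffian is f/2 = x₃κ/2. With the factor 2/κ, contracting the form with V gives exactly
  -- -x₃γ, so no division by x₃ remains.
  set V : ℝ × (Fin 4 → ℝ) → Fin 4 → ℝ := fun q a =>
    2 / κ q * ∑ b, c b q.2 * pfaffianAdjugate (fun i j => A i j q) b a
  have hV : ∀ᶠ q in 𝓝 (s₀, (0 : Fin 4 → ℝ)), ContDiffAt ℝ n V q := by
    filter_upwards [hA, hκ, hκne, hsnd.eventually hγ] with q h1 h2 h3 h4
    rw [contDiffAt_pi]
    intro a
    refine (contDiffAt_const.div h2 h3).mul (ContDiffAt.sum fun b _ => ?_)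
    refine ContDiffAt.mul ((h4.comp q contDiffAt_snd).clm_apply contDiffAt_const) ?_
    have h5 : ∀ i j, ContDiffAt ℝ n (fun q => -A i j q) q := fun i j => (h1 i j).neg
    fin_cases b <;> fin_cases a <;> first
      | exact contDiffAt_const
      | exact h1 _ _
      | exact h5 _ _
  have hcl : Tendsto (fun s : ℝ => (s, (0 : Fin 4 → ℝ))) (𝓝 s₀) (𝓝 (s₀, 0)) :=
    Continuous.tendsto' (by fun_prop) _ _ rfl
  -- At the origin the interpolated form is (1 - s + sk) dx₃ ∧ α₀ and γ = (k - 1)α₀; the adjugate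
  -- turns V into a multiple of the cross product of α₀ with itself.
  have hV0 : ∀ᶠ s in 𝓝 s₀, V (s, 0) = 0 := by
    refine Eventually.of_forall fun s => ?_
    have hz1 : ∀ i j : Fin 4, i ≠ 3 → j ≠ 3 → coeff ω₁ i j 0 = 0 := fun i j hi hj => by
      rw [← hres.self_of_nhds rfl i j hi hj, hzero i j hi hj]
    have hA0 : ∀ i j : Fin 4, i ≠ 3 → j ≠ 3 → A i j (s, 0) = 0 := fun i j hi hj => by
      simp only [A, coeff_interpolate, hzero i j hi hj, hz1 i j hi hj, mul_zero, add_zero]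
    have hA3 : ∀ i : Fin 4, A i 3 (s, 0) = -((1 - s + s * k) * coeff ω₀ 3 i 0) := fun i => by
      simp only [A, coeff_interpolate, coeff_swap _ i 3, hk]
      ring
    have hc0 : ∀ i, c i 0 = (k - 1) * coeff ω₀ 3 i 0 := fun i => by
      have h1 : γ 0 = toBilin (Fin 4 → ℝ) (η 0) lastVec :=
        average_of_eq_zero lastVec (by simp) _
      have h2 : c i 0 = coeff ω₁ 3 i 0 - coeff ω₀ 3 i 0 := by
        simp only [c, h1, coeff_eq_toBilin]
        rw [map_sub, sub_apply, sub_apply]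
      rw [h2, hk]
      ring
    have h33 : coeff ω₀ 3 3 0 = 0 := by linarith [coeff_swap ω₀ 3 3 0]
    funext a
    have h01 := hA0 0 1 (by decide) (by decide)
    have h02 := hA0 0 2 (by decide) (by decide)
    have h12 := hA0 1 2 (by decide) (by decide)
    simp only [V, Fin.sum_univ_four, pfaffianAdjugate, hc0, h33, h01, h02, h12, hA3]
    fin_cases a <;> simp <;> right <;> ring
  have heq : ∀ᶠ q in 𝓝 (s₀, (0 : Fin 4 → ℝ)), ∀ b, toBilin (Fin 4 → ℝ) (ω₀ q.2) (V q) b +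
      q.1 * oneFormDeriv β q.2 (V q) b + β q.2 b = 0 := by
    filter_upwards [hsnd.eventually hdβ, hfκ, hκne] with q h1 h2 h3 b
    rw [h1, ← toBilin_interpolate]
    suffices h4 : toBilin (Fin 4 → ℝ) (interpolate ω₀ ω₁ q.1 q.2) (V q) + β q.2 = 0 from
      congrArg (fun L => L b) h4
    refine clm_ext_single fun i => ?_
    rw [add_apply, toBilin_single]
    have h5 := sum_pfaffianAdjugate_mul (M := fun i j => A i j q)
      (fun i j => coeff_swap _ i j q.2) (fun i => c i q.2) i
    have h6 : ∀ a, toBilin (Fin 4 → ℝ) (interpolate ω₀ ω₁ q.1 q.2) (Pi.single a 1)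
        (Pi.single i 1) = A a i q := fun a => (coeff_eq_toBilin _ a i q.2).symm
    have h7 : f q = 2 * (A 0 1 q * A 2 3 q - A 0 2 q * A 1 3 q + A 0 3 q * A 1 2 q) := rfl
    have h8 : β q.2 (Pi.single i 1) = l q * c i q.2 := rfl
    simp only [h6, h8, V, mul_assoc]
    rw [← Finset.mul_sum, h5]
    have h9 : A 0 1 q * A 2 3 q - A 0 2 q * A 1 3 q + A 0 3 q * A 1 2 q = l q * κ q / 2 := by
      rw [← h2, h7]; ring
    rw [h9]
    change _ = (0 : ℝ)
    field_simp
    ring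
  refine eventually_germEquiv_of_homological hn hω₀ hc₀ hβ hV hV0 heq ?_
  filter_upwards [hdβ] with x hx s a b
  rw [hx, toBilin_interpolate]

/-- The normal form theorem in coordinates in which the Martinet hypersurface is `x₃ = 0`. -/
theorem germEquiv_of_flat (hn : n = ∞ ∨ n = ω)
    (hω₀ : ∀ᶠ x in 𝓝 0, ContDiffAt ℝ n ω₀ x) (hω₁ : ∀ᶠ x in 𝓝 0, ContDiffAt ℝ n ω₁ x)
    (hc₀ : ∀ᶠ x in 𝓝 0, extDeriv ω₀ x = 0) (hc₁ : ∀ᶠ x in 𝓝 0, extDeriv ω₁ x = 0)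
    (hres : ∀ᶠ x in 𝓝 (0 : Fin 4 → ℝ), x 3 = 0 → ∀ i j : Fin 4, i ≠ 3 → j ≠ 3 →
      coeff ω₀ i j x = coeff ω₁ i j x)
    (hzero : ∀ i j : Fin 4, i ≠ 3 → j ≠ 3 → coeff ω₀ i j 0 = 0)
    (hsq₀ : ∀ᶠ x in 𝓝 (0 : Fin 4 → ℝ), x 3 = 0 → squareCoeff ω₀ x = 0)
    (hsq₁ : ∀ᶠ x in 𝓝 (0 : Fin 4 → ℝ), x 3 = 0 → squareCoeff ω₁ x = 0)
    (hd₀ : fderiv ℝ (squareCoeff ω₀) 0 lastVec ≠ 0)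
    {k : ℝ} (hk0 : 0 < k) (hk : ∀ i, coeff ω₁ 3 i 0 = k * coeff ω₀ 3 i 0)
    (hdiv : coeff ω₀ 3 0 0 * (fderiv ℝ (coeff ω₁ 3 2) 0 (Pi.single 1 1)
          - fderiv ℝ (coeff ω₁ 3 1) 0 (Pi.single 2 1)) +
        coeff ω₀ 3 1 0 * (fderiv ℝ (coeff ω₁ 3 0) 0 (Pi.single 2 1)
          - fderiv ℝ (coeff ω₁ 3 2) 0 (Pi.single 0 1)) +
        coeff ω₀ 3 2 0 * (fderiv ℝ (coeff ω₁ 3 1) 0 (Pi.single 0 1)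
          - fderiv ℝ (coeff ω₁ 3 0) 0 (Pi.single 1 1)) =
      coeff ω₁ 3 0 0 * (fderiv ℝ (coeff ω₀ 3 2) 0 (Pi.single 1 1)
          - fderiv ℝ (coeff ω₀ 3 1) 0 (Pi.single 2 1)) +
        coeff ω₁ 3 1 0 * (fderiv ℝ (coeff ω₀ 3 0) 0 (Pi.single 2 1)
          - fderiv ℝ (coeff ω₀ 3 2) 0 (Pi.single 0 1)) +
        coeff ω₁ 3 2 0 * (fderiv ℝ (coeff ω₀ 3 1) 0 (Pi.single 0 1)
          - fderiv ℝ (coeff ω₀ 3 0) 0 (Pi.single 1 1))) :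
    GermEquiv n ω₀ ω₁ := by
  have hn1 : 1 ≤ n := by rcases hn with rfl | rfl <;> simp
  have hn0 : n ≠ 0 := (lt_of_lt_of_le one_pos hn1).ne'
  have hz1 : ∀ i j : Fin 4, i ≠ 3 → j ≠ 3 → coeff ω₁ i j 0 = 0 := fun i j hi hj => by
    rw [← hres.self_of_nhds rfl i j hi hj, hzero i j hi hj]
  have hD₀ := hω₀.self_of_nhds.differentiableAt hn0
  have hD₁ := hω₁.self_of_nhds.differentiableAt hn0
  have hC₀ : ∀ i j, DifferentiableAt ℝ (coeff ω₀ i j) 0 := fun i j =>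
    (contDiffAt_coeff hω₀.self_of_nhds i j).differentiableAt hn0
  have hC₁ : ∀ i j, DifferentiableAt ℝ (coeff ω₁ i j) 0 := fun i j =>
    (contDiffAt_coeff hω₁.self_of_nhds i j).differentiableAt hn0
  have hfi : ∀ s i j, HasFDerivAt (coeff (interpolate ω₀ ω₁ s) i j)
      ((1 - s) • fderiv ℝ (coeff ω₀ i j) 0 + s • fderiv ℝ (coeff ω₁ i j) 0) 0 := by
    intro s i j
    rw [show coeff (interpolate ω₀ ω₁ s) i j =
      fun x => (1 - s) * coeff ω₀ i j x + s * coeff ω₁ i j x from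
      funext fun x => coeff_interpolate ω₀ ω₁ s i j x]
    exact ((hC₀ i j).hasFDerivAt.const_mul (1 - s)).add ((hC₁ i j).hasFDerivAt.const_mul s)
  have hds : ∀ s ∈ Set.Icc (0 : ℝ) 1,
      fderiv ℝ (squareCoeff (interpolate ω₀ ω₁ s)) 0 lastVec ≠ 0 := by
    intro s hs
    have hDs : HasFDerivAt (interpolate ω₀ ω₁ s)
        (fderiv ℝ ω₀ 0 + s • (fderiv ℝ ω₁ 0 - fderiv ℝ ω₀ 0)) 0 :=
      hD₀.hasFDerivAt.add ((hD₁.hasFDerivAt.sub hD₀.hasFDerivAt).const_smul s)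
    have hcs : extDeriv (interpolate ω₀ ω₁ s) 0 = 0 := by
      have h1 := map_add (ContinuousAlternatingMap.alternatizeUncurryFinCLM ℝ (Fin 4 → ℝ) ℝ)
        (fderiv ℝ ω₀ 0) (s • (fderiv ℝ ω₁ 0 - fderiv ℝ ω₀ 0))
      have h2 := map_smul (ContinuousAlternatingMap.alternatizeUncurryFinCLM ℝ (Fin 4 → ℝ) ℝ) s
        (fderiv ℝ ω₁ 0 - fderiv ℝ ω₀ 0)
      have h3 := map_sub (ContinuousAlternatingMap.alternatizeUncurryFinCLM ℝ (Fin 4 → ℝ) ℝ)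
        (fderiv ℝ ω₁ 0) (fderiv ℝ ω₀ 0)
      replace h1 := h1.trans (congrArg₂ (· + ·) rfl (h2.trans (congrArg (s • ·) h3)))
      rw [extDeriv, hDs.fderiv]
      refine h1.trans ?_
      change extDeriv ω₀ 0 + s • (extDeriv ω₁ 0 - extDeriv ω₀ 0) = 0
      rw [hc₀.self_of_nhds, hc₁.self_of_nhds]
      simp
    have hzs : ∀ i j : Fin 4, i ≠ 3 → j ≠ 3 → coeff (interpolate ω₀ ω₁ s) i j 0 = 0 :=
      fun i j hi hj => by rw [coeff_interpolate, hzero i j hi hj, hz1 i j hi hj]; simp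
    rw [fderiv_squareCoeff hDs.differentiableAt hcs (hzs 0 1 (by decide) (by decide))
      (hzs 0 2 (by decide) (by decide)) (hzs 1 2 (by decide) (by decide))
      fun i j => (hfi s i j).differentiableAt]
    rw [fderiv_squareCoeff hD₀ hc₀.self_of_nhds (hzero 0 1 (by decide) (by decide))
      (hzero 0 2 (by decide) (by decide)) (hzero 1 2 (by decide) (by decide)) hC₀] at hd₀
    have key := contactForm_interpolation (u := ![coeff ω₀ 3 0 0, coeff ω₀ 3 1 0, coeff ω₀ 3 2 0])
      (v := ![coeff ω₁ 3 0 0, coeff ω₁ 3 1 0, coeff ω₁ 3 2 0])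
      (du := fun b => ![fderiv ℝ (coeff ω₀ 3 0) 0 (Pi.single b.castSucc 1),
        fderiv ℝ (coeff ω₀ 3 1) 0 (Pi.single b.castSucc 1),
        fderiv ℝ (coeff ω₀ 3 2) 0 (Pi.single b.castSucc 1)])
      (dv := fun b => ![fderiv ℝ (coeff ω₁ 3 0) 0 (Pi.single b.castSucc 1),
        fderiv ℝ (coeff ω₁ 3 1) 0 (Pi.single b.castSucc 1),
        fderiv ℝ (coeff ω₁ 3 2) 0 (Pi.single b.castSucc 1)]) (k := k) (s := s)
      (fun i => by fin_cases i <;> exact hk _) hdiv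
    -- The sign of k matters here: for k < 0 this factor vanishes at s = 1/(1 - k), inside [0, 1].
    have hpos : (1 - s + s * k) ^ 2 ≠ 0 := by
      have : 0 < 1 - s + s * k := by
        rcases hs.2.lt_or_eq with h | h
        · have := mul_nonneg hs.1 hk0.le
          linarith
        · rw [h]; linarith
      positivity
    have hne := mul_ne_zero hpos ((mul_ne_zero_iff.1 hd₀).2)
    refine mul_ne_zero (by norm_num) (fun h0 => hne ?_)
    rw [← h0]
    simp only [(hfi s _ _).fderiv, coeff_interpolate]
    exact key.symm
  -- Each s has a neighbourhood of equivalent forms; an equivalence relation that is locally trivial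
  -- on a connected interval is trivial.
  have hconn := (isPreconnected_Icc (a := (0 : ℝ)) (b := 1)).induction₂
    (fun s t => GermEquiv n (interpolate ω₀ ω₁ s) (interpolate ω₀ ω₁ t))
    (fun s hs => (eventually_germEquiv_interpolate hn hω₀ hω₁ hc₀ hc₁ hres hzero hsq₀ hsq₁ hk
      (hds s hs)).filter_mono nhdsWithin_le_nhds)
    (fun _ _ _ _ _ _ h h' => h.trans hn1 h') (fun _ _ _ _ h => h.symm hn1)
    (Set.left_mem_Icc.2 zero_le_one) (Set.right_mem_Icc.2 zero_le_one)
  have e0 : interpolate ω₀ ω₁ 0 = ω₀ := by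
    funext x; simp [interpolate]
  have e1 : interpolate ω₀ ω₁ 1 = ω₁ := by
    funext x; simp [interpolate]
  rwa [e0, e1] at hconn

end Flat

/-! ### Division of proportional vectors by means of a regular sequence. -/

section RegularSequence

open scoped Pointwise in
/-- A vector proportional to `X` is a multiple of `X` if the ideal generated by the entries of `X`
contains a regular sequence of length two. -/
lemma exists_eq_mul_of_proportional {R κ : Type*} [CommRing R] {X Y : κ → R}
    (hXY : ∀ a b, Y a * X b = Y b * X a) {g₁ g₂ : R} (h₁ : g₁ ∈ Ideal.span (Set.range X))
    (h₂ : g₂ ∈ Ideal.span (Set.range X)) (hreg : RingTheory.Sequence.IsRegular R [g₁, g₂]) :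
    ∃ h, ∀ a, Y a = h * X a := by
  -- Every g in the ideal is a denominator: gY is a multiple of X. For a generator X_b the
  -- multiplier is Y_b.
  have key : ∀ g ∈ Ideal.span (Set.range X), ∃ y, ∀ a, g * Y a = y * X a := by
    intro g hg
    induction hg using Submodule.span_induction with
    | mem x hx =>
      obtain ⟨b, rfl⟩ := hx
      exact ⟨Y b, fun a => by rw [mul_comm, hXY]⟩
    | zero => exact ⟨0, fun a => by simp⟩
    | add x x' _ _ hx hx' =>
      obtain ⟨y, hy⟩ := hx
      obtain ⟨y', hy'⟩ := hx'
      exact ⟨y + y', fun a => by rw [add_mul, add_mul, hy, hy']⟩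
    | smul r x _ hx =>
      obtain ⟨y, hy⟩ := hx
      exact ⟨r * y, fun a => by rw [smul_eq_mul, mul_assoc, hy, mul_assoc]⟩
  have ann : ∀ z, (∀ a, z * X a = 0) → ∀ g ∈ Ideal.span (Set.range X), z * g = 0 := by
    intro z hz g hg
    induction hg using Submodule.span_induction with
    | mem x hx =>
      obtain ⟨b, rfl⟩ := hx
      exact hz b
    | zero => simp
    | add x x' _ _ hx hx' => rw [mul_add, hx, hx', add_zero]
    | smul r x _ hx => rw [smul_eq_mul, mul_left_comm, hx, mul_zero]
  have hw := hreg.toIsWeaklyRegular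
  rw [RingTheory.Sequence.isWeaklyRegular_cons_iff,
    RingTheory.Sequence.isWeaklyRegular_cons_iff] at hw
  obtain ⟨hr₁, hr₂, -⟩ := hw
  obtain ⟨y₁, hy₁⟩ := key g₁ h₁
  obtain ⟨y₂, hy₂⟩ := key g₂ h₂
  -- The element g₂y₁ - g₁y₂ kills X, hence kills g₁, hence is zero. Then g₂y₁ lies in ⟨g₁⟩, and
  -- regularity of g₂ modulo g₁ gives y₁ = g₁h; cancelling g₁ from g₁Y = g₁hX finishes.
  have e1 : g₁ • (g₂ * y₁ - g₁ * y₂) = g₁ • (0 : R) := by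
    rw [smul_zero, smul_eq_mul, mul_comm]
    refine ann _ (fun a => ?_) g₁ h₁
    linear_combination g₁ * hy₂ a - g₂ * hy₁ a
  have e2 := sub_eq_zero.1 (hr₁ e1)
  have e3 : y₁ ∈ g₁ • (⊤ : Submodule R R) := by
    refine mem_of_isSMulRegular_quotient_of_smul_mem hr₂ ?_
    rw [smul_eq_mul, e2]
    exact Submodule.smul_mem_pointwise_smul y₂ g₁ ⊤ trivial
  obtain ⟨h, -, rfl⟩ := e3
  refine ⟨h, fun a => hr₁ ?_⟩
  change g₁ * Y a = g₁ * (h * X a)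
  rw [hy₁ a]
  change g₁ * h * X a = _
  ring

/-- Indices are modulo 3, so the coefficients (a + 1, a + 2) are the entries of the vector dual to
σ. They generate the whole ideal, since other index pairs give zero or a sign change. -/
lemma exists_factor_of_regular {n : WithTop ℕ∞}
    {σ : (Fin 3 → ℝ) → (Fin 3 → ℝ) [⋀^Fin 2]→L[ℝ] ℝ} (hσ : IsGermOfClass n σ)
    {g₁ g₂ : functionGerms n (Fin 3 → ℝ)} (hI : coeffIdeal n σ = Ideal.span {g₁, g₂})
    (hreg : RingTheory.Sequence.IsRegular (functionGerms n (Fin 3 → ℝ)) [g₁, g₂])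
    {Y : Fin 3 → (Fin 3 → ℝ) → ℝ} (hY : ∀ a, IsGermOfClass n (Y a))
    (hYX : ∀ᶠ q in 𝓝 (0 : Fin 3 → ℝ), ∀ a b : Fin 3,
      Y a q * coeff σ (b + 1) (b + 2) q = Y b q * coeff σ (a + 1) (a + 2) q) :
    ∃ h : (Fin 3 → ℝ) → ℝ, IsGermOfClass n h ∧
      ∀ᶠ q in 𝓝 0, ∀ a : Fin 3, Y a q = h q * coeff σ (a + 1) (a + 2) q := by
  have hX : ∀ i j, IsGermOfClass n (coeff σ i j) := fun i j =>
    Eventually.mono hσ fun x hx => contDiffAt_coeff hx i j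
  let mk : ∀ f : (Fin 3 → ℝ) → ℝ, IsGermOfClass n f → functionGerms n (Fin 3 → ℝ) :=
    fun f hf => ⟨f, f, hf, rfl⟩
  let X' : Fin 3 → functionGerms n (Fin 3 → ℝ) := fun a => mk _ (hX (a + 1) (a + 2))
  let Y' : Fin 3 → functionGerms n (Fin 3 → ℝ) := fun a => mk _ (hY a)
  have hle : coeffIdeal n σ ≤ Ideal.span (Set.range X') := by
    refine Ideal.span_le.2 ?_
    rintro g ⟨i, j, hg⟩
    have hg' : g = mk _ (hX i j) := Subtype.ext hg
    have hs : ∀ i j, mk _ (hX i j) = -mk _ (hX j i) := fun i j => Subtype.ext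
      (congrArg (fun f : (Fin 3 → ℝ) → ℝ => (f : Germ (𝓝 (0 : Fin 3 → ℝ)) ℝ))
        (funext fun x => coeff_swap σ i j x))
    have h0 : ∀ i, mk _ (hX i i) = 0 := fun i => Subtype.ext
      (congrArg (fun f : (Fin 3 → ℝ) → ℝ => (f : Germ (𝓝 (0 : Fin 3 → ℝ)) ℝ))
        (funext fun x => by
          linarith [coeff_swap σ i i x]))
    have hmem : ∀ a, X' a ∈ Ideal.span (Set.range X') := fun a => Ideal.subset_span ⟨a, rfl⟩
    have hcase : i = j ∨ (∃ a : Fin 3, i = a + 1 ∧ j = a + 2) ∨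
        ∃ a : Fin 3, j = a + 1 ∧ i = a + 2 :=
      (show ∀ i j : Fin 3, i = j ∨ (∃ a : Fin 3, i = a + 1 ∧ j = a + 2) ∨
        ∃ a : Fin 3, j = a + 1 ∧ i = a + 2 by decide) i j
    rw [hg']
    rcases hcase with rfl | ⟨a, rfl, rfl⟩ | ⟨a, rfl, rfl⟩
    · rw [h0]; exact Ideal.zero_mem _
    · exact hmem a
    · rw [hs]; exact Submodule.neg_mem _ (hmem a)
  rw [hI] at hle
  obtain ⟨h, hh⟩ := exists_eq_mul_of_proportional (X := X') (Y := Y')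
    (fun a b => Subtype.ext (Germ.coe_eq.2 (hYX.mono fun q hq => hq a b)))
    (hle (Ideal.subset_span (by simp))) (hle (Ideal.subset_span (by simp))) hreg
  obtain ⟨_, f, hf, rfl⟩ := h
  refine ⟨f, hf, eventually_all.2 fun a => ?_⟩
  exact Germ.coe_eq.1 (congrArg Subtype.val (hh a))

end RegularSequence

/-! ### Change of variables for 2-forms, and the straightening map. -/

section Flattening

-- The Pfaffian of MᵀθM. Its entries are combinations of 2 × 2 minors of M, matched against the
-- Laplace expansion of the determinant along the first two columns.
set_option maxHeartbeats 1000000 in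
lemma pfaffian_congruence (M θ : Fin 4 → Fin 4 → ℝ) (hθ : ∀ i j, θ i j = -θ j i)
    {θ' : Fin 4 → Fin 4 → ℝ} (hθ' : ∀ i j, θ' i j = ∑ a, ∑ b, M a i * M b j * θ a b) :
    θ' 0 1 * θ' 2 3 - θ' 0 2 * θ' 1 3 + θ' 0 3 * θ' 1 2 =
      (Matrix.of M).det * (θ 0 1 * θ 2 3 - θ 0 2 * θ 1 3 + θ 0 3 * θ 1 2) := by
  have h0 : ∀ i, θ i i = 0 := fun i => by linarith [hθ i i]
  have h1 : ∀ i j, θ' i j = (M 0 i * M 1 j - M 1 i * M 0 j) * θ 0 1 +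
      (M 0 i * M 2 j - M 2 i * M 0 j) * θ 0 2 + (M 0 i * M 3 j - M 3 i * M 0 j) * θ 0 3 +
      (M 1 i * M 2 j - M 2 i * M 1 j) * θ 1 2 + (M 1 i * M 3 j - M 3 i * M 1 j) * θ 1 3 +
      (M 2 i * M 3 j - M 3 i * M 2 j) * θ 2 3 := by
    intro i j
    rw [hθ']
    simp only [Fin.sum_univ_four, h0, hθ 1 0, hθ 2 0, hθ 3 0, hθ 2 1, hθ 3 1, hθ 3 2]
    ring
  have hdet : (Matrix.of M).det =
      (M 0 0 * M 1 1 - M 1 0 * M 0 1) * (M 2 2 * M 3 3 - M 3 2 * M 2 3) -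
      (M 0 0 * M 2 1 - M 2 0 * M 0 1) * (M 1 2 * M 3 3 - M 3 2 * M 1 3) +
      (M 0 0 * M 3 1 - M 3 0 * M 0 1) * (M 1 2 * M 2 3 - M 2 2 * M 1 3) +
      (M 1 0 * M 2 1 - M 2 0 * M 1 1) * (M 0 2 * M 3 3 - M 3 2 * M 0 3) -
      (M 1 0 * M 3 1 - M 3 0 * M 1 1) * (M 0 2 * M 2 3 - M 2 2 * M 0 3) +
      (M 2 0 * M 3 1 - M 3 0 * M 2 1) * (M 0 2 * M 1 3 - M 1 2 * M 0 3) := by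
    simp [Matrix.det_succ_row_zero, Fin.sum_univ_succ, Fin.succAbove]
    ring
  rw [hdet]
  simp only [h1]
  ring

lemma squareCoeff_pullback (φ : (Fin 4 → ℝ) → (Fin 4 → ℝ))
    (η : (Fin 4 → ℝ) → (Fin 4 → ℝ) [⋀^Fin 2]→L[ℝ] ℝ) (x : Fin 4 → ℝ) :
    squareCoeff (pullback φ η) x =
      (Matrix.of fun a i => fderiv ℝ φ x (Pi.single i 1) a).det * squareCoeff η (φ x) := by
  have h := pfaffian_congruence (fun a i => fderiv ℝ φ x (Pi.single i 1) a)
    (fun i j => coeff η i j (φ x)) (fun i j => coeff_swap η i j (φ x))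
    (θ' := fun i j => coeff (pullback φ η) i j x) fun i j => by
      rw [coeff_eq_toBilin, toBilin_pullback, toBilin_single]
      refine Finset.sum_congr rfl fun a _ => ?_
      rw [toBilin_swap, toBilin_single, ← Finset.sum_neg_distrib, Finset.mul_sum]
      refine Finset.sum_congr rfl fun b _ => ?_
      rw [coeff_swap, coeff_eq_toBilin]
      ring
  rw [squareCoeff, squareCoeff]
  linear_combination 2 * h

/-- Half the antisymmetrization recovers the form, so regularity can be checked on the associated
bilinear map. -/
lemma exists_leftInverse_toBilin (E : Type) [NormedAddCommGroup E] [NormedSpace ℝ E] :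
    ∃ r : (E →L[ℝ] E →L[ℝ] ℝ) →L[ℝ] (E [⋀^Fin 2]→L[ℝ] ℝ), ∀ η, r (toBilin E η) = η := by
  let r : (E →L[ℝ] E →L[ℝ] ℝ) →L[ℝ] (E [⋀^Fin 2]→L[ℝ] ℝ) :=
    (ContinuousAlternatingMap.alternatizeUncurryFinCLM ℝ E ℝ) ∘L ContinuousLinearMap.postcomp E
      ((ContinuousAlternatingMap.ofSubsingletonLIE (𝕜 := ℝ) (E := E) (F := ℝ)
        (0 : Fin 1)).toContinuousLinearEquiv.toContinuousLinearMap)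
  have hr : ∀ B a b, toBilin E (r B) a b = B a b - B b a := by
    intro B a b
    rw [toBilin_apply]
    change ContinuousAlternatingMap.alternatizeUncurryFin _ ![a, b] = _
    rw [ContinuousAlternatingMap.alternatizeUncurryFin_apply, Fin.sum_univ_two]
    simp [sub_eq_add_neg]
    rfl
  refine ⟨(2 : ℝ)⁻¹ • r, fun η => ext_toBilin fun a b => ?_⟩
  rw [smul_apply, map_smul, smul_apply, smul_apply, hr, toBilin_swap η b a, smul_eq_mul]
  ring

/-- As a bilinear map the pullback is η ∘ φ composed with Dφ in each slot. Reaching the second slot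
requires a flip, which costs the sign in `h3`. The derivative of φ is still of class `n` for both
classes considered. -/
lemma contDiffAt_pullback {E F : Type} [NormedAddCommGroup E] [NormedSpace ℝ E]
    [NormedAddCommGroup F] [NormedSpace ℝ F] {n : WithTop ℕ∞}
    (hn : n = ∞ ∨ n = ω) {φ : E → F} {η : F → F [⋀^Fin 2]→L[ℝ] ℝ} {x : E}
    (hφ : ContDiffAt ℝ n φ x) (hη : ContDiffAt ℝ n η (φ x)) :
    ContDiffAt ℝ n (pullback φ η) x := by
  have hn' : n + 1 ≤ n := by rcases hn with rfl | rfl <;> simp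
  have h1 : ContDiffAt ℝ n (fderiv ℝ φ) x := hφ.fderiv_right hn'
  have h2 : ContDiffAt ℝ n (fun y => toBilin F (η (φ y))) x := (hη.comp x hφ).toBilin
  obtain ⟨r, hr⟩ := exists_leftInverse_toBilin E
  have h3 : ContDiffAt ℝ n (fun y => -toBilin E (pullback φ η y)) x := by
    refine ((((ContinuousLinearMap.flipₗᵢ ℝ E F ℝ).contDiff (n := n)).contDiffAt.comp x
      (h2.clm_comp h1)).clm_comp h1).congr_of_eventuallyEq (Eventually.of_forall fun y => ?_)
    ext a b
    change -toBilin E (pullback φ η y) a b = toBilin F (η (φ y)) (fderiv ℝ φ y b) (fderiv ℝ φ y a)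
    rw [toBilin_pullback, toBilin_swap]
    ring
  have h4 : ContDiffAt ℝ n (fun y => toBilin E (pullback φ η y)) x :=
    (ContDiffAt.neg h3).congr_of_eventuallyEq (Eventually.of_forall fun y => by
      ext a b
      exact (neg_neg (toBilin E (pullback φ η y) a b)).symm)
  have h6 := ContDiffAt.continuousLinearMap_comp (𝕜 := ℝ) (E := E) (F := E →L[ℝ] E →L[ℝ] ℝ)
    (G := E [⋀^Fin 2]→L[ℝ] ℝ) r h4
  rwa [show (⇑r ∘ fun y => toBilin E (pullback φ η y)) = pullback φ η from
    funext fun y => hr _] at h6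

/-- The inclusion of the hyperplane `x₃ = 0` in `ℝ⁴`. -/
noncomputable def planeIncl : (Fin 3 → ℝ) →L[ℝ] (Fin 4 → ℝ) :=
  ContinuousLinearMap.pi ![ContinuousLinearMap.proj 0, ContinuousLinearMap.proj 1,
    ContinuousLinearMap.proj 2, 0]

/-- The projection of `ℝ⁴` to its first three coordinates. -/
noncomputable def planeProj : (Fin 4 → ℝ) →L[ℝ] (Fin 3 → ℝ) :=
  ContinuousLinearMap.pi fun a => ContinuousLinearMap.proj a.castSucc

lemma planeProj_planeIncl (q : Fin 3 → ℝ) : planeProj (planeIncl q) = q := by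
  ext a; fin_cases a <;> rfl

lemma planeIncl_planeProj {x : Fin 4 → ℝ} (h : x 3 = 0) : planeIncl (planeProj x) = x := by
  ext a; fin_cases a
  · rfl
  · rfl
  · rfl
  · exact h.symm

lemma planeIncl_last (q : Fin 3 → ℝ) : planeIncl q 3 = 0 := rfl

lemma planeIncl_single (a : Fin 3) :
    planeIncl (Pi.single a 1) = Pi.single a.castSucc 1 := by
  ext i; fin_cases a <;> fin_cases i <;> simp [planeIncl]

lemma planeProj_lastVec : planeProj (Pi.single 3 1) = 0 := by
  ext a; fin_cases a <;> simp [planeProj]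

/-- The map `(q, t) ↦ ι(q) + t w`, straightening the hypersurface parametrized by `ι`. -/
noncomputable def straighten (ι : (Fin 3 → ℝ) → (Fin 4 → ℝ)) (w : Fin 4 → ℝ) :
    (Fin 4 → ℝ) → (Fin 4 → ℝ) :=
  fun x => ι (planeProj x) + x 3 • w

variable {ι : (Fin 3 → ℝ) → (Fin 4 → ℝ)} {w : Fin 4 → ℝ}

lemma straighten_planeIncl (q : Fin 3 → ℝ) : straighten ι w (planeIncl q) = ι q := by
  rw [straighten, planeProj_planeIncl, planeIncl_last, zero_smul, add_zero]

lemma fderiv_straighten {x : Fin 4 → ℝ} (h : DifferentiableAt ℝ ι (planeProj x))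
    (v : Fin 4 → ℝ) :
    fderiv ℝ (straighten ι w) x v = fderiv ℝ ι (planeProj x) (planeProj v) + v 3 • w := by
  have h1 : HasFDerivAt (straighten ι w) ((fderiv ℝ ι (planeProj x)).comp planeProj +
      (lastCoord).smulRight w) x :=
    (h.hasFDerivAt.comp x planeProj.hasFDerivAt).add (lastCoord.hasFDerivAt.smul_const w)
  rw [h1.fderiv]
  rfl

lemma contDiffAt_straighten {n : WithTop ℕ∞} {x : Fin 4 → ℝ}
    (h : ContDiffAt ℝ n ι (planeProj x)) : ContDiffAt ℝ n (straighten ι w) x :=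
  (h.comp x planeProj.contDiff.contDiffAt).add
    ((lastCoord.contDiff.contDiffAt).smul contDiffAt_const)

lemma exists_equiv_fderiv_straighten (hd : DifferentiableAt ℝ ι 0)
    (hinj : Function.Injective (fderiv ℝ ι 0)) (hw : w ∉ Set.range (fderiv ℝ ι 0)) :
    ∃ e : (Fin 4 → ℝ) ≃L[ℝ] (Fin 4 → ℝ),
      (e : (Fin 4 → ℝ) →L[ℝ] (Fin 4 → ℝ)) = fderiv ℝ (straighten ι w) 0 := by
  have hd' : DifferentiableAt ℝ ι (planeProj 0) := by rwa [map_zero]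
  have hinj' : Function.Injective (fderiv ℝ (straighten ι w) 0).toLinearMap := by
    refine (injective_iff_map_eq_zero _).2 fun v hv => ?_
    change fderiv ℝ (straighten ι w) 0 v = 0 at hv
    rw [fderiv_straighten hd', map_zero] at hv
    have h3 : v 3 = 0 := by
      by_contra h3
      refine hw ⟨-(v 3)⁻¹ • planeProj v, ?_⟩
      rw [map_smul, eq_neg_of_add_eq_zero_left hv, smul_neg, neg_smul, neg_neg, smul_smul,
        inv_mul_cancel₀ h3, one_smul]
    rw [h3, zero_smul, add_zero] at hv
    have h4 : planeProj v = 0 := hinj (hv.trans (map_zero _).symm)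
    rw [← planeIncl_planeProj h3, h4, map_zero]
  refine ⟨(LinearEquiv.ofInjectiveEndo _ hinj').toContinuousLinearEquiv, ?_⟩
  ext v : 1
  rfl

end Flattening

/-! ### Singular symplectic germs in straightened coordinates. -/

section Straighten

variable {n : WithTop ℕ∞} {ι : (Fin 3 → ℝ) → (Fin 4 → ℝ)} {w : Fin 4 → ℝ}
  {θ : (Fin 4 → ℝ) → (Fin 4 → ℝ) [⋀^Fin 2]→L[ℝ] ℝ}

lemma tendsto_planeProj : Tendsto planeProj (𝓝 0) (𝓝 0) := by
  simpa using planeProj.continuous.tendsto 0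

lemma tendsto_planeIncl : Tendsto planeIncl (𝓝 0) (𝓝 0) := by
  simpa using planeIncl.continuous.tendsto 0

lemma straighten_zero (h0 : ι 0 = 0) : straighten ι w 0 = 0 := by
  have := straighten_planeIncl (ι := ι) (w := w) 0
  rwa [map_zero, h0] at this

lemma isGermOfClass_straighten (hι : IsGermOfClass n ι) : IsGermOfClass n (straighten ι w) :=
  (tendsto_planeProj.eventually hι).mono fun _ hx => contDiffAt_straighten hx

lemma tendsto_straighten (hι : IsGermOfClass n ι) (h0 : ι 0 = 0) :
    Tendsto (straighten ι w) (𝓝 0) (𝓝 0) := by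
  have := (isGermOfClass_straighten (w := w) hι).self_of_nhds.continuousAt.tendsto
  rwa [straighten_zero h0] at this

lemma isGermOfClass_pullback_straighten (hn : n = ∞ ∨ n = ω) (hι : IsGermOfClass n ι)
    (h0 : ι 0 = 0) (hθ : IsGermOfClass n θ) : IsGermOfClass n (pullback (straighten ι w) θ) := by
  filter_upwards [isGermOfClass_straighten (w := w) hι,
    (tendsto_straighten hι h0).eventually hθ] with x h1 h2
  exact contDiffAt_pullback hn h1 h2

lemma closed_pullback_straighten (hn : n = ∞ ∨ n = ω) (hι : IsGermOfClass n ι)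
    (h0 : ι 0 = 0) (hθ : IsGermOfClass n θ) (hc : ∀ᶠ x in 𝓝 0, extDeriv θ x = 0) :
    ∀ᶠ x in 𝓝 0, extDeriv (pullback (straighten ι w) θ) x = 0 := by
  have hn0 : n ≠ 0 := by rcases hn with rfl | rfl <;> simp
  filter_upwards [isGermOfClass_straighten (w := w) hι,
    (tendsto_straighten hι h0).eventually (hθ.and hc)] with x h1 h2
  have h5 : extDeriv (pullback (straighten ι w) θ) x = _ :=
    extDeriv_pullback (h2.1.differentiableAt hn0) h1 (minSmoothness_two_le hn)
  rw [h5, h2.2]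
  rfl

lemma coeff_pullback_straighten {q : Fin 3 → ℝ} (h : DifferentiableAt ℝ ι q) (a b : Fin 3) :
    coeff (pullback (straighten ι w) θ) a.castSucc b.castSucc (planeIncl q) =
      coeff (pullback ι θ) a b q := by
  have h' : DifferentiableAt ℝ ι (planeProj (planeIncl q)) := by rwa [planeProj_planeIncl]
  rw [coeff_eq_toBilin, coeff_eq_toBilin, toBilin_pullback, toBilin_pullback,
    fderiv_straighten h', fderiv_straighten h', straighten_planeIncl, ← planeIncl_single,
    ← planeIncl_single, planeProj_planeIncl, planeProj_planeIncl, planeProj_planeIncl,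
    planeIncl_last, planeIncl_last, zero_smul, add_zero, add_zero]

lemma coeff_last_pullback_straighten {q : Fin 3 → ℝ} (h : DifferentiableAt ℝ ι q) (a : Fin 3) :
    coeff (pullback (straighten ι w) θ) 3 a.castSucc (planeIncl q) =
      toBilin (Fin 4 → ℝ) (θ (ι q)) w (fderiv ℝ ι q (Pi.single a 1)) := by
  have h' : DifferentiableAt ℝ ι (planeProj (planeIncl q)) := by rwa [planeProj_planeIncl]
  rw [coeff_eq_toBilin, toBilin_pullback, fderiv_straighten h', fderiv_straighten h',
    straighten_planeIncl, ← planeIncl_single, planeProj_planeIncl, planeProj_planeIncl,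
    planeIncl_last, zero_smul, add_zero, planeProj_lastVec, map_zero, zero_add, Pi.single_eq_same,
    one_smul]

lemma germEquiv_pullback_straighten (hn : n = ∞ ∨ n = ω) (hι : IsGermOfClass n ι)
    (h0 : ι 0 = 0) (hinj : Function.Injective (fderiv ℝ ι 0)) (hw : w ∉ Set.range (fderiv ℝ ι 0)) :
    GermEquiv n (pullback (straighten ι w) θ) θ := by
  have hn1 : 1 ≤ n := by rcases hn with rfl | rfl <;> simp
  have hn0 : n ≠ 0 := by rcases hn with rfl | rfl <;> simp
  obtain ⟨e, he⟩ :=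
    exists_equiv_fderiv_straighten (hι.self_of_nhds.differentiableAt hn0) hinj hw
  exact GermEquiv.of_map hn1 (isGermOfClass_straighten hι) (straighten_zero h0) e he
    EventuallyEq.rfl

/-- The square of the pulled-back form is the Jacobian determinant times f ∘ Φ. As f(0) = 0, its
differential at 0 is a nonzero multiple of df ∘ DΦ, hence nonzero; it vanishes along the hyperplane,
so its last component cannot vanish. -/
lemma fderiv_squareCoeff_pullback_straighten_ne_zero (hn : n = ∞ ∨ n = ω) (hι : IsGermOfClass n ι)
    (h0 : ι 0 = 0) (hinj : Function.Injective (fderiv ℝ ι 0)) (hw : w ∉ Set.range (fderiv ℝ ι 0))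
    (hθ : IsGermOfClass n θ) (hs : IsStructurallySmooth θ)
    (hsq : ∀ᶠ q in 𝓝 0, squareCoeff θ (ι q) = 0) :
    fderiv ℝ (squareCoeff (pullback (straighten ι w) θ)) 0 lastVec ≠ 0 := by
  have hn0 : n ≠ 0 := by rcases hn with rfl | rfl <;> simp
  have hn' : n + 1 ≤ n := by rcases hn with rfl | rfl <;> simp
  obtain ⟨e, he⟩ :=
    exists_equiv_fderiv_straighten (hι.self_of_nhds.differentiableAt hn0) hinj hw
  set Φ := straighten ι w with hΦ
  have hΦ0 : Φ 0 = 0 := straighten_zero h0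
  have hΦc : ContDiffAt ℝ n Φ 0 := (isGermOfClass_straighten hι).self_of_nhds
  set D : (Fin 4 → ℝ) → ℝ :=
    fun x => (Matrix.of fun a i => fderiv ℝ Φ x (Pi.single i 1) a).det with hD
  have hDd : DifferentiableAt ℝ D 0 := by
    have h1 : DifferentiableAt ℝ (fderiv ℝ Φ) 0 := (hΦc.fderiv_right hn').differentiableAt hn0
    have h2 : ∀ i a, DifferentiableAt ℝ (fun x => fderiv ℝ Φ x (Pi.single i 1) a) 0 := fun i a =>
      (differentiableAt_pi.1 (h1.clm_apply (differentiableAt_const (Pi.single i 1)))) a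
    simp only [hD, Matrix.det_apply', Matrix.of_apply]
    fun_prop
  have hD0 : D 0 ≠ 0 := by
    have h1 : D 0 = LinearMap.det (e.toLinearEquiv : (Fin 4 → ℝ) →ₗ[ℝ] (Fin 4 → ℝ)) := by
      rw [← LinearMap.det_toMatrix']
      refine congrArg Matrix.det (Matrix.ext fun a i => ?_)
      rw [LinearMap.toMatrix'_apply, Matrix.of_apply, ← he]
      rfl
    rw [h1]
    exact (LinearEquiv.isUnit_det' e.toLinearEquiv).ne_zero
  have hC : ∀ i j, DifferentiableAt ℝ (coeff θ i j) 0 := fun i j =>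
    (contDiffAt_coeff hθ.self_of_nhds i j).differentiableAt hn0
  have hF : DifferentiableAt ℝ (squareCoeff θ) (Φ 0) := by
    rw [hΦ0]
    exact ((((hC 0 1).mul (hC 2 3)).sub ((hC 0 2).mul (hC 1 3))).add
      ((hC 0 3).mul (hC 1 2))).const_mul 2
  have hprod : HasFDerivAt (squareCoeff (pullback Φ θ))
      (D 0 • (fderiv ℝ (squareCoeff θ) (Φ 0)).comp (fderiv ℝ Φ 0) +
        squareCoeff θ (Φ 0) • fderiv ℝ D 0) 0 := by
    have h1 := hDd.hasFDerivAt.mul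
      (hF.hasFDerivAt.comp 0 (hΦc.differentiableAt hn0).hasFDerivAt)
    rwa [show squareCoeff (pullback Φ θ) = D * (squareCoeff θ ∘ Φ) from
      funext fun x => squareCoeff_pullback Φ θ x]
  intro hlast
  have hplane : ∀ a : Fin 3,
      fderiv ℝ (squareCoeff (pullback Φ θ)) 0 (Pi.single a.castSucc 1) = 0 := by
    intro a
    have h1 : squareCoeff (pullback Φ θ) ∘ planeIncl =ᶠ[𝓝 0] fun _ => 0 := by
      filter_upwards [hsq] with q hq
      rw [Function.comp_apply, squareCoeff_pullback, hΦ, straighten_planeIncl, hq, mul_zero]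
    have h2 : HasFDerivAt (squareCoeff (pullback Φ θ) ∘ planeIncl) _ 0 := HasFDerivAt.comp 0
      (by rw [map_zero]; exact hprod.differentiableAt.hasFDerivAt) planeIncl.hasFDerivAt
    have h3 := h2.unique ((hasFDerivAt_const (0 : ℝ) (0 : Fin 3 → ℝ)).congr_of_eventuallyEq h1)
    rw [← planeIncl_single]
    exact congrArg (fun L : (Fin 3 → ℝ) →L[ℝ] ℝ => L (Pi.single a 1)) h3
  have hz : fderiv ℝ (squareCoeff (pullback Φ θ)) 0 = 0 := by
    refine clm_ext_single fun i => ?_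
    cases i using Fin.lastCases with
    | last => exact hlast
    | cast a => exact hplane a
  rw [hprod.fderiv, hΦ0, hs.1, zero_smul, add_zero, smul_eq_zero, or_iff_right hD0, ← he] at hz
  refine hs.2 (ContinuousLinearMap.ext fun v => ?_)
  have := congrArg (fun L : (Fin 4 → ℝ) →L[ℝ] ℝ => L (e.symm v)) hz
  simpa using this

end Straighten

/-! ### Comparison of the two contractions along the hypersurface. -/

section Comparison

variable {n : WithTop ℕ∞} {ω₀ ω₁ : (Fin 4 → ℝ) → (Fin 4 → ℝ) [⋀^Fin 2]→L[ℝ] ℝ}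
  {σ : (Fin 3 → ℝ) → (Fin 3 → ℝ) [⋀^Fin 2]→L[ℝ] ℝ}

/-- The left side is -1/2 times the square: it pairs the contraction with ∂/∂x₃ against the vector
dual to the restriction of η. -/
lemma contract_last_eq_zero {η : (Fin 4 → ℝ) → (Fin 4 → ℝ) [⋀^Fin 2]→L[ℝ] ℝ} {x : Fin 4 → ℝ}
    (h : squareCoeff η x = 0) :
    coeff η 1 2 x * coeff η 3 0 x + coeff η 2 0 x * coeff η 3 1 x +
      coeff η 0 1 x * coeff η 3 2 x = 0 := by
  rw [squareCoeff, coeff_swap η 2 3, coeff_swap η 1 3, coeff_swap η 0 3, coeff_swap η 0 2] at h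
  linear_combination (-1 / 2 : ℝ) * h

/-- Two closed 2-forms with the same restriction `σ` to their common Martinet hypersurface `x₃ = 0`
have proportional contractions with `∂/∂x₃` at the origin, to first order along the contact
direction, if `σ` vanishes at the origin and the ideal of `σ` contains a regular sequence. -/
theorem exists_proportional_contractions (hn : n = ∞ ∨ n = ω)
    (hω₀ : IsGermOfClass n ω₀) (hω₁ : IsGermOfClass n ω₁)
    (hc₀ : ∀ᶠ x in 𝓝 0, extDeriv ω₀ x = 0) (hc₁ : ∀ᶠ x in 𝓝 0, extDeriv ω₁ x = 0)
    (hres₀ : ∀ᶠ q in 𝓝 0, ∀ a b : Fin 3,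
      coeff ω₀ a.castSucc b.castSucc (planeIncl q) = coeff σ a b q)
    (hres₁ : ∀ᶠ q in 𝓝 0, ∀ a b : Fin 3,
      coeff ω₁ a.castSucc b.castSucc (planeIncl q) = coeff σ a b q)
    (hsq₀ : ∀ᶠ q in 𝓝 0, squareCoeff ω₀ (planeIncl q) = 0)
    (hsq₁ : ∀ᶠ q in 𝓝 0, squareCoeff ω₁ (planeIncl q) = 0)
    (hd₀ : fderiv ℝ (squareCoeff ω₀) 0 lastVec ≠ 0) (hd₁ : fderiv ℝ (squareCoeff ω₁) 0 lastVec ≠ 0)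
    (hσn : IsGermOfClass n σ) (hσ : σ 0 = 0) {g₁ g₂ : functionGerms n (Fin 3 → ℝ)}
    (hI : coeffIdeal n σ = Ideal.span {g₁, g₂})
    (hreg : RingTheory.Sequence.IsRegular (functionGerms n (Fin 3 → ℝ)) [g₁, g₂]) :
    (∃ a : Fin 3, coeff ω₀ 3 a.castSucc 0 ≠ 0) ∧
    (∃ k : ℝ, k ≠ 0 ∧ ∀ a : Fin 3, coeff ω₁ 3 a.castSucc 0 = k * coeff ω₀ 3 a.castSucc 0) ∧
      coeff ω₀ 3 0 0 * (fderiv ℝ (coeff ω₁ 3 2) 0 (Pi.single 1 1)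
          - fderiv ℝ (coeff ω₁ 3 1) 0 (Pi.single 2 1)) +
        coeff ω₀ 3 1 0 * (fderiv ℝ (coeff ω₁ 3 0) 0 (Pi.single 2 1)
          - fderiv ℝ (coeff ω₁ 3 2) 0 (Pi.single 0 1)) +
        coeff ω₀ 3 2 0 * (fderiv ℝ (coeff ω₁ 3 1) 0 (Pi.single 0 1)
          - fderiv ℝ (coeff ω₁ 3 0) 0 (Pi.single 1 1)) =
      coeff ω₁ 3 0 0 * (fderiv ℝ (coeff ω₀ 3 2) 0 (Pi.single 1 1)
          - fderiv ℝ (coeff ω₀ 3 1) 0 (Pi.single 2 1)) +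
        coeff ω₁ 3 1 0 * (fderiv ℝ (coeff ω₀ 3 0) 0 (Pi.single 2 1)
          - fderiv ℝ (coeff ω₀ 3 2) 0 (Pi.single 0 1)) +
        coeff ω₁ 3 2 0 * (fderiv ℝ (coeff ω₀ 3 1) 0 (Pi.single 0 1)
          - fderiv ℝ (coeff ω₀ 3 0) 0 (Pi.single 1 1)) := by
  have hn0 : n ≠ 0 := by rcases hn with rfl | rfl <;> simp
  have hσ0 : ∀ a b, coeff σ a b 0 = 0 := fun a b => by rw [coeff, hσ]; rfl
  have hz₀ : ∀ a b : Fin 3, coeff ω₀ a.castSucc b.castSucc 0 = 0 := fun a b => by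
    have := hres₀.self_of_nhds a b
    rwa [map_zero, hσ0] at this
  have hz₁ : ∀ a b : Fin 3, coeff ω₁ a.castSucc b.castSucc 0 = 0 := fun a b => by
    have := hres₁.self_of_nhds a b
    rwa [map_zero, hσ0] at this
  have hD₀ := hω₀.self_of_nhds.differentiableAt hn0
  have hD₁ := hω₁.self_of_nhds.differentiableAt hn0
  have hC₀ : ∀ i j, DifferentiableAt ℝ (coeff ω₀ i j) 0 := fun i j =>
    (contDiffAt_coeff hω₀.self_of_nhds i j).differentiableAt hn0
  have hC₁ : ∀ i j, DifferentiableAt ℝ (coeff ω₁ i j) 0 := fun i j =>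
    (contDiffAt_coeff hω₁.self_of_nhds i j).differentiableAt hn0
  have hne₀ : ∃ a : Fin 3, coeff ω₀ 3 a.castSucc 0 ≠ 0 := by
    by_contra! h
    refine hd₀ ?_
    rw [fderiv_squareCoeff hD₀ hc₀.self_of_nhds (hz₀ 0 1) (hz₀ 0 2) (hz₀ 1 2) hC₀,
      show coeff ω₀ 3 0 0 = 0 from h 0, show coeff ω₀ 3 1 0 = 0 from h 1,
      show coeff ω₀ 3 2 0 = 0 from h 2]
    ring
  have hne₁ : ∃ a : Fin 3, coeff ω₁ 3 a.castSucc 0 ≠ 0 := by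
    by_contra! h
    refine hd₁ ?_
    rw [fderiv_squareCoeff hD₁ hc₁.self_of_nhds (hz₁ 0 1) (hz₁ 0 2) (hz₁ 1 2) hC₁,
      show coeff ω₁ 3 0 0 = 0 from h 0, show coeff ω₁ 3 1 0 = 0 from h 1,
      show coeff ω₁ 3 2 0 = 0 from h 2]
    ring
  set u : Fin 3 → (Fin 3 → ℝ) → ℝ := fun a q => coeff ω₀ 3 a.castSucc (planeIncl q) with hu
  set v : Fin 3 → (Fin 3 → ℝ) → ℝ := fun a q => coeff ω₁ 3 a.castSucc (planeIncl q) with hv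
  have hun : ∀ a, IsGermOfClass n (u a) := fun a => (tendsto_planeIncl.eventually hω₀).mono
    fun q hq => (contDiffAt_coeff hq 3 a.castSucc).comp q planeIncl.contDiff.contDiffAt
  have hvn : ∀ a, IsGermOfClass n (v a) := fun a => (tendsto_planeIncl.eventually hω₁).mono
    fun q hq => (contDiffAt_coeff hq 3 a.castSucc).comp q planeIncl.contDiff.contDiffAt
  -- The cross product u × v, that is, the coefficients of u ∧ v. Both u and v annihilate the vector
  -- dual to σ, which makes Y proportional to that vector.
  set Y : Fin 3 → (Fin 3 → ℝ) → ℝ :=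
    fun a q => u (a + 1) q * v (a + 2) q - u (a + 2) q * v (a + 1) q with hY
  have hYn : ∀ a, IsGermOfClass n (Y a) := fun a => by
    filter_upwards [hun (a + 1), hun (a + 2), hvn (a + 1), hvn (a + 2)] with q h1 h2 h3 h4
    exact (h1.mul h4).sub (h2.mul h3)
  obtain ⟨h, hhn, hh⟩ := exists_factor_of_regular hσn hI hreg hYn (by
    filter_upwards [hres₀, hres₁, hsq₀, hsq₁] with q r₀ r₁ s₀ s₁
    have e₀ : coeff σ 1 2 q * u 0 q + coeff σ 2 0 q * u 1 q + coeff σ 0 1 q * u 2 q = 0 := by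
      rw [← r₀, ← r₀, ← r₀]
      exact contract_last_eq_zero s₀
    have e₁ : coeff σ 1 2 q * v 0 q + coeff σ 2 0 q * v 1 q + coeff σ 0 1 q * v 2 q = 0 := by
      rw [← r₁, ← r₁, ← r₁]
      exact contract_last_eq_zero s₁
    have key : ∀ a : Fin 3, Y a q * coeff σ (a + 2) (a + 3) q =
        Y (a + 1) q * coeff σ (a + 1) (a + 2) q := by
      intro a
      fin_cases a
      · change (u 1 q * v 2 q - u 2 q * v 1 q) * coeff σ 2 0 q =
          (u 2 q * v 0 q - u 0 q * v 2 q) * coeff σ 1 2 q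
        linear_combination v 2 q * e₀ - u 2 q * e₁
      · change (u 2 q * v 0 q - u 0 q * v 2 q) * coeff σ 0 1 q =
          (u 0 q * v 1 q - u 1 q * v 0 q) * coeff σ 2 0 q
        linear_combination v 0 q * e₀ - u 0 q * e₁
      · change (u 0 q * v 1 q - u 1 q * v 0 q) * coeff σ 1 2 q =
          (u 1 q * v 2 q - u 2 q * v 1 q) * coeff σ 0 1 q
        linear_combination v 1 q * e₀ - u 1 q * e₁
    intro a b
    have k0 := key 0
    have k1 := key 1
    have k2 := key 2
    fin_cases a <;> fin_cases b
    · rfl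
    · exact k0
    · exact k2.symm
    · exact k0.symm
    · rfl
    · exact k1
    · exact k2
    · exact k1.symm
    · rfl)
  have hu0 : ∀ a, u a 0 = coeff ω₀ 3 a.castSucc 0 := fun a => by rw [hu]; simp only [map_zero]
  have hv0 : ∀ a, v a 0 = coeff ω₁ 3 a.castSucc 0 := fun a => by rw [hv]; simp only [map_zero]
  have hY0 : ∀ a, Y a 0 = 0 := fun a => by rw [hh.self_of_nhds a, hσ0, mul_zero]
  refine ⟨hne₀, ?_, ?_⟩
  · obtain ⟨a, ha⟩ := hne₀
    have hprop : ∀ b, v b 0 = v a 0 / u a 0 * u b 0 := by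
      intro b
      have ha' : u a 0 ≠ 0 := by rwa [hu0]
      rw [div_mul_eq_mul_div, eq_div_iff ha']
      have y0 : u 1 0 * v 2 0 - u 2 0 * v 1 0 = 0 := hY0 0
      have y1 : u 2 0 * v 0 0 - u 0 0 * v 2 0 = 0 := hY0 1
      have y2 : u 0 0 * v 1 0 - u 1 0 * v 0 0 = 0 := hY0 2
      clear ha ha'
      fin_cases a <;> fin_cases b <;> dsimp only [Fin.zero_eta, Fin.mk_one, Fin.reduceFinMk] <;>
        first
        | ring1
        | linear_combination y0
        | linear_combination y1
        | linear_combination y2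
        | linear_combination -y0
        | linear_combination -y1
        | linear_combination -y2
    -- The ratio k is nonzero because v does not vanish at 0, again by structural smoothness.
    refine ⟨v a 0 / u a 0, fun hk => ?_, fun b => by rw [← hv0, ← hu0]; exact hprop b⟩
    obtain ⟨b, hb⟩ := hne₁
    rw [← hv0, hprop b, hk, zero_mul] at hb
    exact hb rfl
  · have hincl : ∀ {f : (Fin 4 → ℝ) → ℝ}, DifferentiableAt ℝ f 0 →
        HasFDerivAt (fun q => f (planeIncl q)) ((fderiv ℝ f 0).comp planeIncl) 0 := fun hf =>
      HasFDerivAt.comp (g := _) (f := planeIncl) 0 (by rw [map_zero]; exact hf.hasFDerivAt)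
        planeIncl.hasFDerivAt
    have hhd := (hhn.self_of_nhds.differentiableAt hn0).hasFDerivAt
    -- Differentiate u ∧ v = hσ at 0; the term with dh drops out because σ(0) = 0.
    have E : ∀ a b : Fin 3,
        u (a + 1) 0 * fderiv ℝ (coeff ω₁ 3 (a + 2).castSucc) 0 (Pi.single b.castSucc 1) +
          v (a + 2) 0 * fderiv ℝ (coeff ω₀ 3 (a + 1).castSucc) 0 (Pi.single b.castSucc 1) -
        (u (a + 2) 0 * fderiv ℝ (coeff ω₁ 3 (a + 1).castSucc) 0 (Pi.single b.castSucc 1) +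
          v (a + 1) 0 * fderiv ℝ (coeff ω₀ 3 (a + 2).castSucc) 0 (Pi.single b.castSucc 1)) =
        h 0 * fderiv ℝ (coeff ω₀ (a + 1).castSucc (a + 2).castSucc) 0
          (Pi.single b.castSucc 1) := by
      intro a b
      have h1 : HasFDerivAt (Y a) _ 0 :=
        ((hincl (hC₀ 3 (a + 1).castSucc)).mul (hincl (hC₁ 3 (a + 2).castSucc))).sub
          ((hincl (hC₀ 3 (a + 2).castSucc)).mul (hincl (hC₁ 3 (a + 1).castSucc)))
      have h2 := hhd.mul (hincl (hC₀ (a + 1).castSucc (a + 2).castSucc))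
      have h3 := h1.unique (h2.congr_of_eventuallyEq (by
        filter_upwards [hh, hres₀] with q hq hr
        rw [hq a, ← hr]
        rfl))
      have h4 := congrArg (fun L : (Fin 3 → ℝ) →L[ℝ] ℝ => L (Pi.single b 1)) h3
      simp only [add_apply, sub_apply, smul_apply, ContinuousLinearMap.comp_apply,
        planeIncl_single, smul_eq_mul, map_zero, hz₀, zero_mul, add_zero] at h4
      simp only [hu0, hv0] at h4 ⊢
      exact h4
    -- Summing the three diagonal instances of `E` takes the divergence: the right side becomes h dσ
    -- = 0 and the left side is d(u ∧ v).
    have hcl := closed_coeff hD₀ hc₀.self_of_nhds 0 1 2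
    have hsw : fderiv ℝ (coeff ω₀ 2 0) 0 (Pi.single 1 1) =
        -fderiv ℝ (coeff ω₀ 0 2) 0 (Pi.single 1 1) := by
      rw [fderiv_coeff hD₀, fderiv_coeff hD₀, toBilin_swap]
    have E0 := E 0 0
    have E1 := E 1 1
    have E2 := E 2 2
    simp only [hu0, hv0] at E0 E1 E2
    change coeff ω₀ 3 1 0 * fderiv ℝ (coeff ω₁ 3 2) 0 (Pi.single 0 1) +
      coeff ω₁ 3 2 0 * fderiv ℝ (coeff ω₀ 3 1) 0 (Pi.single 0 1) -
      (coeff ω₀ 3 2 0 * fderiv ℝ (coeff ω₁ 3 1) 0 (Pi.single 0 1) +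
      coeff ω₁ 3 1 0 * fderiv ℝ (coeff ω₀ 3 2) 0 (Pi.single 0 1)) =
      h 0 * fderiv ℝ (coeff ω₀ 1 2) 0 (Pi.single 0 1) at E0
    change coeff ω₀ 3 2 0 * fderiv ℝ (coeff ω₁ 3 0) 0 (Pi.single 1 1) +
      coeff ω₁ 3 0 0 * fderiv ℝ (coeff ω₀ 3 2) 0 (Pi.single 1 1) -
      (coeff ω₀ 3 0 0 * fderiv ℝ (coeff ω₁ 3 2) 0 (Pi.single 1 1) +
      coeff ω₁ 3 2 0 * fderiv ℝ (coeff ω₀ 3 0) 0 (Pi.single 1 1)) =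
      h 0 * fderiv ℝ (coeff ω₀ 2 0) 0 (Pi.single 1 1) at E1
    change coeff ω₀ 3 0 0 * fderiv ℝ (coeff ω₁ 3 1) 0 (Pi.single 2 1) +
      coeff ω₁ 3 1 0 * fderiv ℝ (coeff ω₀ 3 0) 0 (Pi.single 2 1) -
      (coeff ω₀ 3 1 0 * fderiv ℝ (coeff ω₁ 3 0) 0 (Pi.single 2 1) +
      coeff ω₁ 3 0 0 * fderiv ℝ (coeff ω₀ 3 1) 0 (Pi.single 2 1)) =
      h 0 * fderiv ℝ (coeff ω₀ 0 1) 0 (Pi.single 2 1) at E2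
    linear_combination (-1 : ℝ) * (E0 + E1 + E2) - h 0 * hcl - h 0 * hsw

end Comparison

/-! ### The theorem: choice of the transverse direction and conclusion. -/

lemma exists_notMem_range_clm (A : (Fin 3 → ℝ) →L[ℝ] (Fin 4 → ℝ)) : ∃ w, w ∉ Set.range A := by
  by_contra! h
  have := LinearMap.finrank_le_finrank_of_surjective (f := A.toLinearMap) h
  simp at this

theorem mainTheorem6 (n : WithTop ℕ∞) (hn : n = ∞ ∨ n = ω)
    (ω₀ ω₁ : (Fin 4 → ℝ) → (Fin 4 → ℝ) [⋀^Fin 2]→L[ℝ] ℝ)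
    (hω₀ : IsSingularSymplecticGerm n ω₀) (hω₁ : IsSingularSymplecticGerm n ω₁)
    (hs₀ : IsStructurallySmooth ω₀) (hs₁ : IsStructurallySmooth ω₁)
    (hM : ∀ᶠ x in 𝓝 (0 : Fin 4 → ℝ), x ∈ martinet ω₀ ↔ x ∈ martinet ω₁)
    (ι : (Fin 3 → ℝ) → (Fin 4 → ℝ)) (hι : IsLocalParametrization n ι (martinet ω₀))
    (σ : (Fin 3 → ℝ) → (Fin 3 → ℝ) [⋀^Fin 2]→L[ℝ] ℝ)
    (hσ₀ : pullback ι ω₀ =ᶠ[𝓝 0] σ) (hσ₁ : pullback ι ω₁ =ᶠ[𝓝 0] σ)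
    (hσ : σ 0 = 0)
    (g₁ g₂ : functionGerms n (Fin 3 → ℝ))
    (hI : coeffIdeal n σ = Ideal.span {g₁, g₂})
    (hreg : RingTheory.Sequence.IsRegular (functionGerms n (Fin 3 → ℝ)) [g₁, g₂]) :
    ∃ Ψ : OpenPartialHomeomorph (Fin 4 → ℝ) (Fin 4 → ℝ),
      IsDiffeoGerm n Ψ ∧ pullback Ψ ω₁ =ᶠ[𝓝 0] ω₀ := by
  have hn0 : n ≠ 0 := by rcases hn with rfl | rfl <;> simp
  have hn1 : 1 ≤ n := by rcases hn with rfl | rfl <;> simp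
  have hι0 := hι.map_zero
  have hιt : Tendsto ι (𝓝 0) (𝓝[martinet ω₀] 0) := hι.map_nhds.le
  have hιt' : Tendsto ι (𝓝 0) (𝓝 0) := hιt.mono_right nhdsWithin_le_nhds
  have hsq₀ : ∀ᶠ q in 𝓝 0, squareCoeff ω₀ (ι q) = 0 := hιt.eventually self_mem_nhdsWithin
  have hsq₁ : ∀ᶠ q in 𝓝 0, squareCoeff ω₁ (ι q) = 0 := by
    filter_upwards [hsq₀, hιt'.eventually hM] with q h1 h2
    exact h2.1 h1
  have hσn : IsGermOfClass n σ := by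
    filter_upwards [hι.isGermOfClass, hιt'.eventually hω₀.isGermOfClass,
      hσ₀.eventuallyEq_nhds] with q h1 h2 h3
    exact (contDiffAt_pullback hn h1 h2).congr_of_eventuallyEq h3.symm
  have hres : ∀ {θ : (Fin 4 → ℝ) → (Fin 4 → ℝ) [⋀^Fin 2]→L[ℝ] ℝ}, pullback ι θ =ᶠ[𝓝 0] σ →
      ∀ w, ∀ᶠ q in 𝓝 0, ∀ a b : Fin 3,
        coeff (pullback (straighten ι w) θ) a.castSucc b.castSucc (planeIncl q) =
          coeff σ a b q := by
    intro θ hθ w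
    filter_upwards [hι.isGermOfClass, hθ] with q h1 h2 a b
    rw [coeff_pullback_straighten (h1.differentiableAt hn0), coeff, coeff, h2]
  have hsq : ∀ {θ : (Fin 4 → ℝ) → (Fin 4 → ℝ) [⋀^Fin 2]→L[ℝ] ℝ},
      (∀ᶠ q in 𝓝 0, squareCoeff θ (ι q) = 0) →
      ∀ w, ∀ᶠ q in 𝓝 0, squareCoeff (pullback (straighten ι w) θ) (planeIncl q) = 0 := by
    intro θ hθ w
    filter_upwards [hθ] with q h
    rw [squareCoeff_pullback, straighten_planeIncl, h, mul_zero]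
  have hflat : ∀ {P : (Fin 3 → ℝ) → Prop}, (∀ᶠ q in 𝓝 0, P q) →
      ∀ᶠ x in 𝓝 (0 : Fin 4 → ℝ), P (planeProj x) := fun hP => tendsto_planeProj.eventually hP
  obtain ⟨w, hw⟩ := exists_notMem_range_clm (fderiv ℝ ι 0)
  have hw' : -w ∉ Set.range (fderiv ℝ ι 0) := by
    rintro ⟨v, hv⟩
    exact hw ⟨-v, by rw [map_neg, hv, neg_neg]⟩
  -- The two forms may be straightened with different transverse vectors: the charts agree on x₃ =
  -- 0, so the restriction to the hyperplane is σ in both.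
  have hcomp := fun w₁ (hw₁ : w₁ ∉ Set.range (fderiv ℝ ι 0)) =>
    exists_proportional_contractions hn
      (isGermOfClass_pullback_straighten (w := w) hn hι.isGermOfClass hι0 hω₀.isGermOfClass)
      (isGermOfClass_pullback_straighten (w := w₁) hn hι.isGermOfClass hι0 hω₁.isGermOfClass)
      (closed_pullback_straighten hn hι.isGermOfClass hι0 hω₀.isGermOfClass hω₀.closed)
      (closed_pullback_straighten hn hι.isGermOfClass hι0 hω₁.isGermOfClass hω₁.closed)
      (hres hσ₀ w) (hres hσ₁ w₁) (hsq hsq₀ w) (hsq hsq₁ w₁)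
      (fderiv_squareCoeff_pullback_straighten_ne_zero hn hι.isGermOfClass hι0 hι.immersion hw
        hω₀.isGermOfClass hs₀ hsq₀)
      (fderiv_squareCoeff_pullback_straighten_ne_zero hn hι.isGermOfClass hι0 hι.immersion hw₁
        hω₁.isGermOfClass hs₁ hsq₁) hσn hσ hI hreg
  have hequiv : ∀ w₁, w₁ ∉ Set.range (fderiv ℝ ι 0) → ∀ k : ℝ, 0 < k →
      (∀ a : Fin 3, coeff (pullback (straighten ι w₁) ω₁) 3 a.castSucc 0 =
        k * coeff (pullback (straighten ι w) ω₀) 3 a.castSucc 0) → GermEquiv n ω₀ ω₁ := by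
    intro w₁ hw₁ k hk0 hk
    have h1 := germEquiv_pullback_straighten (θ := ω₀) hn hι.isGermOfClass hι0 hι.immersion hw
    have h2 := germEquiv_pullback_straighten (θ := ω₁) hn hι.isGermOfClass hι0 hι.immersion hw₁
    refine (h1.symm hn1).trans hn1 (GermEquiv.trans hn1 ?_ h2)
    refine germEquiv_of_flat (k := k) hn
      (isGermOfClass_pullback_straighten hn hι.isGermOfClass hι0 hω₀.isGermOfClass)
      (isGermOfClass_pullback_straighten hn hι.isGermOfClass hι0 hω₁.isGermOfClass)
      (closed_pullback_straighten hn hι.isGermOfClass hι0 hω₀.isGermOfClass hω₀.closed)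
      (closed_pullback_straighten hn hι.isGermOfClass hι0 hω₁.isGermOfClass hω₁.closed)
      ?_ ?_ ?_ ?_
      (fderiv_squareCoeff_pullback_straighten_ne_zero hn hι.isGermOfClass hι0 hι.immersion hw
        hω₀.isGermOfClass hs₀ hsq₀) hk0 ?_ (hcomp w₁ hw₁).2.2
    · filter_upwards [hflat (hres hσ₀ w), hflat (hres hσ₁ w₁)] with x r₀ r₁ hx i j hi hj
      cases i using Fin.lastCases with
      | last => exact absurd rfl hi
      | cast a =>
        cases j using Fin.lastCases with
        | last => exact absurd rfl hj
        | cast b =>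
          have := (r₀ a b).trans (r₁ a b).symm
          rwa [planeIncl_planeProj hx] at this
    · intro i j hi hj
      cases i using Fin.lastCases with
      | last => exact absurd rfl hi
      | cast a =>
        cases j using Fin.lastCases with
        | last => exact absurd rfl hj
        | cast b =>
          have := (hres hσ₀ w).self_of_nhds a b
          rw [map_zero] at this
          rw [this, coeff, hσ]
          rfl
    · filter_upwards [hflat (hsq hsq₀ w)] with x h hx
      rwa [planeIncl_planeProj hx] at h
    · filter_upwards [hflat (hsq hsq₁ w₁)] with x h hx
      rwa [planeIncl_planeProj hx] at h
    · intro i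
      cases i using Fin.lastCases with
      | last =>
        have h0 : ∀ θ : (Fin 4 → ℝ) → (Fin 4 → ℝ) [⋀^Fin 2]→L[ℝ] ℝ, coeff θ 3 3 0 = 0 :=
          fun θ => by linarith [coeff_swap θ 3 3 0]
        change coeff _ 3 3 0 = k * coeff _ 3 3 0
        rw [h0, h0, mul_zero]
      | cast a => exact hk a
  obtain ⟨⟨a, ha⟩, ⟨k, hk0, hk⟩, -⟩ := hcomp w hw
  -- For k < 0, replacing w by -w in the chart of ω₁ alone reverses its contraction along the
  -- hyperplane and turns k into -k.
  rcases hk0.lt_or_gt with hneg | hpos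
  · refine hequiv (-w) hw' (-k) (neg_pos.2 hneg) fun a => ?_
    have hd := hι.isGermOfClass.self_of_nhds.differentiableAt hn0
    have e1 := coeff_last_pullback_straighten (w := w) (θ := ω₁) hd a
    have e2 := coeff_last_pullback_straighten (w := -w) (θ := ω₁) hd a
    rw [map_zero] at e1 e2
    rw [e2, map_neg, neg_apply, ← e1, hk a, neg_mul]
  · exact hequiv w hw k hpos hk
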